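/- All trees are finite rooted trees; the size of a tree is its number of vertices, and $\log=\log_2$. A straight-line drawing of a tree places its vertices at distinct points of $\mathbb{Z}^2$ and its edges as straight segments, such that no edge passes through a vertex other than its endpoints and two distinct edges meet at most in a common endpoint. The width (respectively height) of a drawing is the number of grid columns (respectively rows) occupied by its axis-parallel bounding box. A (drawing) algorithm is a procedure that assigns to integers $n,A$ and a tree of size $n$ a position in $\mathbb{Z}^2$ for each of its vertices; no bound on running time is asserted. There is an absolute constant $C>0$ such that the following holds. Let $f_0,g_0:\mathbb{N}\to\mathbb{R}$ be nondecreasing functions with $f_0(n)\ge g_0(n)$ for all $n$. Suppose we are given a general algorithm $\mathcal{G}_0$ that, for all integers $n\ge 2$ and $A$ with $n\ge A\ge 1$, $A\ge g_0(n)$, and for every tree of size $n$, outputs a straight-line drawing of width at most $A$ and height at most $(n/A)f_0(A)$, with the root at the top left corner of the bounding box. Then for every integer $s\ge 1$ there is an (improved) general algorithm that, for all integers $n\ge A\ge 1$ with $A\ge\log s$ and $(A,s)\ne(1,1)$, and for every tree of size $n$, outputs a straight-line drawing of width at most $$C\,(A+\log n)$$ and height at most $$C\left(\frac nA\log A+\frac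 nA f_0(s)\log^2 s+\frac ns\log A\right),$$ with the root at the top left corner of the bounding box. -/

import Mathlib

namespace TreeDrawing

/-- A rooted (unordered) tree of size `n`, with vertex set `Fin n`. -/
structure LabelledTree (n : ℕ) where
  graph : SimpleGraph (Fin n)
  isTree : graph.IsTree
  root : Fin n

/-- A grid point, seen as a point of the real plane. -/
def toPlane (p : ℤ × ℤ) : ℝ × ℝ := ((p.1 : ℝ), (p.2 : ℝ))

/-- The closed straight-line segment between two grid points. -/
def seg (p q : ℤ × ℤ) : Set (ℝ × ℝ) := segment ℝ (toPlane p) (toPlane q)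

/-- `pos` is a (planar) straight-line grid drawing of `G`: distinct vertices are drawn at distinct
points of the integer grid, the edge `uv` is drawn as the segment from `pos u` to `pos v`, no edge
passes through a vertex other than its endpoints, and two distinct edges meet at most in
a common endpoint. -/
structure IsStraightLineDrawing {V : Type*} (G : SimpleGraph V) (pos : V → ℤ × ℤ) : Prop where
  injective : Function.Injective pos
  vertex_notMem_edge : ∀ u v w : V, G.Adj u v → w ≠ u → w ≠ v →
    toPlane (pos w) ∉ seg (pos u) (pos v)
  planar : ∀ u v x y : V, G.Adj u v → G.Adj x y → s(u, v) ≠ s(x, y) →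
    seg (pos u) (pos v) ∩ seg (pos x) (pos y) ⊆
      (fun w => toPlane (pos w)) '' (({u, v} : Set V) ∩ {x, y})

/-- The width of (the bounding box of) a drawing of a finite nonempty vertex set: the number of
grid columns that the box occupies, so that an `a × b` grid has width `a`. -/
noncomputable def width {V : Type*} (pos : V → ℤ × ℤ) : ℤ :=
  (⨆ v, (pos v).1) - (⨅ v, (pos v).1) + 1

/-- The height of (the bounding box of) a drawing of a finite nonempty vertex set: the number of
grid rows that the box occupies, so that an `a × b` grid has height `b`. -/
noncomputable def height {V : Type*} (pos : V → ℤ × ℤ) : ℤ :=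
  (⨆ v, (pos v).2) - (⨅ v, (pos v).2) + 1

/-- The vertex `r` lies at the top left corner of the bounding box of the drawing. -/
def AtTopLeft {V : Type*} (pos : V → ℤ × ℤ) (r : V) : Prop :=
  (pos r).1 = (⨅ v, (pos v).1) ∧ (pos r).2 = (⨆ v, (pos v).2)

/-- A drawing procedure: given the size `n`, the parameter `A` and a rooted tree of size `n`, it
outputs a grid point for every vertex. -/
abbrev Algorithm : Type := (n A : ℕ) → LabelledTree n → Fin n → ℤ × ℤ

/-- On the input `n`, `A`, `T`, the output of `𝒢` is a straight-line drawing of `T` with the root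
at the top left corner, of width at most `W` and height at most `H`. -/
def Algorithm.Draws (𝒢 : Algorithm) {n : ℕ} (A : ℕ) (T : LabelledTree n) (W H : ℝ) : Prop :=
  IsStraightLineDrawing T.graph (𝒢 n A T) ∧ AtTopLeft (𝒢 n A T) T.root ∧
    (width (𝒢 n A T) : ℝ) ≤ W ∧ (height (𝒢 n A T) : ℝ) ≤ H

/-- `𝒢` is a general algorithm with bounds `f₀`, `g₀`: for all `n ≥ A ≥ g₀ n` and every tree of
size `n`, it gives a drawing of width at most `A` and height at most `(n / A) f₀(A)`. Nothing is
asked for the one-vertex tree, so that bounds such as `f₀ A = C A log A`, which vanish at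
`A = 1`, are covered. -/
def IsGeneralAlgorithm (f₀ g₀ : ℕ → ℝ) (𝒢 : Algorithm) : Prop :=
  ∀ (n A : ℕ) (T : LabelledTree n), 2 ≤ n → 1 ≤ A → A ≤ n → g₀ n ≤ (A : ℝ) →
    𝒢.Draws A T (A : ℝ) (((n : ℝ) / A) * f₀ A)

end TreeDrawing

/-! The drawing is built recursively along heavy paths, the second coordinate growing downwards. The
basic object is a star: a vertex v at the origin together with the subtrees at some of its children.
A star is drawn inside a region of the real plane, and stars at v whose regions meet only in the
origin can be superposed (`StarDraw.union`). Planarity is only checked locally, at each vertex;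
`Plane.straight` shows that this suffices.

Let F be the minimum of s and the rounded value of f₀(s). The given algorithm is used only for stars
of size m ≤ s, which it draws in a columns and mF/a rows whenever F ≤ a ≤ m (`SmallStars`).

For a subtree with more than A vertices there are two cases.

If the root and its light subtrees together have at most A vertices, the heavy path is followed
until about A vertices are collected, or until a vertex with a larger light part is next. This
section is drawn along one row, with its light subtrees hanging side by side, in O(A) columns and
O(log A) rows (`draw_chunk`); the rest goes below. The light subtrees use the flat drawing
`rootDraw_flat`, in n columns and O(log n) rows.

Otherwise `draw_big` splits the light children by size. Those below s are packed into stars of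
bounded size. Each star is drawn in a square by the given algorithm, and the squares are mapped by
integer matrices of determinant 1 into disjoint cones with apex v. A positive fraction of the
lattice points of a P × Q box are primitive, so there are enough cones with short generators, and m
vertices cost O(F(m/A + 1)) rows. The subtrees too large for this are drawn side by side. Children
of size between s and A get flat drawings arranged in staircases: one row per root, which gives the
term n/s, and O(log A) rows per bin of width A. Larger light children are drawn recursively and
stacked, one column to the right. Since log of the size drops by one, this costs log n columns in
all. The heavy child goes below everything.

The heights are added up in `exists_draw` by an induction that keeps a credit of several times the
cost of one step. For s = 1 or A = 1 the standard drawing is good enough; otherwise s is replaced by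
min(s, A). The factor log² s enters only through being at least 1 for s ≥ 2. -/

namespace TreeDrawing

/-! ### Rooted forests and local planarity -/

/-- The children and the sets of descendants of the vertices of a rooted forest. -/
structure ChildSystem (V : Type*) [DecidableEq V] where
  kids : V → Finset V
  desc : V → Finset V
  desc_eq : ∀ v, desc v = insert v ((kids v).biUnion desc)
  notMem : ∀ v, ∀ c ∈ kids v, v ∉ desc c
  disj : ∀ v, ∀ c ∈ kids v, ∀ d ∈ kids v, c ≠ d → Disjoint (desc c) (desc d)

namespace ChildSystem

variable {V : Type*} [DecidableEq V] (S : ChildSystem V)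

/-- The size of the subtree rooted at `v`. -/
def size (v : V) : ℕ := (S.desc v).card

lemma mem_desc {v x : V} : x ∈ S.desc v ↔ x = v ∨ ∃ c ∈ S.kids v, x ∈ S.desc c := by
  rw [S.desc_eq v]; simp

lemma self_mem (v : V) : v ∈ S.desc v := S.mem_desc.2 (Or.inl rfl)

lemma desc_subset_of_kid {v c : V} (h : c ∈ S.kids v) : S.desc c ⊆ S.desc v :=
  fun _ hx => S.mem_desc.2 (Or.inr ⟨c, h, hx⟩)

lemma size_pos (v : V) : 0 < S.size v := Finset.card_pos.2 ⟨v, S.self_mem v⟩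

lemma size_eq (v : V) : S.size v = 1 + ∑ c ∈ S.kids v, S.size c := by
  unfold size
  rw [S.desc_eq v, Finset.card_insert_of_notMem, Finset.card_biUnion, add_comm]
  · exact fun c hc d hd h => S.disj v c hc d hd h
  · simp only [Finset.mem_biUnion, not_exists, not_and]
    exact fun c hc => S.notMem v c hc

lemma size_kid_lt {v c : V} (h : c ∈ S.kids v) : S.size c < S.size v := by
  have := Finset.single_le_sum (f := S.size) (fun _ _ => Nat.zero_le _) h
  rw [S.size_eq v]; omega

lemma desc_subset {v x : V} (h : x ∈ S.desc v) : S.desc x ⊆ S.desc v := by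
  induction hn : S.size v using Nat.strong_induction_on generalizing v with
  | _ n ih =>
    rcases S.mem_desc.1 h with rfl | ⟨c, hc, hx⟩
    · exact subset_rfl
    · exact (ih _ (hn ▸ S.size_kid_lt hc) hx rfl).trans (S.desc_subset_of_kid hc)

lemma kid_mem_desc {v c : V} (h : c ∈ S.kids v) : c ∈ S.desc v :=
  S.desc_subset_of_kid h (S.self_mem c)

lemma kid_mem_desc_of_mem {v x c : V} (hx : x ∈ S.desc v) (h : c ∈ S.kids x) : c ∈ S.desc v :=
  S.desc_subset hx (S.kid_mem_desc h)

variable (pos pos' : V → ℤ × ℤ)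

/-- The points of the plane covered by the drawing of the subtree rooted at `v`. -/
def supp (v : V) : Set (ℝ × ℝ) :=
  ⋃ x ∈ S.desc v, ({toPlane (pos x)} ∪ ⋃ c ∈ S.kids x, seg (pos x) (pos c))

/-- The drawing of the subtree at `c` together with the edge from its parent `v`. -/
def arm (v c : V) : Set (ℝ × ℝ) := seg (pos v) (pos c) ∪ S.supp pos c

/-- The drawing of `v` and of the subtrees at the children in `B`. -/
def starSupp (v : V) (B : Finset V) : Set (ℝ × ℝ) := {toPlane (pos v)} ∪ ⋃ c ∈ B, S.arm pos v c

/-- The arms from `v` to the children in `B` do not overlap. -/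
def Local (v : V) (B : Finset V) : Prop :=
  (∀ c ∈ B, pos v ≠ pos c ∧ seg (pos v) (pos c) ∩ S.supp pos c ⊆ {toPlane (pos c)}) ∧
  ∀ c ∈ B, ∀ d ∈ B, c ≠ d → S.arm pos v c ∩ S.arm pos v d ⊆ {toPlane (pos v)}

/-- The drawing of the subtree rooted at `v` is planar. -/
def Plane (v : V) : Prop := ∀ x ∈ S.desc v, S.Local pos x (S.kids x)

variable {pos pos'}

lemma mem_supp_of_mem {v x : V} (h : x ∈ S.desc v) : toPlane (pos x) ∈ S.supp pos v := by
  simp only [supp, Set.mem_iUnion]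
  exact ⟨x, h, Or.inl rfl⟩

lemma seg_subset_supp {v x c : V} (h : x ∈ S.desc v) (hc : c ∈ S.kids x) :
    seg (pos x) (pos c) ⊆ S.supp pos v := by
  intro p hp
  simp only [supp, Set.mem_iUnion]
  refine ⟨x, h, Or.inr ?_⟩
  simp only [Set.mem_iUnion]
  exact ⟨c, hc, hp⟩

lemma supp_subset_of_mem {v x : V} (h : x ∈ S.desc v) : S.supp pos x ⊆ S.supp pos v := by
  unfold supp
  exact Set.biUnion_subset_biUnion_left (fun y hy => S.desc_subset h hy)

lemma supp_eq (v : V) : S.supp pos v = S.starSupp pos v (S.kids v) := by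
  apply Set.Subset.antisymm
  · intro p hp
    simp only [supp, Set.mem_iUnion] at hp
    obtain ⟨x, hx, hp⟩ := hp
    rcases S.mem_desc.1 hx with rfl | ⟨c, hc, hx⟩
    · rcases hp with hp | hp
      · exact Or.inl hp
      · simp only [Set.mem_iUnion] at hp
        obtain ⟨c, hc, hp⟩ := hp
        refine Or.inr ?_
        simp only [Set.mem_iUnion]
        exact ⟨c, hc, Or.inl hp⟩
    · refine Or.inr ?_
      simp only [Set.mem_iUnion]
      refine ⟨c, hc, Or.inr ?_⟩
      simp only [supp, Set.mem_iUnion]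
      exact ⟨x, hx, hp⟩
  · rintro p (hp | hp)
    · rw [hp]; exact S.mem_supp_of_mem (S.self_mem v)
    · simp only [Set.mem_iUnion] at hp
      obtain ⟨c, hc, hp | hp⟩ := hp
      · exact S.seg_subset_supp (S.self_mem v) hc hp
      · exact S.supp_subset_of_mem (S.kid_mem_desc hc) hp

lemma supp_congr {v : V} (h : ∀ x ∈ S.desc v, pos x = pos' x) :
    S.supp pos v = S.supp pos' v := by
  unfold supp
  refine Set.iUnion₂_congr fun x hx => ?_
  rw [h x hx]
  congr 1
  refine Set.iUnion₂_congr fun c hc => ?_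
  rw [h c (S.kid_mem_desc_of_mem hx hc)]

lemma arm_congr {v c : V} (hv : pos v = pos' v) (h : ∀ x ∈ S.desc c, pos x = pos' x) :
    S.arm pos v c = S.arm pos' v c := by
  unfold arm
  rw [S.supp_congr h, hv, h c (S.self_mem c)]

lemma Local.congr {v : V} {B : Finset V} (hl : S.Local pos v B) (hv : pos v = pos' v)
    (h : ∀ c ∈ B, ∀ x ∈ S.desc c, pos x = pos' x) : S.Local pos' v B := by
  refine ⟨fun c hc => ?_, fun c hc d hd hcd => ?_⟩
  · have := hl.1 c hc
    rwa [S.supp_congr (h c hc), hv, h c hc c (S.self_mem c)] at this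
  · have := hl.2 c hc d hd hcd
    rwa [S.arm_congr hv (h c hc), S.arm_congr hv (h d hd), hv] at this

lemma Plane.congr {v : V} (hp : S.Plane pos v) (h : ∀ x ∈ S.desc v, pos x = pos' x) :
    S.Plane pos' v := by
  intro x hx
  refine (hp x hx).congr S (h x hx) fun c hc y hy => h y ?_
  exact S.desc_subset (S.kid_mem_desc_of_mem hx hc) hy

lemma starSupp_congr {v : V} {B : Finset V} (hv : pos v = pos' v)
    (h : ∀ c ∈ B, ∀ x ∈ S.desc c, pos x = pos' x) : S.starSupp pos v B = S.starSupp pos' v B := by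
  unfold starSupp
  rw [hv]
  congr 1
  exact Set.iUnion₂_congr fun c hc => S.arm_congr hv (h c hc)

lemma plane_iff {v : V} :
    S.Plane pos v ↔ S.Local pos v (S.kids v) ∧ ∀ c ∈ S.kids v, S.Plane pos c := by
  constructor
  · exact fun h => ⟨h v (S.self_mem v), fun c hc x hx => h x (S.desc_subset_of_kid hc hx)⟩
  · rintro ⟨h1, h2⟩ x hx
    rcases S.mem_desc.1 hx with rfl | ⟨c, hc, hx⟩
    · exact h1
    · exact h2 c hc x hx

lemma arm_subset_starSupp {v c : V} {B : Finset V} (hc : c ∈ B) :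
    S.arm pos v c ⊆ S.starSupp pos v B := by
  intro p hp
  refine Or.inr ?_
  simp only [Set.mem_iUnion]
  exact ⟨c, hc, hp⟩

/-! ### Affine images of drawings -/

section Affine

variable {φ : ℤ × ℤ → ℤ × ℤ} {Φ : ℝ × ℝ →ᵃ[ℝ] ℝ × ℝ}

lemma seg_map (h : ∀ p, toPlane (φ p) = Φ (toPlane p)) (p q : ℤ × ℤ) :
    seg (φ p) (φ q) = Φ '' seg p q := by
  unfold seg
  rw [h, h, image_segment]

lemma supp_map (h : ∀ p, toPlane (φ p) = Φ (toPlane p)) (v : V) :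
    S.supp (fun x => φ (pos x)) v = Φ '' S.supp pos v := by
  unfold supp
  simp only [Set.image_iUnion, Set.image_union, Set.image_singleton, seg_map h, h]

lemma arm_map (h : ∀ p, toPlane (φ p) = Φ (toPlane p)) (v c : V) :
    S.arm (fun x => φ (pos x)) v c = Φ '' S.arm pos v c := by
  unfold arm
  rw [S.supp_map h, Set.image_union, seg_map h]

lemma starSupp_map (h : ∀ p, toPlane (φ p) = Φ (toPlane p)) (v : V) (B : Finset V) :
    S.starSupp (fun x => φ (pos x)) v B = Φ '' S.starSupp pos v B := by
  unfold starSupp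
  simp only [Set.image_iUnion, Set.image_union, Set.image_singleton, S.arm_map h, h]

lemma toPlane_injective : Function.Injective toPlane := by
  rintro ⟨a, b⟩ ⟨c, d⟩ h
  simpa [toPlane] using h

lemma Local.map {v : V} {B : Finset V} (hl : S.Local pos v B)
    (h : ∀ p, toPlane (φ p) = Φ (toPlane p)) (hΦ : Function.Injective Φ) :
    S.Local (fun x => φ (pos x)) v B := by
  refine ⟨fun c hc => ⟨fun he => (hl.1 c hc).1 ?_, ?_⟩, fun c hc d hd hcd => ?_⟩
  · apply toPlane_injective
    apply hΦ
    rw [← h, ← h]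
    exact congrArg toPlane he
  · rw [S.supp_map h, seg_map h, ← Set.image_inter hΦ, h, ← Set.image_singleton]
    exact Set.image_mono (hl.1 c hc).2
  · rw [S.arm_map h, S.arm_map h, ← Set.image_inter hΦ, h, ← Set.image_singleton]
    exact Set.image_mono (hl.2 c hc d hd hcd)

lemma Plane.map {v : V} (hp : S.Plane pos v) (h : ∀ p, toPlane (φ p) = Φ (toPlane p))
    (hΦ : Function.Injective Φ) : S.Plane (fun x => φ (pos x)) v :=
  fun x hx => (hp x hx).map S h hΦ

end Affine

/-! ### Stars drawn inside prescribed regions -/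

/-- There is a planar drawing of `v`, at the origin, and of the subtrees at the children in `B`,
inside the region `R`. -/
def StarDraw (v : V) (B : Finset V) (R : Set (ℝ × ℝ)) : Prop :=
  ∃ pos : V → ℤ × ℤ, pos v = 0 ∧ S.Local pos v B ∧ (∀ c ∈ B, S.Plane pos c) ∧
    S.starSupp pos v B ⊆ R

variable {S}

lemma StarDraw.mono {v : V} {B : Finset V} {R R' : Set (ℝ × ℝ)} (h : S.StarDraw v B R)
    (hR : R ⊆ R') : S.StarDraw v B R' := by
  obtain ⟨pos, h1, h2, h3, h4⟩ := h
  exact ⟨pos, h1, h2, h3, h4.trans hR⟩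

lemma toPlane_zero : toPlane 0 = 0 := by simp [toPlane]

lemma StarDraw.zero_mem {v : V} {B : Finset V} {R : Set (ℝ × ℝ)} (h : S.StarDraw v B R) :
    (0 : ℝ × ℝ) ∈ R := by
  obtain ⟨pos, h1, h2, h3, h4⟩ := h
  refine h4 (Or.inl ?_)
  rw [h1, toPlane_zero]; rfl

lemma starDraw_empty (v : V) : S.StarDraw v ∅ {0} := by
  refine ⟨fun _ => 0, rfl, ⟨by simp, by simp⟩, by simp, ?_⟩
  simp [starSupp, toPlane_zero]

/-- The linear map with columns `u` and `w`. -/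
def colMap (u w : ℤ × ℤ) (p : ℝ × ℝ) : ℝ × ℝ :=
  (p.1 * u.1 + p.2 * w.1, p.1 * u.2 + p.2 * w.2)

lemma StarDraw.colMap {v : V} {B : Finset V} {R : Set (ℝ × ℝ)} (h : S.StarDraw v B R)
    (u w : ℤ × ℤ) (hd : u.1 * w.2 - u.2 * w.1 ≠ 0) : S.StarDraw v B (colMap u w '' R) := by
  obtain ⟨pos, h1, h2, h3, h4⟩ := h
  let Φ : ℝ × ℝ →ₗ[ℝ] ℝ × ℝ :=
    { toFun := ChildSystem.colMap u w
      map_add' := fun p q => by ext <;> simp [ChildSystem.colMap] <;> ring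
      map_smul' := fun r p => by ext <;> simp [ChildSystem.colMap] <;> ring }
  let φ : ℤ × ℤ → ℤ × ℤ := fun p => (p.1 * u.1 + p.2 * w.1, p.1 * u.2 + p.2 * w.2)
  have hφ : ∀ p, toPlane (φ p) = Φ.toAffineMap (toPlane p) := by
    intro p
    simp [φ, Φ, toPlane, ChildSystem.colMap]
  have hd' : (u.1 * w.2 - u.2 * w.1 : ℝ) ≠ 0 := by exact_mod_cast hd
  have hΦ : Function.Injective Φ.toAffineMap := by
    rw [LinearMap.coe_toAffineMap]
    rw [← LinearMap.ker_eq_bot, LinearMap.ker_eq_bot']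
    rintro ⟨a, b⟩ hab
    have e1 : a * u.1 + b * w.1 = 0 := congrArg Prod.fst hab
    have e2 : a * u.2 + b * w.2 = 0 := congrArg Prod.snd hab
    have ha : a * (u.1 * w.2 - u.2 * w.1 : ℝ) = 0 := by linear_combination e1 * w.2 - e2 * w.1
    have hb : b * (u.1 * w.2 - u.2 * w.1 : ℝ) = 0 := by linear_combination e2 * u.1 - e1 * u.2
    simp only [mul_eq_zero, hd', or_false] at ha hb
    rw [ha, hb]; rfl
  refine ⟨fun x => φ (pos x), by simp [φ, h1], h2.map S hφ hΦ,
    fun c hc => (h3 c hc).map S hφ hΦ, ?_⟩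
  rw [S.starSupp_map hφ]
  exact Set.image_mono h4

/-- The subtrees at distinct children are disjoint and avoid v, so each descendant determines its
child and the positions can be prescribed independently. -/
lemma exists_glue {v : V} {B : Finset V} (hB : B ⊆ S.kids v) (q : ℤ × ℤ) (p : V → V → ℤ × ℤ) :
    ∃ pos : V → ℤ × ℤ, pos v = q ∧ ∀ c ∈ B, ∀ x ∈ S.desc c, pos x = p c x := by
  classical
  refine ⟨fun x => if x = v then q else if h : ∃ c ∈ B, x ∈ S.desc c then p h.choose x else 0,
    by simp, fun c hc x hx => ?_⟩
  have hxv : x ≠ v := by rintro rfl; exact S.notMem x c (hB hc) hx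
  have hex : ∃ c ∈ B, x ∈ S.desc c := ⟨c, hc, hx⟩
  simp only [hxv, if_false, dif_pos hex]
  obtain ⟨h1, h2⟩ := hex.choose_spec
  by_cases he : hex.choose = c
  · rw [he]
  · exact absurd hx (Finset.disjoint_left.1 (S.disj v _ (hB h1) c (hB hc) he) h2)

lemma StarDraw.union {v : V} {B₁ B₂ : Finset V} {R₁ R₂ : Set (ℝ × ℝ)} (h₁ : S.StarDraw v B₁ R₁)
    (h₂ : S.StarDraw v B₂ R₂) (hB₁ : B₁ ⊆ S.kids v) (hB₂ : B₂ ⊆ S.kids v) (hB : Disjoint B₁ B₂)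
    (hR : R₁ ∩ R₂ ⊆ {0}) : S.StarDraw v (B₁ ∪ B₂) (R₁ ∪ R₂) := by
  obtain ⟨p₁, a1, a2, a3, a4⟩ := h₁
  obtain ⟨p₂, b1, b2, b3, b4⟩ := h₂
  obtain ⟨pos, h0, h⟩ := S.exists_glue (Finset.union_subset hB₁ hB₂) 0
    (fun c => if c ∈ B₁ then p₁ else p₂)
  have e₁ : ∀ c ∈ B₁, ∀ x ∈ S.desc c, p₁ x = pos x := fun c hc x hx => by
    rw [h c (Finset.mem_union_left _ hc) x hx, if_pos hc]
  have e₂ : ∀ c ∈ B₂, ∀ x ∈ S.desc c, p₂ x = pos x := fun c hc x hx => by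
    rw [h c (Finset.mem_union_right _ hc) x hx, if_neg (Finset.disjoint_right.1 hB hc)]
  have l₁ := a2.congr S (a1.trans h0.symm) e₁
  have l₂ := b2.congr S (b1.trans h0.symm) e₂
  rw [S.starSupp_congr (a1.trans h0.symm) e₁] at a4
  rw [S.starSupp_congr (b1.trans h0.symm) e₂] at b4
  have key : ∀ c ∈ B₁, ∀ d ∈ B₂, S.arm pos v c ∩ S.arm pos v d ⊆ {toPlane (pos v)} := by
    intro c hc d hd p hp
    rw [h0, toPlane_zero]
    exact hR ⟨a4 (S.arm_subset_starSupp hc hp.1), b4 (S.arm_subset_starSupp hd hp.2)⟩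
  refine ⟨pos, h0, ⟨fun c hc => ?_, fun c hc d hd hcd => ?_⟩, fun c hc => ?_, ?_⟩
  · rcases Finset.mem_union.1 hc with hc | hc
    · exact l₁.1 c hc
    · exact l₂.1 c hc
  · rcases Finset.mem_union.1 hc with hc | hc <;> rcases Finset.mem_union.1 hd with hd | hd
    · exact l₁.2 c hc d hd hcd
    · exact key c hc d hd
    · rw [Set.inter_comm]; exact key d hd c hc
    · exact l₂.2 c hc d hd hcd
  · rcases Finset.mem_union.1 hc with hc | hc
    · exact (a3 c hc).congr S (e₁ c hc)
    · exact (b3 c hc).congr S (e₂ c hc)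
  · rintro p (hp | hp)
    · exact Or.inl (a4 (Or.inl hp))
    · simp only [Set.mem_iUnion] at hp
      obtain ⟨c, hc, hp⟩ := hp
      rcases Finset.mem_union.1 hc with hc | hc
      · exact Or.inl (a4 (S.arm_subset_starSupp hc hp))
      · exact Or.inr (b4 (S.arm_subset_starSupp hc hp))

/-- The region covered when a drawing in `R` is moved to `q` and joined to the origin. -/
def armRegion (q : ℤ × ℤ) (R : Set (ℝ × ℝ)) : Set (ℝ × ℝ) :=
  segment ℝ 0 (toPlane q) ∪ {p | p - toPlane q ∈ R}

lemma StarDraw.single {v c : V} {R : Set (ℝ × ℝ)} (hc : c ∈ S.kids v)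
    (h : S.StarDraw c (S.kids c) R) (q : ℤ × ℤ) (hq : q ≠ 0)
    (hR : ∀ p ∈ segment ℝ (0 : ℝ × ℝ) (toPlane q), p - toPlane q ∈ R → p = toPlane q) :
    S.StarDraw v {c} (armRegion q R) := by
  obtain ⟨p₁, a1, a2, a3, a4⟩ := h
  have hp₁ : S.Plane p₁ c := S.plane_iff.2 ⟨a2, a3⟩
  rw [← S.supp_eq] at a4
  let Φ : ℝ × ℝ →ᵃ[ℝ] ℝ × ℝ := AffineMap.id ℝ (ℝ × ℝ) + AffineMap.const ℝ (ℝ × ℝ) (toPlane q)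
  have hΦ : ∀ p, Φ p = p + toPlane q := fun p => by simp [Φ]
  have hφ : ∀ p, toPlane (p + q) = Φ (toPlane p) := fun p => by
    rw [hΦ]; simp [toPlane]
  have hinj : Function.Injective Φ := fun a b hab => by
    rw [hΦ, hΦ] at hab; exact add_right_cancel hab
  have hp₂ := hp₁.map S (φ := fun p => p + q) hφ hinj
  obtain ⟨pos, h0, h⟩ := S.exists_glue (Finset.singleton_subset_iff.2 hc) 0
    (fun _ x => p₁ x + q)
  have e : ∀ x ∈ S.desc c, p₁ x + q = pos x := fun x hx =>
    (h c (Finset.mem_singleton_self c) x hx).symm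
  have hs : S.supp pos c ⊆ {p | p - toPlane q ∈ R} := by
    rw [← S.supp_congr e, S.supp_map (φ := fun p => p + q) hφ]
    rintro _ ⟨p, hp, rfl⟩
    rw [hΦ]
    simpa using a4 hp
  have hpc : pos c = q := by rw [← e c (S.self_mem c), a1, zero_add]
  have hseg : seg (pos v) (pos c) = segment ℝ 0 (toPlane q) := by
    unfold seg; rw [h0, hpc, toPlane_zero]
  refine ⟨pos, h0, ⟨?_, ?_⟩, ?_, ?_⟩
  · intro d hd
    rw [Finset.mem_singleton.1 hd]
    refine ⟨by rw [h0, hpc]; exact hq.symm, ?_⟩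
    rw [hseg, hpc]
    exact fun p hp => hR p hp.1 (hs hp.2)
  · intro d hd d' hd' hne
    exact absurd ((Finset.mem_singleton.1 hd).trans (Finset.mem_singleton.1 hd').symm) hne
  · intro d hd
    rw [Finset.mem_singleton.1 hd]
    exact hp₂.congr S e
  · rintro p (hp | hp)
    · refine Or.inl ?_
      rw [hp, h0, toPlane_zero]
      exact left_mem_segment _ _ _
    · simp only [Finset.mem_singleton, Set.iUnion_iUnion_eq_left] at hp
      rcases hp with hp | hp
      · left; rwa [hseg] at hp
      · right; exact hs hp

/-- Arms that pairwise meet in the origin only can be drawn together. -/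
lemma StarDraw.biUnion {v : V} {ι : Type*} [DecidableEq ι] (I : Finset ι) (B : ι → Finset V)
    (R : ι → Set (ℝ × ℝ)) (h : ∀ i ∈ I, S.StarDraw v (B i) (R i)) (hB : ∀ i ∈ I, B i ⊆ S.kids v)
    (hd : ∀ i ∈ I, ∀ j ∈ I, i ≠ j → Disjoint (B i) (B j))
    (hR : ∀ i ∈ I, ∀ j ∈ I, i ≠ j → R i ∩ R j ⊆ {0}) :
    S.StarDraw v (I.biUnion B) ({0} ∪ ⋃ i ∈ I, R i) := by
  induction I using Finset.induction_on with
  | empty => simpa using S.starDraw_empty v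
  | insert i I hi ih =>
    have h1 := ih (fun j hj => h j (Finset.mem_insert_of_mem hj))
      (fun j hj => hB j (Finset.mem_insert_of_mem hj))
      (fun j hj k hk => hd j (Finset.mem_insert_of_mem hj) k (Finset.mem_insert_of_mem hk))
      (fun j hj k hk => hR j (Finset.mem_insert_of_mem hj) k (Finset.mem_insert_of_mem hk))
    have h2 := (h i (Finset.mem_insert_self i I)).union h1 (hB i (Finset.mem_insert_self i I))
      (Finset.biUnion_subset.2 fun j hj => hB j (Finset.mem_insert_of_mem hj)) ?_ ?_
    · rw [Finset.biUnion_insert]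
      refine h2.mono ?_
      rw [Finset.set_biUnion_insert]
      intro p hp
      simp only [Set.mem_union] at hp ⊢
      tauto
    · rw [Finset.disjoint_biUnion_right]
      intro j hj
      exact hd i (Finset.mem_insert_self i I) j (Finset.mem_insert_of_mem hj)
        (fun e => hi (e ▸ hj))
    · rintro p ⟨hp1, hp2 | hp2⟩
      · exact hp2
      · simp only [Set.mem_iUnion] at hp2
        obtain ⟨j, hj, hp2⟩ := hp2
        exact hR i (Finset.mem_insert_self i I) j (Finset.mem_insert_of_mem hj)
          (fun e => hi (e ▸ hj)) ⟨hp1, hp2⟩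

lemma mem_segment_zero {p : ℝ × ℝ} {q : ℤ × ℤ} (h : p ∈ segment ℝ (0 : ℝ × ℝ) (toPlane q)) :
    ∃ t : ℝ, 0 ≤ t ∧ t ≤ 1 ∧ p.1 = t * q.1 ∧ p.2 = t * q.2 := by
  rw [segment_eq_image] at h
  obtain ⟨t, ⟨h0, h1⟩, rfl⟩ := h
  exact ⟨t, h0, h1, by simp [toPlane], by simp [toPlane]⟩

/-! ### Boxes, bands and rows -/

/-- The box with `W` columns and `H` rows with its top left corner at the origin
(the second coordinate grows downwards). -/
def Box (W H : ℕ) : Set (ℝ × ℝ) :=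
  {p | 0 ≤ p.1 ∧ p.1 ≤ W - 1 ∧ 0 ≤ p.2 ∧ p.2 ≤ H - 1}

/-- The rows `y₀, …, y₁ - 1` in the columns `1, …, W`, joined to the origin. -/
def Band (y₀ y₁ W : ℕ) : Set (ℝ × ℝ) :=
  {p | 0 ≤ p.1 ∧ p.1 ≤ W ∧ y₀ * min p.1 1 ≤ p.2 ∧ p.2 ≤ (y₁ - 1) * min p.1 1}

/-- The columns `x₀, …, x₁ - 1` in the rows `1, …, h`, joined to the origin. -/
def Row (x₀ x₁ h : ℕ) : Set (ℝ × ℝ) :=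
  {p | 0 ≤ p.2 ∧ p.2 ≤ h ∧ x₀ * min p.2 1 ≤ p.1 ∧ p.1 ≤ (x₁ - 1) * min p.2 1}

variable (S) in
/-- The subtree at `v` has a drawing with `v` at the top left corner in `W` columns and `H` rows. -/
def Draw (v : V) (W H : ℕ) : Prop := S.StarDraw v (S.kids v) (Box W H)

lemma Box.mono {W W' H H' : ℕ} (hW : W ≤ W') (hH : H ≤ H') : Box W H ⊆ Box W' H' := by
  rintro p ⟨h1, h2, h3, h4⟩
  have : (W : ℝ) ≤ W' := by exact_mod_cast hW
  have : (H : ℝ) ≤ H' := by exact_mod_cast hH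
  exact ⟨h1, by linarith, h3, by linarith⟩

lemma Draw.mono {v : V} {W W' H H' : ℕ} (h : S.Draw v W H) (hW : W ≤ W') (hH : H ≤ H') :
    S.Draw v W' H' := StarDraw.mono h (Box.mono hW hH)

lemma StarDraw.one_le {v : V} {B : Finset V} {W H : ℕ} (h : S.StarDraw v B (Box W H)) :
    1 ≤ W ∧ 1 ≤ H := by
  obtain ⟨h1, h2, h3, h4⟩ := h.zero_mem
  simp only [Prod.fst_zero, Prod.snd_zero, sub_nonneg] at h2 h4
  exact ⟨by exact_mod_cast h2, by exact_mod_cast h4⟩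

lemma Draw.band {v c : V} {W H : ℕ} (h : S.Draw c W H) (hc : c ∈ S.kids v) (y : ℕ) :
    S.StarDraw v {c} (Band y (y + H) W) := by
  have hH : (1 : ℝ) ≤ H := by exact_mod_cast h.one_le.2
  have hW : (1 : ℝ) ≤ W := by exact_mod_cast h.one_le.1
  refine (h.single hc (1, (y : ℤ)) (by simp) ?_).mono ?_
  · rintro p hp ⟨h1, h2, h3, h4⟩
    obtain ⟨t, h5, h6, h7, h8⟩ := mem_segment_zero hp
    simp only [toPlane, Prod.fst_sub, Prod.snd_sub, Int.cast_one, Int.cast_natCast] at *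
    have : t = 1 := by linarith
    subst this
    ext <;> simp [h7, h8]
  · have hy : (0 : ℝ) ≤ y := Nat.cast_nonneg y
    rintro p (hp | ⟨h1, h2, h3, h4⟩)
    · obtain ⟨t, h5, h6, h7, h8⟩ := mem_segment_zero hp
      simp only [Int.cast_one, Int.cast_natCast, mul_one] at h7 h8
      refine ⟨by linarith, by linarith, ?_, ?_⟩
      · rw [h7, h8, min_eq_left h6]; linarith
      · rw [h7, h8, min_eq_left h6]; push_cast; nlinarith
    · simp only [toPlane, Prod.fst_sub, Prod.snd_sub, Int.cast_one, Int.cast_natCast] at *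
      refine ⟨by linarith, by linarith, ?_, ?_⟩
      · rw [min_eq_right (by linarith)]; linarith
      · rw [min_eq_right (by linarith)]; push_cast; linarith

/-- With μ = min(p.1, 1), a common point has y₂ μ ≤ p.2 ≤ (y₁ - 1) μ, which forces μ = 0. The edges
between column 0 and column 1 are thus ordered by slope like the bands themselves. -/
lemma Band.inter {y₀ y₁ y₂ y₃ W W' : ℕ} (h : y₁ ≤ y₂) : Band y₀ y₁ W ∩ Band y₂ y₃ W' ⊆ {0} := by
  rintro p ⟨⟨h1, h2, h3, h4⟩, ⟨_, _, h5, _⟩⟩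
  have hy : (y₁ : ℝ) ≤ y₂ := by exact_mod_cast h
  have hm : 0 ≤ min p.1 1 := le_min h1 zero_le_one
  have hm0 : min p.1 1 = 0 := by nlinarith
  have hp1 : p.1 = 0 := by
    rcases min_choice p.1 1 with e | e
    · rw [← e, hm0]
    · rw [e] at hm0; norm_num at hm0
  rw [hm0] at h3 h4
  simp only [mul_zero] at h3 h4
  exact Prod.ext hp1 (le_antisymm h4 h3)

lemma Band.mono {y₀ y₁ W y₀' y₁' W' : ℕ} (h0 : y₀' ≤ y₀) (h1 : y₁ ≤ y₁') (hW : W ≤ W') :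
    Band y₀ y₁ W ⊆ Band y₀' y₁' W' := by
  rintro p ⟨a, b, c, d⟩
  have e1 : (y₀' : ℝ) ≤ y₀ := by exact_mod_cast h0
  have e2 : (y₁ : ℝ) ≤ y₁' := by exact_mod_cast h1
  have e3 : (W : ℝ) ≤ W' := by exact_mod_cast hW
  have hm : 0 ≤ min p.1 1 := le_min a zero_le_one
  exact ⟨a, by linarith, by nlinarith, by nlinarith⟩

lemma StarDraw.band_append {v : V} {B₁ B₂ : Finset V} {y₀ y₁ y₂ W : ℕ}
    (h₁ : S.StarDraw v B₁ (Band y₀ y₁ W)) (h₂ : S.StarDraw v B₂ (Band y₁ y₂ W))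
    (hB₁ : B₁ ⊆ S.kids v) (hB₂ : B₂ ⊆ S.kids v) (hB : Disjoint B₁ B₂)
    (h01 : y₀ ≤ y₁) (h12 : y₁ ≤ y₂) : S.StarDraw v (B₁ ∪ B₂) (Band y₀ y₂ W) :=
  (h₁.union h₂ hB₁ hB₂ hB (Band.inter le_rfl)).mono
    (Set.union_subset (Band.mono le_rfl h12 le_rfl) (Band.mono h01 le_rfl le_rfl))

lemma zero_subset_band (y₀ y₁ W : ℕ) : {0} ⊆ Band y₀ y₁ W := by
  rintro p hp
  rw [hp]
  simp [Band]

/-- Sets of children that are drawn in bands can be drawn together, band after band. -/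
lemma StarDraw.band_biUnion {v : V} {ι : Type*} [DecidableEq ι] (I : Finset ι)
    (B : ι → Finset V) (H : ι → ℕ) {W : ℕ} (y : ℕ)
    (h : ∀ i ∈ I, ∀ y, S.StarDraw v (B i) (Band y (y + H i) W))
    (hB : ∀ i ∈ I, B i ⊆ S.kids v)
    (hd : ∀ i ∈ I, ∀ j ∈ I, i ≠ j → Disjoint (B i) (B j)) :
    S.StarDraw v (I.biUnion B) (Band y (y + ∑ i ∈ I, H i) W) := by
  induction I using Finset.induction_on generalizing y with
  | empty => simpa using (S.starDraw_empty v).mono (zero_subset_band y y W)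
  | insert i I hi ih =>
    have h1 := ih (y + H i) (fun j hj => h j (Finset.mem_insert_of_mem hj))
      (fun j hj => hB j (Finset.mem_insert_of_mem hj))
      (fun j hj k hk => hd j (Finset.mem_insert_of_mem hj) k (Finset.mem_insert_of_mem hk))
    rw [Finset.biUnion_insert, Finset.sum_insert hi, ← add_assoc]
    refine (h i (Finset.mem_insert_self i I) y).band_append h1 (hB i (Finset.mem_insert_self i I))
      (Finset.biUnion_subset.2 fun j hj => hB j (Finset.mem_insert_of_mem hj)) ?_
      (Nat.le_add_right _ _) (Nat.le_add_right _ _)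
    rw [Finset.disjoint_biUnion_right]
    intro j hj
    exact hd i (Finset.mem_insert_self i I) j (Finset.mem_insert_of_mem hj) (fun e => hi (e ▸ hj))

lemma starDraw_stack {v : V} {B : Finset V} (hB : B ⊆ S.kids v) {W : ℕ} (H : V → ℕ)
    (h : ∀ c ∈ B, S.Draw c W (H c)) (y : ℕ) :
    S.StarDraw v B (Band y (y + ∑ c ∈ B, H c) W) := by
  have := StarDraw.band_biUnion (S := S) (v := v) B (fun c => {c}) H (W := W) y
    (fun c hc y => (h c hc).band (hB hc) y)
    (fun c hc => Finset.singleton_subset_iff.2 (hB hc))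
    (fun c _ d _ hcd => Finset.disjoint_singleton.2 hcd)
  rwa [Finset.biUnion_singleton_eq_self] at this

lemma StarDraw.swap {v : V} {B : Finset V} {R : Set (ℝ × ℝ)} (h : S.StarDraw v B R) :
    S.StarDraw v B (Prod.swap '' R) := by
  have := h.colMap (0, 1) (1, 0) (by norm_num)
  refine this.mono ?_
  rintro _ ⟨p, hp, rfl⟩
  exact ⟨p, hp, by ext <;> simp [ChildSystem.colMap]⟩

lemma starDraw_row {v : V} {B : Finset V} (hB : B ⊆ S.kids v) (w : V → ℕ) {h : ℕ}
    (hd : ∀ c ∈ B, S.Draw c (w c) h) (x : ℕ) :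
    S.StarDraw v B (Row x (x + ∑ c ∈ B, w c) h) := by
  have := starDraw_stack (S := S) hB (W := h) w (fun c hc => ?_) x
  · refine this.swap.mono ?_
    rintro _ ⟨p, hp, rfl⟩
    exact hp
  · refine StarDraw.mono (hd c hc).swap ?_
    rintro _ ⟨p, ⟨h1, h2, h3, h4⟩, rfl⟩
    exact ⟨h3, h4, h1, h2⟩

/-- A last child is drawn below the root, under everything else. -/
lemma StarDraw.finish {v r : V} {B : Finset V} {Y W W' H : ℕ} (h : S.StarDraw v B (Band 0 Y W))
    (hr : S.Draw r W' H) (hB : B ⊆ S.kids v) (hrk : r ∈ S.kids v) (hrB : r ∉ B) (hY : 1 ≤ Y) :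
    S.StarDraw v (insert r B) (Box (max (W + 1) W') (Y + H)) := by
  have hH : (1 : ℝ) ≤ H := by exact_mod_cast hr.one_le.2
  have hY' : (1 : ℝ) ≤ Y := by exact_mod_cast hY
  have hW : ((W : ℝ) + 1) ≤ max ((W : ℝ) + 1) W' := le_max_left _ _
  have hW' : (W' : ℝ) ≤ max ((W : ℝ) + 1) W' := le_max_right _ _
  have h1 : S.StarDraw v {r} (armRegion (0, (Y : ℤ)) (Box W' H)) := by
    refine hr.single hrk _ (by simp; omega) ?_
    rintro p hp ⟨h1, h2, h3, h4⟩
    obtain ⟨t, h5, h6, h7, h8⟩ := mem_segment_zero hp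
    simp only [toPlane, Prod.fst_sub, Prod.snd_sub, Int.cast_zero, Int.cast_natCast] at *
    have : t = 1 := by nlinarith
    subst this
    ext <;> simp [h7, h8]
  have h2 := h1.union h (Finset.singleton_subset_iff.2 hrk) hB
    (Finset.disjoint_singleton_left.2 hrB) ?_
  · rw [← Finset.insert_eq] at h2
    refine h2.mono ?_
    rintro p ((hp | ⟨h1, h2, h3, h4⟩) | ⟨h1, h2, h3, h4⟩)
    · obtain ⟨t, h5, h6, h7, h8⟩ := mem_segment_zero hp
      simp only [Int.cast_zero, Int.cast_natCast, mul_zero] at *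
      have hW0 : (0 : ℝ) ≤ W := Nat.cast_nonneg W
      refine ⟨by linarith, by push_cast; linarith, by rw [h8]; positivity, ?_⟩
      rw [h8]; push_cast; nlinarith
    · simp only [toPlane, Prod.fst_sub, Prod.snd_sub, Int.cast_zero, Int.cast_natCast] at *
      exact ⟨by linarith, by push_cast; linarith, by linarith, by push_cast; linarith⟩
    · have hm : 0 ≤ min p.1 1 := le_min h1 zero_le_one
      have hm1 : min p.1 1 ≤ 1 := min_le_right _ _
      simp only [Nat.cast_zero, zero_mul] at h3
      refine ⟨by linarith, by push_cast; linarith, by linarith, ?_⟩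
      push_cast; nlinarith
  · rintro p ⟨hp | ⟨h1, h2, h3, h4⟩, ⟨k1, k2, k3, k4⟩⟩
    · obtain ⟨t, h5, h6, h7, h8⟩ := mem_segment_zero hp
      simp only [Int.cast_zero, mul_zero] at h7
      rw [h7, min_eq_left zero_le_one] at k3 k4
      exact Prod.ext h7 (le_antisymm (by simpa using k4) (by simpa using k3))
    · exfalso
      have hm1 : min p.1 1 ≤ 1 := min_le_right _ _
      simp only [toPlane, Prod.fst_sub, Prod.snd_sub, Int.cast_zero, Int.cast_natCast] at *
      nlinarith

/-! ### Heavy children and the standard drawing -/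

variable (S) in
/-- `r` is a child of `v` with a largest subtree. -/
def IsHeavy (v r : V) : Prop := r ∈ S.kids v ∧ ∀ c ∈ S.kids v, S.size c ≤ S.size r

lemma exists_isHeavy {v : V} (h : S.kids v ≠ ∅) : ∃ r, S.IsHeavy v r := by
  obtain ⟨r, hr, h⟩ := Finset.exists_max_image (S.kids v) S.size
    (Finset.nonempty_iff_ne_empty.2 h)
  exact ⟨r, hr, h⟩

lemma size_eq_heavy {v r : V} (h : r ∈ S.kids v) :
    S.size v = 1 + ∑ c ∈ (S.kids v).erase r, S.size c + S.size r := by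
  rw [S.size_eq v, ← Finset.sum_erase_add _ _ h]; ring

lemma IsHeavy.two_mul_lt {v r c : V} (h : S.IsHeavy v r) (hc : c ∈ (S.kids v).erase r) :
    2 * S.size c < S.size v := by
  have h1 := Finset.single_le_sum (f := S.size) (fun _ _ => Nat.zero_le _) hc
  have h2 := h.2 c (Finset.mem_of_mem_erase hc)
  rw [size_eq_heavy h.1]; omega

lemma log_size_light {v r c : V} (h : S.IsHeavy v r) (hc : c ∈ (S.kids v).erase r) :
    Nat.log 2 (S.size c) + 1 ≤ Nat.log 2 (S.size v) := by
  have h1 := h.two_mul_lt hc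
  have h2 := S.size_pos c
  rw [← Nat.log_mul_base one_lt_two h2.ne']
  exact Nat.log_mono_right (by omega)

lemma draw_of_kids_eq_empty {v : V} (h : S.kids v = ∅) : S.Draw v 1 1 := by
  unfold Draw
  rw [h]
  refine (S.starDraw_empty v).mono ?_
  rintro p hp
  rw [hp]; simp [Box]

/-- The standard drawing, of logarithmic width. -/
lemma draw_standard (S : ChildSystem V) (v : V) :
    S.Draw v (Nat.log 2 (S.size v) + 1) (S.size v) := by
  induction hn : S.size v using Nat.strong_induction_on generalizing v with
  | _ n ih =>
    by_cases hk : S.kids v = ∅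
    · exact (draw_of_kids_eq_empty hk).mono (by omega) (by have := S.size_pos v; omega)
    · obtain ⟨r, hr⟩ := exists_isHeavy hk
      -- The light subtrees need one column less than the whole, so they fit to the right of column
      -- 0, which is left to the edge to the heavy child.
      have h1 := starDraw_stack (S := S) (v := v) (Finset.erase_subset r (S.kids v))
        (W := Nat.log 2 n) S.size (fun c hc => (ih _ (hn ▸ S.size_kid_lt
          (Finset.mem_of_mem_erase hc)) c rfl).mono (hn ▸ log_size_light hr hc) le_rfl) 1
      have h2 := (h1.mono (Band.mono (Nat.zero_le 1) le_rfl le_rfl)).finish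
        (ih _ (hn ▸ S.size_kid_lt hr.1) r rfl) (Finset.erase_subset r _) hr.1
        (Finset.notMem_erase r _) (by omega)
      rw [Finset.insert_erase hr.1] at h2
      refine StarDraw.mono h2 (Box.mono ?_ ?_)
      · have : S.size r ≤ n := hn ▸ (S.size_kid_lt hr.1).le
        exact max_le le_rfl (Nat.succ_le_succ (Nat.log_mono_right this))
      · rw [← hn, size_eq_heavy hr.1]

/-- Every star of subtrees is drawn in a square whose side is its size. -/
lemma starDraw_square {v : V} {B : Finset V} (hB : B ⊆ S.kids v) :
    S.StarDraw v B (Box (1 + ∑ c ∈ B, S.size c) (1 + ∑ c ∈ B, S.size c)) := by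
  set m := ∑ c ∈ B, S.size c
  have h1 := starDraw_stack (S := S) hB (W := m) S.size (fun c hc => (S.draw_standard c).mono ?_
    le_rfl) 1
  · refine h1.mono ?_
    rintro p ⟨h1, h2, h3, h4⟩
    have hm : 0 ≤ min p.1 1 := le_min h1 zero_le_one
    have hm1 : min p.1 1 ≤ 1 := min_le_right _ _
    have hm2 : (0 : ℝ) ≤ m := Nat.cast_nonneg m
    push_cast at h3 h4
    refine ⟨h1, by push_cast; linarith, by linarith, ?_⟩
    push_cast
    rw [← Nat.cast_sum] at h4
    have : (1 + (m : ℝ) - 1) * min p.1 1 ≤ 1 + m - 1 := mul_le_of_le_one_right (by linarith) hm1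
    linarith
  · have h2 : S.size c ≤ m := Finset.single_le_sum (f := S.size) (fun _ _ => Nat.zero_le _) hc
    have h3 := Nat.log_lt_self 2 (S.size_pos c).ne'
    omega

/-! ### Sections of a heavy path drawn along a row -/

/-- The region of a heavy path that runs to the left on the row of its first vertex (the origin)
through `X` columns, with light subtrees in the next `h` rows and `H` more rows below. -/
def catRegion (X w h W H : ℕ) : Set (ℝ × ℝ) :=
  {p | -(X : ℝ) ≤ p.1 ∧ p.1 ≤ W - X - 1 ∧ 0 ≤ p.2 ∧ p.2 ≤ h + H ∧
    (p.2 < h + 1 → p.1 ≤ w - 1) ∧ (p.2 ≤ 0 → p.1 ≤ 0)}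

variable (S) in
/-- The subtree at `v` is drawn in `catRegion X w h W H`. -/
def Cat (v : V) (X w h W H : ℕ) : Prop := S.StarDraw v (S.kids v) (catRegion X w h W H)

/-- The region of a drawing with the root alone in the first row, at the origin, and everything else
in the columns `σ, …, σ + W - 1`. -/
def rootRegion (σ W H : ℕ) : Set (ℝ × ℝ) :=
  {p | 0 ≤ p.1 ∧ p.1 ≤ σ + W - 1 ∧ 0 ≤ p.2 ∧ p.2 ≤ H - 1 ∧ (1 ≤ p.2 → σ ≤ p.1)}

variable (S) in
/-- The subtree at `v` has drawings in `H` rows, with the root alone in the first row and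
arbitrarily far to the left of the other vertices, which occupy `W` columns. -/
def RootDraw (v : V) (W H : ℕ) : Prop := ∀ σ, S.StarDraw v (S.kids v) (rootRegion σ W H)

lemma RootDraw.draw {v : V} {W H : ℕ} (h : S.RootDraw v W H) : S.Draw v W H := by
  refine (h 0).mono ?_
  rintro p ⟨h1, h2, h3, h4, -⟩
  exact ⟨h1, by simpa using h2, h3, h4⟩

lemma cat_leaf {v : V} (h : S.kids v = ∅) {w h' W H : ℕ} (hw : 1 ≤ w) (hW : w ≤ W) :
    S.Cat v 0 w h' W H := by
  unfold Cat
  rw [h]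
  refine (S.starDraw_empty v).mono ?_
  rintro p hp
  rw [hp]
  have h1 : (1 : ℝ) ≤ w := by exact_mod_cast hw
  have h2 : (1 : ℝ) ≤ W := by exact_mod_cast hw.trans hW
  refine ⟨by simp, by simpa using h2, by simp, by simp; positivity, fun _ => by simpa using h1,
    fun _ => by simp⟩

/-- The end of a section: the light subtrees hang from row 1, starting in column 1, so column 0 is
free for the vertical edge to r in row h + 1. Being in the leftmost column, r may keep a drawing
with its root at the top left corner. -/
lemma cat_last {v r : V} (hr : r ∈ S.kids v) {h W W' H : ℕ}
    (hl : ∀ c ∈ (S.kids v).erase r, S.Draw c (S.size c) h) (hd : S.Draw r W' H) (hW' : W' ≤ W)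
    (hW : 1 + ∑ c ∈ (S.kids v).erase r, S.size c ≤ W) :
    S.Cat v 0 (1 + ∑ c ∈ (S.kids v).erase r, S.size c) h W H := by
  have hrow := starDraw_row (S := S) (Finset.erase_subset r _) S.size hl 1
  generalize ∑ c ∈ (S.kids v).erase r, S.size c = s at *
  have hH : (1 : ℝ) ≤ H := by exact_mod_cast hd.one_le.2
  have hh : (0 : ℝ) ≤ h := Nat.cast_nonneg h
  have hs : (0 : ℝ) ≤ s := Nat.cast_nonneg s
  have hW2 : (W' : ℝ) ≤ W := by exact_mod_cast hW'
  have hW3 : (1 : ℝ) + s ≤ W := by exact_mod_cast hW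
  have h1 : S.StarDraw v {r} (armRegion (0, (h : ℤ) + 1) (Box W' H)) := by
    refine hd.single hr _ (by simp; omega) ?_
    rintro p hp ⟨h1, h2, h3, h4⟩
    obtain ⟨t, h5, h6, h7, h8⟩ := mem_segment_zero hp
    simp only [toPlane, Prod.fst_sub, Prod.snd_sub] at *
    push_cast at *
    have : t = 1 := by nlinarith
    subst this
    ext <;> simp [h7, h8]
  have h2 := h1.union hrow
    (Finset.singleton_subset_iff.2 hr) (Finset.erase_subset r _)
    (Finset.disjoint_singleton_left.2 (Finset.notMem_erase r _)) ?_
  · rw [← Finset.insert_eq, Finset.insert_erase hr] at h2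
    refine h2.mono ?_
    rintro p ((hp | ⟨h1, h2, h3, h4⟩) | ⟨h1, h2, h3, h4⟩)
    · obtain ⟨t, h5, h6, h7, h8⟩ := mem_segment_zero hp
      push_cast at *
      simp only [mul_zero] at h7
      refine ⟨by simp [h7], by rw [h7]; push_cast; linarith, by rw [h8]; positivity, by
        rw [h8]; nlinarith, fun _ => by rw [h7]; push_cast; linarith, fun _ => h7.le⟩
    · simp only [toPlane, Prod.fst_sub, Prod.snd_sub] at *
      push_cast at *
      refine ⟨by simp; linarith, by push_cast; linarith, by linarith, by linarith,
        fun _ => by linarith, fun _ => by linarith⟩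
    · have hm : 0 ≤ min p.2 1 := le_min h1 zero_le_one
      have hm1 : min p.2 1 ≤ 1 := min_le_right _ _
      have hm2 : min p.2 1 ≤ p.2 := min_le_left _ _
      push_cast at *
      have h5 : (1 + (s : ℝ) - 1) * min p.2 1 ≤ s := by nlinarith
      refine ⟨by simp; linarith, by simp; linarith, h1, by linarith,
        fun _ => by push_cast; linarith,
        fun _ => ?_⟩
      nlinarith
  · rintro p ⟨hp | ⟨h1, h2, h3, h4⟩, ⟨k1, k2, k3, k4⟩⟩
    · obtain ⟨t, h5, h6, h7, h8⟩ := mem_segment_zero hp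
      simp only [Int.cast_zero, mul_zero] at h7
      push_cast at k3 k4
      have h9 : min p.2 1 ≤ 0 := by linarith
      have h10 : p.2 = 0 := by
        rcases min_choice p.2 1 with e | e <;> rw [e] at h9 <;> linarith
      exact Prod.ext h7 h10
    · exfalso
      simp only [toPlane, Prod.fst_sub, Prod.snd_sub] at *
      push_cast at *
      linarith

/-- The heavy child is placed w columns to the left on the same row. The last two conditions of
`catRegion` are made for this step: nothing in the first row of r lies to its right, so the edge is
free, and the rows above h + 1 end just before column 0, where the light subtrees of v begin. -/
lemma cat_step {v r : V} (hr : r ∈ S.kids v) {X w h W H : ℕ}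
    (hl : ∀ c ∈ (S.kids v).erase r, S.Draw c (S.size c) h) (hd : S.Cat r X w h W H) (hw : 1 ≤ w)
    (hW : X + w + (1 + ∑ c ∈ (S.kids v).erase r, S.size c) ≤ W) :
    S.Cat v (X + w) (1 + ∑ c ∈ (S.kids v).erase r, S.size c) h W H := by
  have hrow := starDraw_row (S := S) (Finset.erase_subset r _) S.size hl 0
  generalize ∑ c ∈ (S.kids v).erase r, S.size c = s at *
  have hH : (0 : ℝ) ≤ H := Nat.cast_nonneg H
  have hh : (0 : ℝ) ≤ h := Nat.cast_nonneg h
  have hs : (0 : ℝ) ≤ s := Nat.cast_nonneg s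
  have hX : (0 : ℝ) ≤ X := Nat.cast_nonneg X
  have hw' : (1 : ℝ) ≤ w := by exact_mod_cast hw
  have hW3 : (X + w + (1 + s) : ℝ) ≤ W := by exact_mod_cast hW
  have h1 : S.StarDraw v {r} (armRegion (-(w : ℤ), 0) (catRegion X w h W H)) := by
    refine hd.single hr _ (by simp; omega) ?_
    rintro p hp ⟨h1, h2, h3, h4, h5', h6'⟩
    obtain ⟨t, h5, h6, h7, h8⟩ := mem_segment_zero hp
    simp only [toPlane, Prod.fst_sub, Prod.snd_sub] at *
    push_cast at *
    have h9 := h6' (by linarith)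
    have : t = 1 := by nlinarith
    subst this
    ext <;> simp [h7, h8]
  have h2 := h1.union hrow
    (Finset.singleton_subset_iff.2 hr) (Finset.erase_subset r _)
    (Finset.disjoint_singleton_left.2 (Finset.notMem_erase r _)) ?_
  · rw [← Finset.insert_eq, Finset.insert_erase hr] at h2
    refine h2.mono ?_
    rintro p ((hp | ⟨h1, h2, h3, h4, h5, h6⟩) | ⟨h1, h2, h3, h4⟩)
    · obtain ⟨t, h5, h6, h7, h8⟩ := mem_segment_zero hp
      push_cast at *
      simp only [mul_zero] at h8
      have h9 : t * w ≤ w := by nlinarith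
      have h10 : 0 ≤ t * w := by positivity
      refine ⟨?_, ?_, ?_, ?_, fun _ => ?_, fun _ => ?_⟩ <;> push_cast <;> nlinarith
    · simp only [toPlane, Prod.fst_sub, Prod.snd_sub] at *
      push_cast at *
      refine ⟨?_, ?_, ?_, ?_, fun h7 => ?_, fun h7 => ?_⟩ <;> push_cast at *
      · linarith
      · linarith
      · linarith
      · linarith
      · linarith [h5 (by linarith)]
      · linarith [h6 (by linarith)]
    · have hm : 0 ≤ min p.2 1 := le_min h1 zero_le_one
      have hm1 : min p.2 1 ≤ 1 := min_le_right _ _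
      have hm2 : min p.2 1 ≤ p.2 := min_le_left _ _
      push_cast at *
      simp only [zero_add, zero_mul] at *
      have h5 : ((s : ℝ) - 1) * min p.2 1 ≤ s := by nlinarith
      refine ⟨?_, ?_, ?_, ?_, fun h7 => ?_, fun h7 => ?_⟩ <;> push_cast at *
      · linarith
      · linarith
      · linarith
      · linarith
      · linarith
      · have : min p.2 1 = 0 := le_antisymm (by linarith) hm
        rw [this] at h4; linarith
  · rintro p ⟨hp | ⟨h1, h2, h3, h4, h5, h6⟩, ⟨k1, k2, k3, k4⟩⟩
    · obtain ⟨t, h5, h6, h7, h8⟩ := mem_segment_zero hp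
      simp only [Int.cast_zero, mul_zero] at h8
      rw [h8, min_eq_left zero_le_one] at k3 k4
      exact Prod.ext (le_antisymm (by simpa using k4) (by simpa using k3)) h8
    · exfalso
      simp only [toPlane, Prod.fst_sub, Prod.snd_sub] at *
      push_cast at *
      have := h5 (by linarith)
      linarith

/-- A section starts at its right end, but the root is wanted at the top left. So v alone takes an
extra first row, r goes to row 1 in column σ + X, which makes σ the leftmost column of its drawing,
and the light subtrees of v continue to the right of those of r. -/
lemma rootDraw_top {v r : V} (hr : r ∈ S.kids v) {X w h W H : ℕ}
    (hl : ∀ c ∈ (S.kids v).erase r, S.Draw c (S.size c) h) (hd : S.Cat r X w h W H) (hw : 1 ≤ w)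
    (hW : X + w + (1 + ∑ c ∈ (S.kids v).erase r, S.size c) ≤ W) :
    S.RootDraw v W (h + H + 2) := by
  intro σ
  have hrow := starDraw_row (S := S) (Finset.erase_subset r _) S.size hl (σ + X + w)
  generalize ∑ c ∈ (S.kids v).erase r, S.size c = s at *
  have hH : (0 : ℝ) ≤ H := Nat.cast_nonneg H
  have hh : (0 : ℝ) ≤ h := Nat.cast_nonneg h
  have hs : (0 : ℝ) ≤ s := Nat.cast_nonneg s
  have hX : (0 : ℝ) ≤ X := Nat.cast_nonneg X
  have hσ : (0 : ℝ) ≤ σ := Nat.cast_nonneg σ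
  have hw' : (1 : ℝ) ≤ w := by exact_mod_cast hw
  have hW3 : (X + w + (1 + s) : ℝ) ≤ W := by exact_mod_cast hW
  have h1 : S.StarDraw v {r} (armRegion ((σ : ℤ) + X, 1) (catRegion X w h W H)) := by
    refine hd.single hr _ (by simp) ?_
    rintro p hp ⟨h1, h2, h3, h4, h5', h6'⟩
    obtain ⟨t, h5, h6, h7, h8⟩ := mem_segment_zero hp
    simp only [toPlane, Prod.fst_sub, Prod.snd_sub] at *
    push_cast at *
    have : t = 1 := by nlinarith
    subst this
    ext <;> simp [h7, h8]
  have h2 := h1.union hrow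
    (Finset.singleton_subset_iff.2 hr) (Finset.erase_subset r _)
    (Finset.disjoint_singleton_left.2 (Finset.notMem_erase r _)) ?_
  · rw [← Finset.insert_eq, Finset.insert_erase hr] at h2
    refine h2.mono ?_
    rintro p ((hp | ⟨h1, h2, h3, h4, h5, h6⟩) | ⟨h1, h2, h3, h4⟩)
    · obtain ⟨t, h5, h6, h7, h8⟩ := mem_segment_zero hp
      push_cast at *
      have h9 : t * (σ + X : ℝ) ≤ σ + X := by nlinarith
      have h10 : 0 ≤ t * (σ + X : ℝ) := by positivity
      refine ⟨?_, ?_, ?_, ?_, fun h11 => ?_⟩ <;> push_cast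
      · linarith
      · linarith
      · linarith
      · linarith
      · have : t = 1 := by linarith
        subst this; linarith
    · simp only [toPlane, Prod.fst_sub, Prod.snd_sub] at *
      push_cast at *
      refine ⟨?_, ?_, ?_, ?_, fun h7 => ?_⟩ <;> push_cast at * <;> linarith
    · have hm : 0 ≤ min p.2 1 := le_min h1 zero_le_one
      have hm1 : min p.2 1 ≤ 1 := min_le_right _ _
      push_cast at *
      have h5 : ((σ : ℝ) + X + w + s - 1) * min p.2 1 ≤ (σ : ℝ) + X + w + s - 1 :=
        mul_le_of_le_one_right (by linarith) hm1
      have h6 : 0 ≤ ((σ : ℝ) + X + w) * min p.2 1 := by positivity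
      refine ⟨?_, ?_, ?_, ?_, fun h7 => ?_⟩ <;> push_cast at *
      · linarith
      · linarith
      · linarith
      · linarith
      · rw [min_eq_right h7] at h3; linarith
  · rintro p ⟨hp | ⟨h1, h2, h3, h4, h5, h6⟩, ⟨k1, k2, k3, k4⟩⟩
    · obtain ⟨t, h5, h6, h7, h8⟩ := mem_segment_zero hp
      push_cast at *
      rw [mul_one] at h8
      rw [h8, min_eq_left h6] at k3
      have : t = 0 := by nlinarith
      subst this
      exact Prod.ext (by simpa using h7) h8
    · exfalso
      simp only [toPlane, Prod.fst_sub, Prod.snd_sub] at *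
      push_cast at *
      have := h5 (by linarith)
      rw [min_eq_right (by linarith)] at k3
      linarith

variable (S) in
/-- The size of the subtree at `v` without the largest subtree at a child. -/
def light (v : V) : ℕ := S.size v - (S.kids v).sup S.size

lemma IsHeavy.light_eq {v r : V} (h : S.IsHeavy v r) :
    S.light v = 1 + ∑ c ∈ (S.kids v).erase r, S.size c := by
  have : (S.kids v).sup S.size = S.size r :=
    le_antisymm (Finset.sup_le h.2) (Finset.le_sup (f := S.size) h.1)
  rw [light, this, size_eq_heavy h.1]; omega

lemma IsHeavy.size_eq_light {v r : V} (h : S.IsHeavy v r) : S.size v = S.light v + S.size r := by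
  rw [h.light_eq, size_eq_heavy h.1]

lemma light_le (v : V) : S.light v ≤ S.size v := Nat.sub_le _ _

lemma ne_of_mem_desc_kid {v c x : V} (hc : c ∈ S.kids v) (hx : x ∈ S.desc c) : x ≠ v := by
  rintro rfl; exact S.notMem _ _ hc hx

/-- Follows the heavy path from v with a budget of b vertices, each path vertex x consuming `S.light
x`. It stops at a leaf (H = 0), when the budget is used up, or before a vertex whose light part
exceeds A. The last path vertex may exceed the budget, but only by A, hence the width b + A. The
last clause records what the unfinished rest r has gained: b vertices less, or a light part above A.
-/
lemma cat_exists (A h W' : ℕ) (hA : 1 ≤ A) (ρ : V → ℕ) (v : V) (b : ℕ) (hv : S.light v ≤ A)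
    (hl : ∀ c, 2 * S.size c < S.size v → S.size c ≤ A → S.Draw c (S.size c) h)
    (hr : ∀ r ∈ S.desc v, r ≠ v → S.Draw r W' (ρ r)) :
    ∃ X w H, 1 ≤ w ∧ X + w ≤ S.size v ∧ X + w ≤ b + A ∧
      (∀ W, W' ≤ W → X + w ≤ W → S.Cat v X w h W H) ∧
      (H = 0 ∨ ∃ r ∈ S.desc v, r ≠ v ∧ H = ρ r ∧ (S.size r + b ≤ S.size v ∨ A < S.light r)) := by
  induction hn : S.size v using Nat.strong_induction_on generalizing v b with
  | _ n ih =>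
    by_cases hk : S.kids v = ∅
    · exact ⟨0, 1, 0, le_rfl, by have := S.size_pos v; omega, by omega,
        fun W _ hW => cat_leaf hk le_rfl (by omega), Or.inl rfl⟩
    obtain ⟨r, hh⟩ := exists_isHeavy hk
    have hlt := S.size_kid_lt hh.1
    have hsz := hh.size_eq_light
    have hle := hh.light_eq
    have hl' : ∀ c ∈ (S.kids v).erase r, S.Draw c (S.size c) h := fun c hc => by
      refine hl c (hh.two_mul_lt hc) ?_
      have := Finset.single_le_sum (f := S.size) (fun _ _ => Nat.zero_le _) hc
      omega
    have hrv : r ≠ v := ne_of_mem_desc_kid hh.1 (S.self_mem r)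
    by_cases hlast : A < S.light r ∨ b ≤ S.light v
    · refine ⟨0, S.light v, ρ r, by omega, by have := light_le (S := S) v; omega, by omega,
        fun W hW' hW => ?_, Or.inr ⟨r, S.kid_mem_desc hh.1, hrv, rfl, ?_⟩⟩
      · rw [hle]
        exact cat_last hh.1 hl' (hr r (S.kid_mem_desc hh.1) hrv) hW' (by omega)
      · rcases hlast with h1 | h1
        · exact Or.inr h1
        · left; omega
    · push Not at hlast
      obtain ⟨X, w, H, h1, h2, h3, h4, h5⟩ := ih _ (hn ▸ hlt) r (b - S.light v) hlast.1
        (fun c hc => hl c (by omega))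
        (fun x hx hxr => hr x (S.desc_subset_of_kid hh.1 hx) (ne_of_mem_desc_kid hh.1 hx)) rfl
      refine ⟨X + w, S.light v, H, by omega, by omega, by omega, fun W hW' hW => ?_, ?_⟩
      · rw [hle]
        exact cat_step hh.1 hl' (h4 W hW' (by omega)) h1 (by omega)
      · rcases h5 with h5 | ⟨x, hx, hxr, h6, h7⟩
        · exact Or.inl h5
        · refine Or.inr ⟨x, S.desc_subset_of_kid hh.1 hx, ne_of_mem_desc_kid hh.1 hx, h6, ?_⟩
          rcases h7 with h7 | h7
          · left; omega
          · exact Or.inr h7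

/-- A subtree of size `n` is drawn in `n` columns and `O(log n)` rows. -/
lemma rootDraw_flat (S : ChildSystem V) (v : V) :
    S.RootDraw v (S.size v) (1 + 2 * Nat.log 2 (S.size v)) := by
  induction hn : S.size v using Nat.strong_induction_on generalizing v with
  | _ n ih =>
    have hpos := S.size_pos v
    by_cases hk : S.kids v = ∅
    · intro σ
      rw [hk]
      refine (S.starDraw_empty v).mono ?_
      rintro p hp
      rw [hp]
      have h1 : (1 : ℝ) ≤ n := by exact_mod_cast (show 1 ≤ n by omega)
      have h2 : (0 : ℝ) ≤ σ := Nat.cast_nonneg σ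
      refine ⟨by simp, by simp; linarith, by simp, by push_cast; simp,
        fun h => by norm_num at h⟩
    obtain ⟨r, hh⟩ := exists_isHeavy hk
    have hlt := S.size_kid_lt hh.1
    have hsz := hh.size_eq_light
    have hle := hh.light_eq
    -- A light subtree has less than half of the vertices, so its logarithm drops by one. The two
    -- rows gained are those of the root and of the heavy path.
    have hl : ∀ c, 2 * S.size c < n → S.Draw c (S.size c) (2 * Nat.log 2 n - 1) := fun c hc => by
      refine (ih _ (by omega) c rfl).draw.mono le_rfl ?_
      have : Nat.log 2 (S.size c) + 1 ≤ Nat.log 2 n := by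
        rw [← Nat.log_mul_base one_lt_two (S.size_pos c).ne']
        exact Nat.log_mono_right (by omega)
      omega
    have hrest : ∀ x ∈ S.desc r, x ≠ r → S.Draw x n (1 + 2 * Nat.log 2 (S.size x)) := by
      intro x hx _
      have h6 : S.size x ≤ S.size r := Finset.card_le_card (S.desc_subset hx)
      exact (ih _ (by omega) x rfl).draw.mono (by omega) le_rfl
    -- With A = b = n neither bound can be reached inside the subtree at r, which has fewer than n
    -- vertices. So the whole heavy path is one section and H = 0.
    obtain ⟨X, w, H, h1, h2, h3, h4, h5⟩ := cat_exists (S := S) n (2 * Nat.log 2 n - 1) n (by omega)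
      (fun x => 1 + 2 * Nat.log 2 (S.size x)) r n ((light_le r).trans (by omega))
      (fun c hc _ => hl c (by omega)) hrest
    · have hH : H = 0 := by
        rcases h5 with h5 | ⟨x, hx, hxr, h6, h7 | h7⟩
        · exact h5
        · have := S.size_pos x; omega
        · have := Finset.card_le_card (S.desc_subset hx)
          have := light_le (S := S) x
          unfold size at *; omega
      subst hH
      have h6 : 1 ≤ Nat.log 2 n := Nat.log_pos one_lt_two (by have := S.size_pos r; omega)
      have := rootDraw_top hh.1 (fun c hc => hl c (hn ▸ hh.two_mul_lt hc)) (h4 n le_rfl (by omega))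
        h1 (by omega)
      rwa [show 2 * Nat.log 2 n - 1 + 0 + 2 = 1 + 2 * Nat.log 2 n by omega] at this

/-- One section of the heavy path of the subtree at `v`, with a rest below it. -/
lemma draw_chunk (A h W' : ℕ) (hA : 1 ≤ A) (ρ : V → ℕ) (v : V) (b : ℕ) (hv : S.light v ≤ A)
    (hl : ∀ c, 2 * S.size c < S.size v → S.size c ≤ A → S.Draw c (S.size c) h)
    (hr : ∀ r ∈ S.desc v, r ≠ v → S.Draw r W' (ρ r)) :
    ∃ H, S.Draw v (max W' (b + A)) (h + H + 2) ∧
      (H = 0 ∨ ∃ r ∈ S.desc v, r ≠ v ∧ H = ρ r ∧ (S.size r + b ≤ S.size v ∨ A < S.light r)) := by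
  by_cases hk : S.kids v = ∅
  · exact ⟨0, (draw_of_kids_eq_empty hk).mono (by omega) (by omega), Or.inl rfl⟩
  obtain ⟨r, hh⟩ := exists_isHeavy hk
  have hlt := S.size_kid_lt hh.1
  have hsz := hh.size_eq_light
  have hle := hh.light_eq
  have hl' : ∀ c ∈ (S.kids v).erase r, S.Draw c (S.size c) h := fun c hc => by
    refine hl c (hh.two_mul_lt hc) ?_
    have := Finset.single_le_sum (f := S.size) (fun _ _ => Nat.zero_le _) hc
    omega
  have hrv : r ≠ v := ne_of_mem_desc_kid hh.1 (S.self_mem r)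
  by_cases hlast : A < S.light r ∨ b ≤ S.light v
  · refine ⟨ρ r, ?_, Or.inr ⟨r, S.kid_mem_desc hh.1, hrv, rfl, ?_⟩⟩
    · have h1 := cat_last (W := max W' (b + A)) hh.1 hl' (hr r (S.kid_mem_desc hh.1) hrv)
        (le_max_left _ _) (by omega)
      refine StarDraw.mono h1 ?_
      rintro p ⟨a1, a2, a3, a4, -, -⟩
      simp only [Nat.cast_zero, neg_zero, sub_zero] at *
      exact ⟨a1, a2, a3, by push_cast; linarith⟩
    · rcases hlast with h1 | h1
      · exact Or.inr h1
      · left; omega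
  · push Not at hlast
    obtain ⟨X, w, H, h1, h2, h3, h4, h5⟩ := cat_exists (S := S) A h W' hA ρ r (b - S.light v)
      hlast.1
      (fun c hc => hl c (by omega))
      (fun x hx hxr => hr x (S.desc_subset_of_kid hh.1 hx) (ne_of_mem_desc_kid hh.1 hx))
    refine ⟨H, (rootDraw_top hh.1 hl' (h4 (max W' (b + A)) (le_max_left _ _)
      (le_max_of_le_right (by omega)))
      h1 (le_max_of_le_right (by omega))).draw,
      ?_⟩
    rcases h5 with h5 | ⟨x, hx, hxr, h6, h7⟩
    · exact Or.inl h5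
    · refine Or.inr ⟨x, S.desc_subset_of_kid hh.1 hx, ne_of_mem_desc_kid hh.1 hx, h6, ?_⟩
      rcases h7 with h7 | h7
      · left; omega
      · exact Or.inr h7

/-! ### Staircases of flat drawings -/

/-- `idx` is the row of a root and `o` the offset of its subtree. The order is reversed: the higher
a root, the further to the right its subtree, so that it descends beyond the right end of all
drawings whose roots are lower. -/
lemma exists_staircase {ι : Type*} [DecidableEq ι] (B : Finset ι) (w : ι → ℕ) :
    ∃ idx o : ι → ℕ, (∀ c ∈ B, idx c < B.card ∧ o c + w c ≤ ∑ d ∈ B, w d) ∧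
      ∀ c ∈ B, ∀ d ∈ B, c ≠ d → idx c ≠ idx d ∧ (idx c < idx d → o d + w d ≤ o c) := by
  induction B using Finset.induction_on with
  | empty => exact ⟨fun _ => 0, fun _ => 0, by simp, by simp⟩
  | insert a B ha ih =>
    obtain ⟨idx, o, h1, h2⟩ := ih
    refine ⟨fun c => if c = a then B.card else idx c, fun c => if c = a then 0 else o c + w a,
      fun c hc => ?_, fun c hc d hd hcd => ?_⟩
    · rw [Finset.card_insert_of_notMem ha, Finset.sum_insert ha]
      by_cases hca : c = a
      · simp [hca]
      · have := h1 c (Finset.mem_of_mem_insert_of_ne hc hca)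
        simp only [hca, if_false]; omega
    · by_cases hca : c = a <;> by_cases hda : d = a
      · exact absurd (hca.trans hda.symm) hcd
      · have := h1 d (Finset.mem_of_mem_insert_of_ne hd hda)
        simp only [hca, hda, if_true, if_false]; omega
      · have := h1 c (Finset.mem_of_mem_insert_of_ne hc hca)
        simp only [hca, hda, if_true, if_false]; omega
      · have := h2 c (Finset.mem_of_mem_insert_of_ne hc hca) d
          (Finset.mem_of_mem_insert_of_ne hd hda) hcd
        simp only [hca, hda, if_false]
        exact ⟨this.1, fun h => by have := this.2 h; omega⟩

/-- Subtrees drawn side by side, with their roots stacked in one column, in one row each. -/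
lemma starDraw_staircase {v : V} {B : Finset V} (hB : B ⊆ S.kids v) (w : V → ℕ) {H : ℕ}
    (hd : ∀ c ∈ B, S.RootDraw c (w c) H) (y : ℕ) :
    S.StarDraw v B (Band y (y + (B.card + H)) (∑ c ∈ B, w c)) := by
  obtain ⟨idx, o, h1, h2⟩ := exists_staircase B w
  have hwH : ∀ c ∈ B, (1 : ℝ) ≤ w c ∧ (1 : ℝ) ≤ H := fun c hc => by
    have := (hd c hc).draw.one_le
    exact ⟨by exact_mod_cast this.1, by exact_mod_cast this.2⟩
  have key : ∀ c ∈ B, ∀ d ∈ B, idx c < idx d →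
      armRegion (1, (y + idx c : ℕ)) (rootRegion (o c) (w c) H) ∩
      armRegion (1, (y + idx d : ℕ)) (rootRegion (o d) (w d) H) ⊆ {0} := by
    intro c hc d hd' hlt
    have hne : c ≠ d := by rintro rfl; exact lt_irrefl _ hlt
    have h3 : ((o d : ℝ) + w d) ≤ o c := by exact_mod_cast (h2 c hc d hd' hne).2 hlt
    have h4 : ((y + idx c : ℕ) : ℝ) + 1 ≤ ((y + idx d : ℕ) : ℝ) := by
      exact_mod_cast (by omega : y + idx c + 1 ≤ y + idx d)
    have h5 := hwH d hd'
    have h6 : (0 : ℝ) ≤ o d := Nat.cast_nonneg _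
    rintro p ⟨hp | ⟨a1, a2, a3, a4, a5⟩, hp' | ⟨b1, b2, b3, b4, b5⟩⟩
    · obtain ⟨t, k1, k2, k3, k4⟩ := mem_segment_zero hp
      obtain ⟨t', k1', k2', k3', k4'⟩ := mem_segment_zero hp'
      simp only [Int.cast_one, mul_one, Int.cast_natCast] at *
      have : t' = t := by linarith
      subst this
      have : t' = 0 := by nlinarith
      subst this
      exact Prod.ext (by simpa using k3) (by simpa using k4)
    · exfalso
      obtain ⟨t, k1, k2, k3, k4⟩ := mem_segment_zero hp
      simp only [toPlane, Prod.fst_sub, Prod.snd_sub, Int.cast_one, mul_one, Int.cast_natCast] at *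
      have : t = 1 := by linarith
      subst this
      linarith
    · exfalso
      obtain ⟨t, k1, k2, k3, k4⟩ := mem_segment_zero hp'
      simp only [toPlane, Prod.fst_sub, Prod.snd_sub, Int.cast_one, mul_one, Int.cast_natCast] at *
      have : t = 1 := by linarith
      subst this
      have := a5 (by linarith)
      linarith
    · exfalso
      simp only [toPlane, Prod.fst_sub, Prod.snd_sub, Int.cast_one, Int.cast_natCast] at *
      have := a5 (by linarith)
      linarith
  have := StarDraw.biUnion (S := S) (v := v) B (fun c => {c})
    (fun c => armRegion (1, (y + idx c : ℕ)) (rootRegion (o c) (w c) H)) (fun c hc => ?_)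
    (fun c hc => Finset.singleton_subset_iff.2 (hB hc))
    (fun c _ d _ hcd => Finset.disjoint_singleton.2 hcd) (fun c hc d hd' hne => ?_)
  · rw [Finset.biUnion_singleton_eq_self] at this
    refine this.mono (Set.union_subset (zero_subset_band _ _ _) (Set.iUnion₂_subset fun c hc => ?_))
    have h3 : ((o c : ℝ) + w c) ≤ (∑ d ∈ B, w d : ℕ) := by exact_mod_cast (h1 c hc).2
    have h4 : (idx c : ℝ) + 1 ≤ B.card := by exact_mod_cast (h1 c hc).1
    have h5 := hwH c hc
    have h6 : (0 : ℝ) ≤ o c := Nat.cast_nonneg _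
    have h7 : (0 : ℝ) ≤ idx c := Nat.cast_nonneg _
    have h8 : (0 : ℝ) ≤ y := Nat.cast_nonneg _
    rintro p (hp | ⟨a1, a2, a3, a4, a5⟩)
    · obtain ⟨t, k1, k2, k3, k4⟩ := mem_segment_zero hp
      simp only [Int.cast_one, mul_one, Int.cast_natCast] at *
      refine ⟨by linarith, by linarith, ?_, ?_⟩
      · rw [k3, k4, min_eq_left k2]; push_cast; nlinarith
      · rw [k3, k4, min_eq_left k2]; push_cast; nlinarith
    · simp only [toPlane, Prod.fst_sub, Prod.snd_sub, Int.cast_one, Int.cast_natCast] at *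
      push_cast at *
      refine ⟨by linarith, by push_cast; linarith, ?_, ?_⟩
      · rw [min_eq_right (by linarith)]; linarith
      · rw [min_eq_right (by linarith)]; push_cast; linarith
  · refine (hd c hc (o c)).single (hB hc) _ (by simp) ?_
    rintro p hp ⟨a1, a2, a3, a4, a5⟩
    obtain ⟨t, k1, k2, k3, k4⟩ := mem_segment_zero hp
    simp only [toPlane, Prod.fst_sub, Prod.snd_sub, Int.cast_one, mul_one, Int.cast_natCast] at *
    have : t = 1 := by linarith
    subst this
    ext <;> simp [k3, k4]
  · rcases lt_or_gt_of_ne (h2 c hc d hd' hne).1 with hlt | hlt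
    · exact key c hc d hd' hlt
    · rw [Set.inter_comm]; exact key d hd' c hc hlt

end ChildSystem

/-! ### Coprime pairs and disjoint unimodular cones -/

/-- Telescoping with 1/d² ≤ 1/(d - 1) - 1/d for d ≥ 3. Keeping the term 1/4 for d = 2 exact brings
the constant below 1, which `le_card_coprime` needs. -/
lemma sum_inv_sq_le (N : ℕ) (hN : 2 ≤ N) :
    ∑ d ∈ Finset.Icc 2 N, (1 : ℝ) / (d : ℝ) ^ 2 ≤ 3 / 4 - 1 / N := by
  induction N, hN using Nat.le_induction with
  | base => norm_num
  | succ n hn ih =>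
    rw [← Finset.insert_Icc_right_eq_Icc_add_one (by omega), Finset.sum_insert (by simp)]
    have hn' : (0 : ℝ) < n := by positivity
    have : (1 : ℝ) / ((n + 1 : ℕ) : ℝ) ^ 2 ≤ 1 / n - 1 / ((n + 1 : ℕ) : ℝ) := by
      push_cast
      rw [div_sub_div _ _ hn'.ne' (by positivity), div_le_div_iff₀ (by positivity) (by positivity)]
      nlinarith
    linarith

/-- At least a quarter of the pairs in a box are coprime. -/
lemma le_card_coprime (P Q : ℕ) :
    P * Q ≤ 4 * ((Finset.Ioc 0 P ×ˢ Finset.Ioc 0 Q).filter fun x => Nat.Coprime x.1 x.2).card := by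
  set U := Finset.Ioc 0 P ×ˢ Finset.Ioc 0 Q
  have hU : U.card = P * Q := by simp [U, Finset.card_product]
  -- A pair that is not coprime consists of multiples of d = gcd ≥ 2, and at most PQ/d² pairs do for
  -- a given d. The upper end P + 2 only ensures that the range is nonempty.
  have h1 : U.filter (fun x => ¬ Nat.Coprime x.1 x.2) ⊆ (Finset.Icc 2 (P + 2)).biUnion fun d =>
      ((Finset.Ioc 0 P).filter (d ∣ ·)) ×ˢ ((Finset.Ioc 0 Q).filter (d ∣ ·)) := by
    rintro ⟨x, y⟩ hx
    simp only [U, Finset.mem_filter, Finset.mem_product, Finset.mem_Ioc, Finset.mem_biUnion,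
      Finset.mem_Icc] at hx ⊢
    have hg : Nat.gcd x y ≠ 1 := hx.2
    have hg0 : 0 < Nat.gcd x y := Nat.gcd_pos_of_pos_left _ hx.1.1.1
    have hgx : Nat.gcd x y ≤ x := Nat.gcd_le_left _ hx.1.1.1
    exact ⟨Nat.gcd x y, ⟨by omega, by omega⟩, ⟨hx.1.1, Nat.gcd_dvd_left _ _⟩,
      ⟨hx.1.2, Nat.gcd_dvd_right _ _⟩⟩
  have h2 : ((U.filter fun x => ¬ Nat.Coprime x.1 x.2).card : ℝ) ≤ 3 / 4 * (P * Q) := by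
    have h3 := (Finset.card_le_card h1).trans Finset.card_biUnion_le
    simp only [Finset.card_product, Nat.Ioc_filter_dvd_card_eq_div] at h3
    have h4 : ((U.filter fun x => ¬ Nat.Coprime x.1 x.2).card : ℝ) ≤
        ∑ d ∈ Finset.Icc 2 (P + 2), (P * Q : ℝ) * (1 / (d : ℝ) ^ 2) := by
      refine le_trans (by exact_mod_cast h3 :
        _ ≤ ((∑ d ∈ Finset.Icc 2 (P + 2), P / d * (Q / d) : ℕ) : ℝ)) ?_
      push_cast
      refine Finset.sum_le_sum fun d hd => ?_
      have hd0 : (0 : ℝ) < d := by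
        have := (Finset.mem_Icc.1 hd).1
        exact_mod_cast (by omega : 0 < d)
      calc ((P / d : ℕ) : ℝ) * ((Q / d : ℕ) : ℝ) ≤ (P / d) * (Q / d) := by
            gcongr <;> exact Nat.cast_div_le
        _ = (P * Q : ℝ) * (1 / (d : ℝ) ^ 2) := by field_simp
    rw [← Finset.mul_sum] at h4
    have h5 := sum_inv_sq_le (P + 2) (by omega)
    have h6 : (0 : ℝ) ≤ 1 / (P + 2 : ℕ) := by positivity
    have h7 : (0 : ℝ) ≤ P * Q := by positivity
    nlinarith
  have h3 := Finset.card_filter_add_card_filter_not (s := U) (fun x => Nat.Coprime x.1 x.2)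
  rw [hU] at h3
  have h4 : ((U.filter fun x => Nat.Coprime x.1 x.2).card : ℝ) +
      (U.filter fun x => ¬ Nat.Coprime x.1 x.2).card = P * Q := by exact_mod_cast h3
  have : ((P * Q : ℕ) : ℝ) ≤ (4 * (U.filter fun x => Nat.Coprime x.1 x.2).card : ℕ) := by
    push_cast; linarith
  exact_mod_cast this

/-- The cone spanned by two vectors. -/
def cone (u w : ℤ × ℤ) : Set (ℝ × ℝ) :=
  {p | ∃ a b : ℝ, 0 ≤ a ∧ 0 ≤ b ∧ p = ChildSystem.colMap u w (a, b)}

/-- The vectors w with determinant 1 against (p, q) are the translates of one of them by multiples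
of (p, q). The first translate that leaves the box on the upper side is taken; one step of (p, q) is
at most (P, Q), which gives the bound (2P, 2Q). Lying outside the box keeps the cone of (p, q) and w
thin; see `cone_inter`. -/
lemma exists_partner {p q P Q : ℤ} (hp : 1 ≤ p) (hq : 1 ≤ q) (hpP : p ≤ P) (hqQ : q ≤ Q)
    (h : IsCoprime p q) :
    ∃ w : ℤ × ℤ, p * w.2 - q * w.1 = 1 ∧ ¬ (w.1 ≤ P ∧ w.2 ≤ Q) ∧ 1 ≤ w.1 ∧ 1 ≤ w.2 ∧
      w.1 ≤ 2 * P ∧ w.2 ≤ 2 * Q := by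
  obtain ⟨a, b, hab⟩ := h
  set t := min ((P + b) / p) ((Q - a) / q)
  have h1 : t * p ≤ P + b :=
    (mul_le_mul_of_nonneg_right (min_le_left _ _) (by omega)).trans (Int.ediv_mul_le _ (by omega))
  have h2 : t * q ≤ Q - a :=
    (mul_le_mul_of_nonneg_right (min_le_right _ _) (by omega)).trans (Int.ediv_mul_le _ (by omega))
  have h3 : P + b < (t + 1) * p ∨ Q - a < (t + 1) * q := by
    rcases min_choice ((P + b) / p) ((Q - a) / q) with e | e
    · left; simp only [t, e]; exact Int.lt_ediv_add_one_mul_self _ (by omega)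
    · right; simp only [t, e]; exact Int.lt_ediv_add_one_mul_self _ (by omega)
  have hdet : p * (a + (t + 1) * q) - q * (-b + (t + 1) * p) = 1 := by linear_combination hab
  refine ⟨(-b + (t + 1) * p, a + (t + 1) * q), hdet, ?_, ?_, ?_, ?_, ?_⟩
  · rintro ⟨k1, k2⟩
    rcases h3 with h3 | h3 <;> simp only at k1 k2 <;> linarith
  · rcases h3 with h3 | h3
    · simp only; linarith
    · by_contra hc
      simp only [not_le] at hc
      have : q * (-b + (t + 1) * p) ≤ 0 := by nlinarith
      nlinarith
  · rcases h3 with h3 | h3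
    · by_contra hc
      simp only [not_le] at hc
      have : p * (a + (t + 1) * q) ≤ 0 := by nlinarith
      nlinarith
    · simp only; linarith
  · simp only; linarith
  · simp only; linarith

/-- If u' were in the cone of u and w but not on the ray of u, it would be an integer combination
with a positive coefficient at w, so w would lie below u' in both coordinates and hence in the box.
So u' comes after w in the angular order, and w' comes after u'; the two cones meet only in their
apex. -/
lemma cone_inter {u w u' w' : ℤ × ℤ} {P Q : ℤ} (hu1 : 1 ≤ u.1) (hw1 : 1 ≤ w.1)
    (hw2 : 1 ≤ w.2) (hd : u.1 * w.2 - u.2 * w.1 = 1) (hw : ¬ (w.1 ≤ P ∧ w.2 ≤ Q))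
    (hu1' : 1 ≤ u'.1) (hu2 : 1 ≤ u.2) (hw1' : 1 ≤ w'.1)
    (hd' : u'.1 * w'.2 - u'.2 * w'.1 = 1) (hP : u'.1 ≤ P) (hQ : u'.2 ≤ Q)
    (hlt : 0 < u.1 * u'.2 - u.2 * u'.1) : cone u w ∩ cone u' w' ⊆ {0} := by
  have h1 : 0 < w.1 * u'.2 - w.2 * u'.1 := by
    by_contra hc
    apply hw
    have e1 : u'.1 = (w.2 * u'.1 - w.1 * u'.2) * u.1 + (u.1 * u'.2 - u.2 * u'.1) * w.1 := by
      linear_combination -u'.1 * hd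
    have e2 : u'.2 = (w.2 * u'.1 - w.1 * u'.2) * u.2 + (u.1 * u'.2 - u.2 * u'.1) * w.2 := by
      linear_combination -u'.2 * hd
    constructor <;> nlinarith
  have trans : ∀ a b : ℤ, 1 ≤ a → 0 < a * u'.2 - b * u'.1 → 0 < a * w'.2 - b * w'.1 := by
    intro a b ha hab
    have : u'.1 * (a * w'.2 - b * w'.1) = a + (a * u'.2 - b * u'.1) * w'.1 := by
      linear_combination a * hd'
    have h3 : 0 < u'.1 * (a * w'.2 - b * w'.1) := by rw [this]; positivity
    exact pos_of_mul_pos_right h3 (by omega)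
  have h2 := trans _ _ hu1 hlt
  have h3 := trans _ _ hw1 h1
  have c0 : (0 : ℝ) < u.1 * u'.2 - u.2 * u'.1 := by exact_mod_cast hlt
  have c1 : (0 : ℝ) < w.1 * u'.2 - w.2 * u'.1 := by exact_mod_cast h1
  have c2 : (0 : ℝ) < u.1 * w'.2 - u.2 * w'.1 := by exact_mod_cast h2
  have c3 : (0 : ℝ) < w.1 * w'.2 - w.2 * w'.1 := by exact_mod_cast h3
  rintro p ⟨⟨a, b, ha, hb, hp⟩, ⟨a', b', ha', hb', hp'⟩⟩
  have e := hp.symm.trans hp'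
  have e1 : a * u.1 + b * w.1 = a' * u'.1 + b' * w'.1 := congrArg Prod.fst e
  have e2 : a * u.2 + b * w.2 = a' * u'.2 + b' * w'.2 := congrArg Prod.snd e
  -- The determinant of the common point with itself, expanded in the two pairs of generators: a
  -- vanishing sum of nonnegative terms.
  have e3 : a * a' * (u.1 * u'.2 - u.2 * u'.1 : ℝ) + a * b' * (u.1 * w'.2 - u.2 * w'.1 : ℝ) +
      b * a' * (w.1 * u'.2 - w.2 * u'.1 : ℝ) + b * b' * (w.1 * w'.2 - w.2 * w'.1 : ℝ) = 0 := by
    linear_combination -(a' * u'.1 + b' * w'.1) * e2 + (a' * u'.2 + b' * w'.2) * e1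
  have f0 : 0 ≤ a * a' * (u.1 * u'.2 - u.2 * u'.1 : ℝ) := by positivity
  have f1 : 0 ≤ a * b' * (u.1 * w'.2 - u.2 * w'.1 : ℝ) := by positivity
  have f2 : 0 ≤ b * a' * (w.1 * u'.2 - w.2 * u'.1 : ℝ) := by positivity
  have f3 : 0 ≤ b * b' * (w.1 * w'.2 - w.2 * w'.1 : ℝ) := by positivity
  have g0 : a * a' * (u.1 * u'.2 - u.2 * u'.1 : ℝ) = 0 := by linarith
  have g1 : a * b' * (u.1 * w'.2 - u.2 * w'.1 : ℝ) = 0 := by linarith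
  have g2 : b * a' * (w.1 * u'.2 - w.2 * u'.1 : ℝ) = 0 := by linarith
  have g3 : b * b' * (w.1 * w'.2 - w.2 * w'.1 : ℝ) = 0 := by linarith
  simp only [mul_eq_zero, c0.ne', c1.ne', c2.ne', c3.ne', or_false] at g0 g1 g2 g3
  have : (a = 0 ∧ b = 0) ∨ (a' = 0 ∧ b' = 0) := by tauto
  rcases this with ⟨rfl, rfl⟩ | ⟨rfl, rfl⟩
  · rw [hp]; simp [ChildSystem.colMap]
  · rw [hp']; simp [ChildSystem.colMap]

/-- Many disjoint unimodular cones with short generators. -/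
lemma exists_cones (P Q K : ℕ) (h : 4 * K ≤ P * Q) :
    ∃ u w : ℕ → ℤ × ℤ, (∀ i < K, 1 ≤ (u i).1 ∧ 1 ≤ (u i).2 ∧ (u i).1 ≤ P ∧ (u i).2 ≤ Q ∧
      1 ≤ (w i).1 ∧ 1 ≤ (w i).2 ∧ (w i).1 ≤ 2 * P ∧ (w i).2 ≤ 2 * Q ∧
      (u i).1 * (w i).2 - (u i).2 * (w i).1 = 1) ∧
      ∀ i < K, ∀ j < K, i ≠ j → cone (u i) (w i) ∩ cone (u j) (w j) ⊆ {0} := by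
  set C := (Finset.Ioc 0 P ×ˢ Finset.Ioc 0 Q).filter fun x => Nat.Coprime x.1 x.2
  have hC : K ≤ C.card := by
    have h0 : P * Q ≤ 4 * C.card := le_card_coprime P Q
    omega
  let x : ℕ → ℕ × ℕ := fun i => if hi : i < C.card then (C.equivFin.symm ⟨i, hi⟩).1 else 0
  have hx : ∀ i < K, 1 ≤ (x i).1 ∧ (x i).1 ≤ P ∧ 1 ≤ (x i).2 ∧ (x i).2 ≤ Q ∧
      Nat.Coprime (x i).1 (x i).2 := by
    intro i hi
    have h1 : x i ∈ C := by
      simp only [x, dif_pos (hi.trans_le hC)]; exact Subtype.property _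
    simp only [C, Finset.mem_filter, Finset.mem_product, Finset.mem_Ioc] at h1
    exact ⟨h1.1.1.1, h1.1.1.2, h1.1.2.1, h1.1.2.2, h1.2⟩
  have hinj : ∀ i < K, ∀ j < K, x i = x j → i = j := by
    intro i hi j hj hij
    simp only [x, dif_pos (hi.trans_le hC), dif_pos (hj.trans_le hC)] at hij
    simpa using C.equivFin.symm.injective (Subtype.ext hij)
  have hw : ∀ i, ∃ w : ℤ × ℤ, i < K → ((x i).1 : ℤ) * w.2 - (x i).2 * w.1 = 1 ∧
      ¬ (w.1 ≤ P ∧ w.2 ≤ Q) ∧ 1 ≤ w.1 ∧ 1 ≤ w.2 ∧ w.1 ≤ 2 * P ∧ w.2 ≤ 2 * Q := by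
    intro i
    by_cases hi : i < K
    · obtain ⟨h1, h2, h3, h4, h5⟩ := hx i hi
      obtain ⟨w, hw⟩ := exists_partner (p := (x i).1) (q := (x i).2) (P := P) (Q := Q)
        (by exact_mod_cast h1) (by exact_mod_cast h3) (by exact_mod_cast h2) (by exact_mod_cast h4)
        (Nat.isCoprime_iff_coprime.2 h5)
      exact ⟨w, fun _ => hw⟩
    · exact ⟨0, fun h => absurd h hi⟩
  choose w hw using hw
  have main : ∀ i < K, ∀ j < K, ((x i).2 : ℤ) * (x j).1 < (x i).1 * (x j).2 →
      cone ((x i).1, (x i).2) (w i) ∩ cone ((x j).1, (x j).2) (w j) ⊆ {0} := by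
    intro i hi j hj hlt
    obtain ⟨a1, a2, a3, a4, a5⟩ := hx i hi
    obtain ⟨b1, b2, b3, b4, b5⟩ := hx j hj
    obtain ⟨c1, c2, c3, c4, c5, c6⟩ := hw i hi
    obtain ⟨d1, d2, d3, d4, d5, d6⟩ := hw j hj
    zify at a1 a2 a3 a4 b1 b2 b3 b4
    exact cone_inter (P := P) (Q := Q) a1 c3 c4 c1 c2 b1 a3 d3 d1 b2 b4 (by simpa using hlt)
  refine ⟨fun i => ((x i).1, (x i).2), w, fun i hi => ?_, fun i hi j hj hij => ?_⟩
  · obtain ⟨a1, a2, a3, a4, a5⟩ := hx i hi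
    obtain ⟨c1, c2, c3, c4, c5, c6⟩ := hw i hi
    zify at a1 a2 a3 a4
    exact ⟨a1, a3, a2, a4, c3, c4, c5, c6, c1⟩
  · rcases lt_trichotomy (((x i).2 : ℤ) * (x j).1) ((x i).1 * (x j).2) with hlt | heq | hlt
    · exact main i hi j hj hlt
    · exfalso
      apply hij
      apply hinj i hi j hj
      obtain ⟨a1, a2, a3, a4, a5⟩ := hx i hi
      obtain ⟨b1, b2, b3, b4, b5⟩ := hx j hj
      have heq' : (x i).2 * (x j).1 = (x i).1 * (x j).2 := by exact_mod_cast heq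
      have e1 : (x i).1 ∣ (x j).1 := a5.dvd_of_dvd_mul_left (heq' ▸ Nat.dvd_mul_right _ _)
      have e2 : (x j).1 ∣ (x i).1 := by
        refine b5.dvd_of_dvd_mul_right (k := (x j).1) (n := (x j).2) ?_
        exact heq' ▸ Nat.dvd_mul_left _ _
      have e3 := Nat.dvd_antisymm e1 e2
      rw [e3, mul_comm] at heq'
      exact Prod.ext e3 (Nat.eq_of_mul_eq_mul_left (by omega) heq')
    · rw [Set.inter_comm]
      exact main j hj i hi (by linarith)

/-! ### Drawings in squares mapped into cones -/

namespace ChildSystem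

variable {V : Type*} [DecidableEq V] {S : ChildSystem V}

/-- The region that contains the cones used to draw a star. -/
def coneRegion (P Q a : ℕ) : Set (ℝ × ℝ) :=
  {p | 0 ≤ p.1 ∧ p.1 ≤ 3 * a * P ∧ 0 ≤ p.2 ∧ p.2 ≤ 3 * a * Q ∧ p.2 ≤ 2 * Q * p.1 ∧
    p.1 ≤ 2 * P * p.2}

/-- Drawings of parts of a star in squares of side `a` are put in disjoint cones. -/
lemma starDraw_cones {v : V} {P Q K a : ℕ} (h : 4 * K ≤ P * Q) (B : ℕ → Finset V)
    (hB : ∀ i < K, B i ⊆ S.kids v) (hdisj : ∀ i < K, ∀ j < K, i ≠ j → Disjoint (B i) (B j))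
    (hd : ∀ i < K, S.StarDraw v (B i) (Box a a)) :
    S.StarDraw v ((Finset.range K).biUnion B) (coneRegion P Q a) := by
  obtain ⟨u, w, h1, h2⟩ := exists_cones P Q K h
  have h3 := StarDraw.biUnion (S := S) (v := v) (Finset.range K) B
    (fun i => ChildSystem.colMap (u i) (w i) '' Box a a)
    (fun i hi => (hd i (Finset.mem_range.1 hi)).colMap _ _ ?_)
    (fun i hi => hB i (Finset.mem_range.1 hi))
    (fun i hi j hj => hdisj i (Finset.mem_range.1 hi) j (Finset.mem_range.1 hj))
    (fun i hi j hj hij => ?_)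
  · refine h3.mono (Set.union_subset ?_ (Set.iUnion₂_subset fun i hi => ?_))
    · rintro p hp
      rw [hp]
      simp only [coneRegion, Set.mem_ofPred_eq, Prod.fst_zero, Prod.snd_zero, mul_zero, le_refl,
        true_and, and_true]
      constructor <;> positivity
    · obtain ⟨a1, a2, a3, a4, a5, a6, a7, a8, -⟩ := h1 i (Finset.mem_range.1 hi)
      rify at a1 a2 a3 a4 a5 a6 a7 a8
      rintro _ ⟨p, ⟨b1, b2, b3, b4⟩, rfl⟩
      -- The generators have coordinates between 1 and 2P, respectively 2Q. The upper bounds give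
      -- the size of the image, and together with the lower bound 1 they confine the slopes to
      -- between 1/(2P) and 2Q.
      have c1 : p.1 * (u i).1 ≤ a * P := mul_le_mul (by linarith) a3 (by linarith) (by positivity)
      have c2 : p.2 * (w i).1 ≤ a * (2 * P) :=
        mul_le_mul (by linarith) a7 (by linarith) (by positivity)
      have c3 : p.1 * (u i).2 ≤ a * Q := mul_le_mul (by linarith) a4 (by linarith) (by positivity)
      have c4 : p.2 * (w i).2 ≤ a * (2 * Q) :=
        mul_le_mul (by linarith) a8 (by linarith) (by positivity)
      have d1 : p.1 ≤ p.1 * (u i).1 := le_mul_of_one_le_right b1 a1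
      have d2 : p.2 ≤ p.2 * (w i).1 := le_mul_of_one_le_right b3 a5
      have d3 : p.1 ≤ p.1 * (u i).2 := le_mul_of_one_le_right b1 a2
      have d4 : p.2 ≤ p.2 * (w i).2 := le_mul_of_one_le_right b3 a6
      have e1 : p.1 * (u i).1 ≤ p.1 * P := mul_le_mul_of_nonneg_left a3 b1
      have e2 : p.2 * (w i).1 ≤ p.2 * (2 * P) := mul_le_mul_of_nonneg_left a7 b3
      have e3 : p.1 * (u i).2 ≤ p.1 * Q := mul_le_mul_of_nonneg_left a4 b1
      have e4 : p.2 * (w i).2 ≤ p.2 * (2 * Q) := mul_le_mul_of_nonneg_left a8 b3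
      have f1 : (0 : ℝ) ≤ P := Nat.cast_nonneg P
      have f2 : (0 : ℝ) ≤ Q := Nat.cast_nonneg Q
      have g1 : 0 ≤ p.1 * P := by positivity
      have g2 : 0 ≤ p.1 * Q := by positivity
      refine ⟨?_, ?_, ?_, ?_, ?_, ?_⟩ <;> simp only [ChildSystem.colMap]
      · linarith
      · linarith
      · linarith
      · linarith
      · have := mul_le_mul_of_nonneg_left (add_le_add d1 d2) f2
        linarith
      · have := mul_le_mul_of_nonneg_left (add_le_add d3 d4) f1
        linarith
  · rw [(h1 i (Finset.mem_range.1 hi)).2.2.2.2.2.2.2.2]; norm_num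
  · refine subset_trans ?_ (h2 i (Finset.mem_range.1 hi) j (Finset.mem_range.1 hj) hij)
    refine Set.inter_subset_inter ?_ ?_ <;>
    · rintro _ ⟨p, ⟨b1, b2, b3, b4⟩, rfl⟩
      exact ⟨p.1, p.2, b1, b3, rfl⟩

end ChildSystem

/-! ### Bin packing -/

/-- Next-fit bin packing. -/
lemma exists_bins {ι : Type*} [DecidableEq ι] (B : Finset ι) (w : ι → ℕ) (c : ℕ)
    (h : ∀ x ∈ B, w x ≤ c) :
    ∃ (K : ℕ) (b : ι → ℕ), (∀ x ∈ B, b x < K) ∧ (∀ i, ∑ x ∈ B with b x = i, w x ≤ c) ∧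
      c * K ≤ 2 * ∑ x ∈ B, w x + c := by
  -- Bin k is the open one, and its load is counted on the left. An item that does not fit exceeds c
  -- together with this load, which pays for opening bin k + 1.
  suffices H : ∃ (k : ℕ) (b : ι → ℕ), (∀ x ∈ B, b x ≤ k) ∧ (∀ i, ∑ x ∈ B with b x = i, w x ≤ c) ∧
      c * k + ∑ x ∈ B with b x = k, w x ≤ 2 * ∑ x ∈ B, w x by
    obtain ⟨k, b, h1, h2, h3⟩ := H
    exact ⟨k + 1, b, fun x hx => Nat.lt_succ_of_le (h1 x hx), h2, by rw [mul_add]; omega⟩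
  induction B using Finset.induction_on with
  | empty => exact ⟨0, fun _ => 0, by simp, by simp, by simp⟩
  | insert a B ha ih =>
    obtain ⟨k, b, h1, h2, h3⟩ := ih (fun x hx => h x (Finset.mem_insert_of_mem hx))
    have hac := h a (Finset.mem_insert_self a B)
    have key : ∀ j i, ∑ x ∈ insert a B with (if x = a then j else b x) = i, w x =
        (if j = i then w a else 0) + ∑ x ∈ B with b x = i, w x := by
      intro j i
      rw [Finset.sum_filter, Finset.sum_insert ha, if_pos rfl, Finset.sum_filter]
      congr 1
      refine Finset.sum_congr rfl fun x hx => ?_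
      rw [if_neg (show x ≠ a by rintro rfl; exact ha hx)]
    by_cases hfit : w a + ∑ x ∈ B with b x = k, w x ≤ c
    · refine ⟨k, fun x => if x = a then k else b x, fun x hx => ?_, fun i => ?_, ?_⟩
      · dsimp only
        split_ifs with hxa
        · exact le_rfl
        · exact h1 x (Finset.mem_of_mem_insert_of_ne hx hxa)
      · rw [key]
        split_ifs with hki
        · rw [← hki]; exact hfit
        · rw [zero_add]; exact h2 i
      · rw [key, if_pos rfl, Finset.sum_insert ha]; omega
    · have hempty : ∑ x ∈ B with b x = k + 1, w x = 0 := by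
        rw [Finset.filter_false_of_mem, Finset.sum_empty]
        intro x hx; have := h1 x hx; omega
      refine ⟨k + 1, fun x => if x = a then k + 1 else b x, fun x hx => ?_, fun i => ?_, ?_⟩
      · dsimp only
        split_ifs with hxa
        · exact le_rfl
        · have := h1 x (Finset.mem_of_mem_insert_of_ne hx hxa); omega
      · rw [key]
        split_ifs with hki
        · rw [← hki, hempty]; exact hac
        · rw [zero_add]; exact h2 i
      · rw [key, if_pos rfl, Finset.sum_insert ha, hempty, mul_add]; omega

/-! ### Stars of subtrees smaller than s -/

namespace ChildSystem

variable {V : Type*} [DecidableEq V] {S : ChildSystem V}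

variable (S) in
/-- Every star of total size `m ≤ s` is drawn in `a` columns and `m F / a` rows, when
`F ≤ a ≤ m`. -/
def SmallStars (s F : ℕ) : Prop :=
  ∀ v B, B ⊆ S.kids v → 1 + ∑ c ∈ B, S.size c ≤ s → ∀ a, F ≤ a → a ≤ 1 + ∑ c ∈ B, S.size c →
    S.StarDraw v B (Box a ((1 + ∑ c ∈ B, S.size c) * F / a))

/-- A star with at most a vertices fits in the square of `starDraw_square`. For a larger one a
columns are admissible, and the number of rows is at most kF/a ≤ a. -/
lemma SmallStars.square {s F k a : ℕ} (h : S.SmallStars s F) {v : V} {B : Finset V}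
    (hB : B ⊆ S.kids v) (hk : 1 + ∑ c ∈ B, S.size c ≤ k) (hks : k ≤ s) (ha : F ≤ a)
    (hka : k * F ≤ a * a) : S.StarDraw v B (Box a a) := by
  by_cases hm : 1 + ∑ c ∈ B, S.size c ≤ a
  · exact (starDraw_square hB).mono (Box.mono hm hm)
  · refine (h v B hB (hk.trans hks) a ha (by omega)).mono (Box.mono le_rfl ?_)
    exact Nat.div_le_of_le_mul ((Nat.mul_le_mul_right F hk).trans hka)

/-- With m/t columns, rounded up, the height is at most F t; the lower bound on the size makes this
number of columns at least F. -/
lemma SmallStars.draw {s F t : ℕ} (h : S.SmallStars s F) (ht : 1 ≤ t) {c : V}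
    (hc : S.size c ≤ s) (hF : F * t ^ 2 ≤ S.size c) :
    S.Draw c ((S.size c + t - 1) / t) (F * t) := by
  set a := (S.size c + t - 1) / t
  have hs := S.size_pos c
  have h1 : S.size c ≤ t * a := by
    have := Nat.lt_mul_div_succ (S.size c + t - 1) (show 0 < t by omega)
    rw [mul_add] at this
    simp only [a]; omega
  have h2 : F ≤ a := by
    rw [Nat.le_div_iff_mul_le (by omega)]
    have : F * t ≤ F * t ^ 2 := Nat.mul_le_mul_left F (by nlinarith)
    omega
  have h3 : a ≤ S.size c := by
    apply Nat.div_le_of_le_mul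
    have : S.size c + t ≤ t * S.size c + 1 := by nlinarith
    omega
  have h4 := h c (S.kids c) subset_rfl (by rw [← S.size_eq]; exact hc) a h2
    (by rw [← S.size_eq]; exact h3)
  rw [← S.size_eq] at h4
  refine StarDraw.mono h4 (Box.mono le_rfl (Nat.div_le_of_le_mul ?_))
  calc S.size c * F ≤ t * a * F := Nat.mul_le_mul_right F h1
    _ = a * (F * t) := by ring

/-- Up to row 1 the slope bound decides: the cones satisfy p.1 ≤ 2P p.2, while the row has p.1 ≥
(3aP + 1) p.2. Below that the column ranges are separate. -/
lemma coneRegion_inter_row {P Q a x₁ h : ℕ} (ha : 1 ≤ a) :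
    coneRegion P Q a ∩ Row (3 * a * P + 1) x₁ h ⊆ {0} := by
  rintro p ⟨⟨h1, h2, h3, h4, h5, h6⟩, ⟨k1, k2, k3, k4⟩⟩
  have ha' : (1 : ℝ) ≤ a := by exact_mod_cast ha
  have hP : (0 : ℝ) ≤ P := Nat.cast_nonneg P
  push_cast at k3
  rcases le_total p.2 1 with h7 | h7
  · rw [min_eq_left h7] at k3
    have h8 : (2 * P : ℝ) ≤ 3 * a * P := by nlinarith
    have h9 : p.2 ≤ 0 := by nlinarith
    have h10 : p.2 = 0 := le_antisymm h9 h3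
    rw [h10] at h6
    exact Prod.ext (le_antisymm (by simpa using h6) h1) h10
  · rw [min_eq_right h7] at k3
    linarith

lemma coneRegion_subset_band {P Q a T W : ℕ} (ha : 1 ≤ a) (hW : 3 * a * P ≤ W)
    (hT : 3 * a * Q ≤ T) : coneRegion P Q a ⊆ Band 0 (T + 1) W := by
  rintro p ⟨h1, h2, h3, h4, h5, h6⟩
  have ha' : (1 : ℝ) ≤ a := by exact_mod_cast ha
  have hQ : (0 : ℝ) ≤ Q := Nat.cast_nonneg Q
  have hW' : (3 * a * P : ℝ) ≤ W := by exact_mod_cast hW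
  have hT' : (3 * a * Q : ℝ) ≤ T := by exact_mod_cast hT
  refine ⟨h1, h2.trans hW', by simpa using h3, ?_⟩
  push_cast
  rw [add_sub_cancel_right]
  rcases min_choice p.1 1 with e | e <;> rw [e]
  · have h8 : (2 * Q : ℝ) ≤ 3 * a * Q := by nlinarith
    nlinarith
  · linarith

lemma row_subset_band {x₀ x₁ h T W : ℕ} (hx : 1 ≤ x₀) (hx₁ : 1 ≤ x₁) (hT : 1 ≤ T) (hh : h ≤ T)
    (hW : x₁ ≤ W + 1) : Row x₀ x₁ h ⊆ Band 0 (T + 1) W := by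
  rintro p ⟨h1, h2, h3, h4⟩
  have hx' : (1 : ℝ) ≤ x₀ := by exact_mod_cast hx
  have hx₁' : (1 : ℝ) ≤ x₁ := by exact_mod_cast hx₁
  have hT' : (1 : ℝ) ≤ T := by exact_mod_cast hT
  have hh' : (h : ℝ) ≤ T := by exact_mod_cast hh
  have hW' : (x₁ : ℝ) ≤ W + 1 := by exact_mod_cast hW
  have hm : 0 ≤ min p.2 1 := le_min h1 zero_le_one
  have hm1 : min p.2 1 ≤ 1 := min_le_right _ _
  have h5 : 0 ≤ p.1 := le_trans (by positivity) h3
  have h6 : min p.2 1 ≤ p.1 := le_trans (le_mul_of_one_le_left hm hx') h3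
  refine ⟨h5, ?_, by simpa using h1, ?_⟩
  · have : (x₁ - 1 : ℝ) * min p.2 1 ≤ x₁ - 1 := mul_le_of_le_one_right (by linarith) hm1
    linarith
  · push_cast
    rw [add_sub_cancel_right]
    rcases le_total p.1 1 with h7 | h7
    · rw [min_eq_left h7]
      rcases le_total p.2 1 with h8 | h8
      · rw [min_eq_left h8] at h6; nlinarith
      · rw [min_eq_right h8] at h6; nlinarith
    · rw [min_eq_right h7]; linarith

/-- The small subtrees of a star. -/
lemma starDraw_small {s F A : ℕ} (hF : 1 ≤ F) (hFs : F ≤ s) (hsA : s ≤ A) (hO : S.SmallStars s F)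
    {v : V} {B : Finset V} (hB : B ⊆ S.kids v) (hs : ∀ c ∈ B, S.size c < s) :
    S.StarDraw v B (Band 0 (300 * F * ((∑ c ∈ B, S.size c) / A + 1) + 1) (12 * A)) := by
  set m := ∑ c ∈ B, S.size c with hm
  set t := m / A + 1 with ht
  have hA : 0 < A := by omega
  have hmt : m ≤ A * t := (Nat.lt_mul_div_succ m hA).le
  have ht1 : 1 ≤ t := Nat.le_add_left 1 _
  -- Up to constants the aim is F t rows. A subtree of size at least F t² attains it by itself
  -- through `SmallStars.draw`, in about 1/t times its size columns; the smaller ones go into the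
  -- cones. If k = s, all of them do.
  set k := min s (F * t ^ 2) with hk
  have hFt2 : F ≤ F * t ^ 2 := Nat.le_mul_of_pos_right F (by positivity)
  have hkF : F ≤ k := le_min hFs hFt2
  have hks : k ≤ s := min_le_left _ _
  have hkt : k ≤ F * t ^ 2 := min_le_right _ _
  -- A star of size at most k fits in a square of side q + 1, just above √(kF).
  set q := Nat.sqrt (k * F) with hq
  have hqF : F ≤ q := Nat.le_sqrt.2 (Nat.mul_le_mul_right F hkF)
  have hqq : q * q ≤ k * F := Nat.sqrt_le _
  have hqq' : k * F ≤ (q + 1) * (q + 1) := (Nat.lt_succ_sqrt (k * F)).le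
  have hqs : q ≤ s := by
    have : q * q ≤ s * s := hqq.trans (Nat.mul_le_mul hks hFs)
    exact Nat.mul_self_le_mul_self_iff.1 this
  have hqt : q ≤ F * t := by
    have : q * q ≤ (F * t) * (F * t) := hqq.trans (by nlinarith [Nat.mul_le_mul_right F hkt])
    exact Nat.mul_self_le_mul_self_iff.1 this
  set a := q + 1 with ha
  set tiny := B.filter fun c => S.size c < k with htiny
  set wide := B.filter fun c => ¬ S.size c < k with hwide
  have hBu : tiny ∪ wide = B := Finset.filter_union_filter_not_eq _ _
  have hdisj : Disjoint tiny wide := Finset.disjoint_filter_filter_not _ _ _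
  have htB : tiny ⊆ B := Finset.filter_subset _ _
  have hwB : wide ⊆ B := Finset.filter_subset _ _
  -- Capacity k - 1 leaves room for v itself. The maximum matters only for k = 1, when there are no
  -- tiny subtrees but `hK` still needs a positive capacity.
  set c := max 1 (k - 1) with hc
  obtain ⟨K, b, hb1, hb2, hb3⟩ := exists_bins tiny S.size c (fun x hx => by
    have := (Finset.mem_filter.1 hx).2; omega)
  have htm : ∑ x ∈ tiny, S.size x ≤ m := Finset.sum_le_sum_of_subset htB
  have hK : k * K ≤ 4 * m + 2 * k := by
    have h1 : k * K ≤ 2 * c * K := Nat.mul_le_mul_right K (by omega)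
    have h2 : c ≤ k := by omega
    rw [mul_assoc] at h1
    omega
  -- P and Q make room for K cones, with a P = O(A). As k K = O(m + k) and a² = O(k F), also a Q =
  -- O(K a²/A + a) = O(F t).
  set P := A / a + 1 with hP
  set Q := 4 * K * a / A + 1 with hQ
  have hPa : A ≤ a * P := (Nat.lt_mul_div_succ A (by omega)).le
  have hQA : 4 * K * a ≤ A * Q := (Nat.lt_mul_div_succ (4 * K * a) hA).le
  have hPa' : a * P ≤ A + a := by
    rw [hP, mul_add, mul_one]; exact Nat.add_le_add_right (Nat.mul_div_le _ _) _
  have hQA' : A * Q ≤ 4 * K * a + A := by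
    rw [hQ, mul_add, mul_one]; exact Nat.add_le_add_right (Nat.mul_div_le _ _) _
  have hPQ : 4 * K ≤ P * Q := by
    have h1 : 4 * K * a * A ≤ A * Q * (a * P) := Nat.mul_le_mul hQA hPa
    have h2 : 4 * K * (a * A) ≤ P * Q * (a * A) := by
      calc _ = 4 * K * a * A := by ring
        _ ≤ _ := h1
        _ = _ := by ring
    exact Nat.le_of_mul_le_mul_right h2 (Nat.mul_pos (by omega) hA)
  have haq : a ≤ 2 * q := by omega
  have haQ : a * Q ≤ 98 * (F * t) := by
    have h1 : a * a ≤ 4 * (k * F) := by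
      calc a * a ≤ (2 * q) * (2 * q) := Nat.mul_le_mul haq haq
        _ = 4 * (q * q) := by ring
        _ ≤ _ := Nat.mul_le_mul_left 4 hqq
    have h2 : A * (a * Q) ≤ A * (98 * (F * t)) := by
      calc A * (a * Q) = a * (A * Q) := by ring
        _ ≤ a * (4 * K * a + A) := Nat.mul_le_mul_left a hQA'
        _ = 4 * K * (a * a) + a * A := by ring
        _ ≤ 4 * K * (4 * (k * F)) + 2 * (F * t) * A := Nat.add_le_add (Nat.mul_le_mul_left _ h1)
            (Nat.mul_le_mul_right A (by omega))
        _ = 16 * F * (k * K) + 2 * (F * t) * A := by ring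
        _ ≤ 16 * F * (4 * m + 2 * k) + 2 * (F * t) * A :=
            Nat.add_le_add_right (Nat.mul_le_mul_left _ hK) _
        _ ≤ 16 * F * (4 * (A * t) + 2 * (A * t)) + 2 * (F * t) * A := by
            have : k ≤ A * t := (hks.trans hsA).trans (Nat.le_mul_of_pos_right A ht1)
            gcongr
        _ = A * (98 * (F * t)) := by ring
    exact Nat.le_of_mul_le_mul_left h2 hA
  have h1 := starDraw_cones (S := S) (v := v) (a := a) hPQ
    (fun i => tiny.filter fun x => b x = i)
    (fun i _ => (Finset.filter_subset _ _).trans (htB.trans hB))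
    (fun i _ j _ hij => by
      rw [Finset.disjoint_left]
      intro x hx hx'
      exact hij ((Finset.mem_filter.1 hx).2.symm.trans (Finset.mem_filter.1 hx').2))
    (fun i _ => by
      refine hO.square ((Finset.filter_subset _ _).trans (htB.trans hB)) (k := k) ?_ hks (by omega)
        hqq'
      by_cases hk1 : k = 1
      · have : tiny = ∅ := by
          refine Finset.filter_false_of_mem fun x _ => ?_
          have := S.size_pos x; omega
        simp only [this, Finset.filter_empty, Finset.sum_empty]
        omega
      · have := hb2 i; omega)
  have htiny_eq : ((Finset.range K).biUnion fun i => tiny.filter fun x => b x = i) = tiny := by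
    ext x
    simp only [Finset.mem_biUnion, Finset.mem_range, Finset.mem_filter]
    exact ⟨fun ⟨_, _, h, _⟩ => h, fun h => ⟨b x, hb1 x h, h, rfl⟩⟩
  rw [htiny_eq] at h1
  have hwide_size : ∀ x ∈ wide, F * t ^ 2 ≤ S.size x := by
    intro x hx
    have h2 := hs x (hwB hx)
    have h3 := (Finset.mem_filter.1 hx).2
    omega
  have h2 := starDraw_row (S := S) (hwB.trans hB) (fun c => (S.size c + t - 1) / t) (h := F * t)
    (fun x hx => hO.draw ht1 (hs x (hwB hx)).le (hwide_size x hx)) (3 * a * P + 1)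
  have hsum : ∑ x ∈ wide, (S.size x + t - 1) / t ≤ 2 * A := by
    have h3 : t * ∑ x ∈ wide, (S.size x + t - 1) / t ≤ t * (2 * A) := by
      calc t * ∑ x ∈ wide, (S.size x + t - 1) / t ≤ ∑ x ∈ wide, 2 * S.size x := by
            rw [Finset.mul_sum]
            refine Finset.sum_le_sum fun x hx => (Nat.mul_div_le _ _).trans ?_
            have h4 := hwide_size x hx
            have h5 : t ≤ F * t ^ 2 := by nlinarith [Nat.mul_le_mul hF (le_refl (t ^ 2))]
            omega
        _ = 2 * ∑ x ∈ wide, S.size x := by rw [Finset.mul_sum]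
        _ ≤ 2 * m := Nat.mul_le_mul_left 2 (Finset.sum_le_sum_of_subset hwB)
        _ ≤ t * (2 * A) := by rw [mul_comm t, mul_assoc]; exact Nat.mul_le_mul_left 2 hmt
    exact Nat.le_of_mul_le_mul_left h3 ht1
  have h3 := h1.union h2 (htB.trans hB) (hwB.trans hB) hdisj (coneRegion_inter_row (by omega))
  rw [hBu] at h3
  have hFt : 1 ≤ F * t := Nat.mul_pos hF ht1
  have hT : 300 * F * t = 300 * (F * t) := mul_assoc _ _ _
  refine h3.mono (Set.union_subset (coneRegion_subset_band (by omega) ?_ ?_)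
    (row_subset_band (by omega) (by omega) ?_ ?_ ?_))
  · rw [mul_assoc]; omega
  · rw [mul_assoc]; omega
  · omega
  · omega
  · rw [mul_assoc]; omega
variable {V : Type*} [DecidableEq V] {S : ChildSystem V}

/-! ### Medium and large subtrees, and the main recursion -/

lemma RootDraw.mono_height {v : V} {W H H' : ℕ} (h : S.RootDraw v W H) (hH : H ≤ H') :
    S.RootDraw v W H' := by
  intro σ
  refine (h σ).mono ?_
  rintro p ⟨h1, h2, h3, h4, h5⟩
  have : (H : ℝ) ≤ H' := by exact_mod_cast hH
  exact ⟨h1, h2, h3, by linarith, h5⟩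

lemma rootDraw_of_size_le {v : V} {A : ℕ} (h : S.size v ≤ A) :
    S.RootDraw v (S.size v) (1 + 2 * Nat.log 2 A) :=
  (rootDraw_flat S v).mono_height (by have := Nat.log_mono_right (b := 2) h; omega)

lemma size_lt_of_mem_desc {v x : V} (hx : x ∈ S.desc v) (h : x ≠ v) : S.size x < S.size v := by
  refine Finset.card_lt_card (Finset.ssubset_iff_subset_ne.2 ⟨S.desc_subset hx, fun e => ?_⟩)
  rw [S.mem_desc] at hx
  obtain rfl | ⟨c, hc, hxc⟩ := hx
  · exact h rfl
  · exact S.notMem v c hc (S.desc_subset hxc (e ▸ S.self_mem v))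

/-- The children with subtrees of medium size are drawn in staircases. -/
lemma starDraw_medium {s A : ℕ} (hs : 0 < s) (hA : 0 < A) {v : V} {B : Finset V}
    (hB : B ⊆ S.kids v) (h : ∀ c ∈ B, s ≤ S.size c ∧ S.size c ≤ A) :
    ∃ H : ℕ, (∀ y, S.StarDraw v B (Band y (y + H) A)) ∧
      (H : ℝ) ≤ (∑ c ∈ B, S.size c : ℕ) / (s : ℝ) +
        (2 * (∑ c ∈ B, S.size c : ℕ) / (A : ℝ) + 1) * (1 + 2 * Nat.log 2 A : ℕ) := by
  obtain ⟨K, b, h1, h2, h3⟩ := exists_bins B S.size A fun x hx => (h x hx).2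
  set H' := 1 + 2 * Nat.log 2 A
  refine ⟨∑ i ∈ Finset.range K, ((B.filter fun x => b x = i).card + H'), fun y => ?_, ?_⟩
  · have h4 := StarDraw.band_biUnion (S := S) (v := v) (Finset.range K)
      (fun i => B.filter fun x => b x = i) (fun i => (B.filter fun x => b x = i).card + H')
      (W := A) y
      (fun i _ y => (starDraw_staircase ((Finset.filter_subset _ _).trans hB) S.size (H := H')
        (fun c hc => rootDraw_of_size_le (h c (Finset.mem_filter.1 hc).1).2) y).mono
        (Band.mono le_rfl le_rfl (h2 i)))
      (fun i _ => (Finset.filter_subset _ _).trans hB)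
      (fun i _ j _ hij => by
        rw [Finset.disjoint_left]
        intro x hx hx'
        exact hij ((Finset.mem_filter.1 hx).2.symm.trans (Finset.mem_filter.1 hx').2))
    have h5 : ((Finset.range K).biUnion fun i => B.filter fun x => b x = i) = B := by
      ext x
      simp only [Finset.mem_biUnion, Finset.mem_range, Finset.mem_filter]
      exact ⟨fun ⟨_, _, h, _⟩ => h, fun h => ⟨b x, h1 x h, h, rfl⟩⟩
    rwa [h5] at h4
  · have h4 : ∑ i ∈ Finset.range K, (B.filter fun x => b x = i).card = B.card :=
      (Finset.card_eq_sum_card_fiberwise fun x hx => by simpa using h1 x hx).symm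
    rw [Finset.sum_add_distrib, h4, Finset.sum_const, Finset.card_range, smul_eq_mul]
    -- Each root takes a row of its own, but has at least s vertices to pay for it.
    have h5 : s * B.card ≤ ∑ c ∈ B, S.size c := by
      have := Finset.card_nsmul_le_sum B S.size s fun c hc => (h c hc).1
      rwa [smul_eq_mul, mul_comm] at this
    have hs' : (0 : ℝ) < s := by exact_mod_cast hs
    have hA' : (0 : ℝ) < A := by exact_mod_cast hA
    have h6 : (B.card : ℝ) ≤ (∑ c ∈ B, S.size c : ℕ) / (s : ℝ) := by
      rw [le_div_iff₀ hs', mul_comm]; exact_mod_cast h5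
    have h7 : (K : ℝ) ≤ 2 * (∑ c ∈ B, S.size c : ℕ) / (A : ℝ) + 1 := by
      rw [div_add_one hA'.ne', le_div_iff₀ hA', mul_comm]; exact_mod_cast h3
    rw [Nat.cast_add, Nat.cast_mul]
    exact add_le_add h6 (mul_le_mul_of_nonneg_right h7 (Nat.cast_nonneg _))

/-- A vertex at which the light subtrees have a total size of at least `A`. -/
lemma draw_big {s F A : ℕ} (hF : 1 ≤ F) (hFs : F ≤ s) (hsA : s ≤ A) (hO : S.SmallStars s F)
    {v r : V} (hr : S.IsHeavy v r) (ρ : V → ℕ)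
    (hd : ∀ c ∈ S.kids v, S.Draw c (12 * A + 1 + Nat.log 2 (S.size c)) (ρ c)) :
    ∃ (H : ℕ) (m₁ m₂ : ℕ) (B : Finset V), S.Draw v (12 * A + 1 + Nat.log 2 (S.size v)) (H + ρ r) ∧
      B ⊆ (S.kids v).erase r ∧ (∀ c ∈ B, A < S.size c) ∧
      S.light v = 1 + m₁ + m₂ + ∑ c ∈ B, S.size c ∧
      (H : ℝ) ≤ 300 * F * (m₁ / (A : ℝ) + 1) + 1 + (m₂ / (s : ℝ) +
        (2 * m₂ / (A : ℝ) + 1) * (1 + 2 * Nat.log 2 A : ℕ)) + (∑ c ∈ B, ρ c : ℕ) := by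
  set K := (S.kids v).erase r with hK
  have hKk : K ⊆ S.kids v := Finset.erase_subset _ _
  set B₁ := K.filter fun c => S.size c < s with hB₁
  set B' := K.filter fun c => ¬ S.size c < s with hB'
  set B₂ := B'.filter fun c => S.size c ≤ A with hB₂
  set B₃ := B'.filter fun c => ¬ S.size c ≤ A with hB₃
  have e1 : B₁ ∪ B' = K := Finset.filter_union_filter_not_eq _ _
  have e2 : B₂ ∪ B₃ = B' := Finset.filter_union_filter_not_eq _ _
  have d1 : Disjoint B₁ B' := Finset.disjoint_filter_filter_not _ _ _
  have d2 : Disjoint B₂ B₃ := Finset.disjoint_filter_filter_not _ _ _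
  have s1 : B₁ ⊆ K := Finset.filter_subset _ _
  have s' : B' ⊆ K := Finset.filter_subset _ _
  have s2 : B₂ ⊆ B' := Finset.filter_subset _ _
  have s3 : B₃ ⊆ B' := Finset.filter_subset _ _
  have hlog : ∀ c ∈ K, Nat.log 2 (S.size c) + 1 ≤ Nat.log 2 (S.size v) := fun c hc =>
    log_size_light hr hc
  have g1 := starDraw_small hF hFs hsA hO (s1.trans hKk) fun c hc => (Finset.mem_filter.1 hc).2
  obtain ⟨H₂, g2, hH₂⟩ := starDraw_medium (S := S) (s := s) (A := A) (B := B₂) (by omega) (by omega)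
    ((s2.trans s').trans hKk) fun c hc => by
      have h1 := Finset.mem_filter.1 hc
      have h2 := Finset.mem_filter.1 h1.1
      exact ⟨not_lt.1 h2.2, h1.2⟩
  set Y := 300 * F * ((∑ c ∈ B₁, S.size c) / A + 1) + 1 with hY
  -- The children larger than A start in column 1. They are light, so the width bound of their own
  -- drawings is smaller by at least one.
  have g3 := starDraw_stack (S := S) (W := 12 * A + Nat.log 2 (S.size v)) ((s3.trans s').trans hKk)
    ρ (fun c hc => (hd c (hKk (s' (s3 hc)))).mono
      (by have := hlog c (s' (s3 hc)); omega) le_rfl) (Y + H₂)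
  have g23 := ((g2 Y).mono (Band.mono le_rfl le_rfl
    (show A ≤ 12 * A + Nat.log 2 (S.size v) by omega))).band_append g3
    ((s2.trans s').trans hKk) ((s3.trans s').trans hKk) d2 (Nat.le_add_right _ _)
    (Nat.le_add_right _ _)
  rw [e2] at g23
  have g := (g1.mono (Band.mono le_rfl le_rfl
    (show 12 * A ≤ 12 * A + Nat.log 2 (S.size v) by omega))).band_append g23
    (s1.trans hKk) (s'.trans hKk) d1 (Nat.zero_le _) (by omega)
  rw [e1] at g
  have g' := g.finish (hd r hr.1) hKk hr.1 (Finset.notMem_erase r _) (by omega)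
  rw [hK, Finset.insert_erase hr.1] at g'
  have hrv : Nat.log 2 (S.size r) ≤ Nat.log 2 (S.size v) :=
    Nat.log_mono_right (S.size_kid_lt hr.1).le
  refine ⟨Y + H₂ + ∑ c ∈ B₃, ρ c, ∑ c ∈ B₁, S.size c, ∑ c ∈ B₂, S.size c, B₃,
    StarDraw.mono g' (Box.mono (by omega) le_rfl), s3.trans s',
    fun c hc => not_le.1 (Finset.mem_filter.1 hc).2, ?_, ?_⟩
  · rw [hr.light_eq, ← hK, ← e1, Finset.sum_union d1, ← e2, Finset.sum_union d2]; ring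
  · have h1 : ((((∑ c ∈ B₁, S.size c) / A : ℕ) : ℝ)) ≤ (∑ c ∈ B₁, S.size c : ℕ) / (A : ℝ) :=
      Nat.cast_div_le
    have h2 : (300 * F : ℝ) * ((((∑ c ∈ B₁, S.size c) / A : ℕ) : ℝ) + 1) ≤
        300 * F * ((∑ c ∈ B₁, S.size c : ℕ) / (A : ℝ) + 1) :=
      mul_le_mul_of_nonneg_left (by linarith) (by positivity)
    have h3 : (Y : ℝ) = (300 * F : ℝ) * ((((∑ c ∈ B₁, S.size c) / A : ℕ) : ℝ) + 1) + 1 := by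
      rw [hY]; push_cast; ring
    rw [Nat.cast_add, Nat.cast_add, h3]
    linarith

/-- Every subtree has a drawing of width `O(A + log n)` and height `O((F + log A) n / A + n / s)`
as soon as the small stars are drawn well. -/
theorem exists_draw {s F A : ℕ} (hF : 1 ≤ F) (hFs : F ≤ s) (hsA : s ≤ A) (hO : S.SmallStars s F)
    (v : V) : ∃ H : ℕ, S.Draw v (12 * A + 1 + Nat.log 2 (S.size v)) H ∧
      (H : ℝ) ≤ (300 * F + 2 * Nat.log 2 A + 10) * (8 * S.size v / (A : ℝ) + 1) +
        S.size v / (s : ℝ) := by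
  have hA : (0 : ℝ) < A := by exact_mod_cast (by omega : 0 < A)
  have hs : (0 : ℝ) < s := by exact_mod_cast (by omega : 0 < s)
  have hF' : (1 : ℝ) ≤ F := by exact_mod_cast hF
  set L := Nat.log 2 A with hL
  have hL0 : (0 : ℝ) ≤ L := Nat.cast_nonneg L
  -- κ is the fixed cost of one section or of one vertex with a large light part, and α is the
  -- charge per vertex; A vertices pay at least 8κ.
  set κ : ℝ := 300 * F + 2 * L + 10 with hκ
  have hκ0 : 0 < κ := by positivity
  set α : ℝ := 8 * κ / A + 1 / s with hα
  have hα0 : 0 < α := by positivity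
  have hαA : 8 * κ ≤ α * A := by
    rw [hα, add_mul, div_mul_cancel₀ _ hA.ne']
    have : 0 ≤ 1 / (s : ℝ) * A := by positivity
    linarith
  have hαm : ∀ m : ℝ, α * m = 8 * (κ * (m / A)) + m / s := by
    intro m; rw [hα]; field_simp
  -- The induction needs credits: 3κ for a subtree larger than A, and one more κ if its root has a
  -- light part above A. The additional κ pays for a section that stops above such a root without
  -- having collected A vertices.
  suffices H : ∀ v : V, ∃ H : ℕ, S.Draw v (12 * A + 1 + Nat.log 2 (S.size v)) H ∧
      (S.size v ≤ A → (H : ℝ) ≤ κ) ∧ (A < S.size v → (H : ℝ) ≤ α * S.size v - 3 * κ) ∧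
      (A < S.light v → (H : ℝ) ≤ α * S.size v - 4 * κ) by
    obtain ⟨H, h1, h2, h3, -⟩ := H v
    refine ⟨H, h1, ?_⟩
    have h4 : κ * (8 * S.size v / (A : ℝ) + 1) + S.size v / (s : ℝ) = α * S.size v + κ := by
      rw [hαm]; ring
    rw [h4]
    have h5 : 0 ≤ α * S.size v := by positivity
    by_cases h : S.size v ≤ A
    · have := h2 h; linarith
    · have := h3 (not_le.1 h); linarith
  clear v
  intro v
  induction hn : S.size v using Nat.strong_induction_on generalizing v with
  | _ n ih =>
  subst hn
  have ih' : ∀ x : V, ∃ H : ℕ, S.size x < S.size v →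
      S.Draw x (12 * A + 1 + Nat.log 2 (S.size x)) H ∧
      (S.size x ≤ A → (H : ℝ) ≤ κ) ∧ (A < S.size x → (H : ℝ) ≤ α * S.size x - 3 * κ) ∧
      (A < S.light x → (H : ℝ) ≤ α * S.size x - 4 * κ) := by
    intro x
    by_cases h : S.size x < S.size v
    · obtain ⟨H, hH⟩ := ih _ h x rfl
      exact ⟨H, fun _ => hH⟩
    · exact ⟨0, fun h' => absurd h' h⟩
  choose ρ hρ using ih'
  have hle : ∀ x, S.size x < S.size v → (ρ x : ℝ) ≤ α * S.size x + κ := by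
    intro x hx
    have h5 : 0 ≤ α * S.size x := by positivity
    by_cases h : S.size x ≤ A
    · have := (hρ x hx).2.1 h; linarith
    · have := (hρ x hx).2.2.1 (not_le.1 h); linarith
  by_cases hsmall : S.size v ≤ A
  · refine ⟨1 + 2 * L, (rootDraw_of_size_le hsmall).draw.mono (by omega) le_rfl, fun _ => ?_,
      fun h => by omega, fun h => by have := S.light_le v; omega⟩
    push_cast; linarith
  push Not at hsmall
  by_cases hbig : A < S.light v
  · have hk : S.kids v ≠ ∅ := by
      intro h
      have h1 := S.size_eq v
      rw [h, Finset.sum_empty] at h1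
      omega
    obtain ⟨r, hr⟩ := exists_isHeavy hk
    have hrv := S.size_kid_lt hr.1
    obtain ⟨H, m₁, m₂, B, h1, h2, h3, h4, h5⟩ := draw_big hF hFs hsA hO hr ρ
      fun c hc => (hρ c (S.size_kid_lt hc)).1
    suffices h6 : ((H + ρ r : ℕ) : ℝ) ≤ α * S.size v - 4 * κ from
      ⟨_, h1, fun h => by omega, fun _ => by linarith, fun _ => h6⟩
    have e1 : (S.size v : ℝ) = 1 + m₁ + m₂ + (∑ c ∈ B, S.size c : ℕ) + S.size r := by
      rw [hr.size_eq_light, h4]; push_cast; ring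
    set M := ∑ c ∈ B, S.size c
    have e2 : α * S.size v = α + α * m₁ + α * m₂ + α * M + α * S.size r := by rw [e1]; ring
    have p1 : (0 : ℝ) ≤ m₁ / A := by positivity
    have p2 : (0 : ℝ) ≤ m₂ / A := by positivity
    have p3 : (0 : ℝ) ≤ m₁ / s := by positivity
    have q1 : 300 * F * (m₁ / A : ℝ) ≤ κ * (m₁ / A) :=
      mul_le_mul_of_nonneg_right (by rw [hκ]; linarith) p1
    have q2 : (1 + 2 * L : ℝ) * (m₂ / A : ℝ) ≤ κ * (m₂ / A) :=
      mul_le_mul_of_nonneg_right (by rw [hκ]; linarith) p2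
    have q3 : (H : ℝ) ≤ κ * (m₁ / A) + 2 * (κ * (m₂ / A)) + m₂ / s + κ + (∑ c ∈ B, ρ c : ℕ) := by
      have : (2 * m₂ / (A : ℝ) + 1) * (1 + 2 * L : ℕ) =
          2 * ((1 + 2 * L : ℝ) * (m₂ / A : ℝ)) + (1 + 2 * L) := by push_cast; ring
      rw [this] at h5
      linarith
    have n1 : 0 ≤ κ * (m₁ / A) := by positivity
    have n2 : 0 ≤ κ * (m₂ / A) := by positivity
    rw [Nat.cast_add, e2, hαm m₁, hαm m₂]
    -- Without light children larger than A, the small and medium ones have at least A vertices in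
    -- total, and these pay for κ, for the possible κ of r and for the credit. Otherwise r is larger
    -- than A as well, and the credits of c and r, 6κ together, cover the cost κ and the credit 4κ.
    rcases B.eq_empty_or_nonempty with hBe | ⟨c, hc⟩
    · have hM : M = 0 := by simp [M, hBe]
      have hR : (∑ c ∈ B, ρ c) = 0 := by simp [hBe]
      rw [hR] at q3
      have h7 := hle r hrv
      have h8 : (A : ℝ) ≤ m₁ + m₂ := by exact_mod_cast (by omega : A ≤ m₁ + m₂)
      have h9 : κ ≤ κ * (m₁ / A) + κ * (m₂ / A) := by
        have : (1 : ℝ) ≤ m₁ / A + m₂ / A := by rw [← add_div, le_div_iff₀ hA]; linarith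
        nlinarith
      rw [hM]
      push_cast at q3 ⊢
      linarith
    · have hcr := hr.2 c (Finset.mem_of_mem_erase (h2 hc))
      have hAr : A < S.size r := (h3 c hc).trans_le hcr
      have h7 := (hρ r hrv).2.2.1 hAr
      have h8 : ((∑ c ∈ B, ρ c : ℕ) : ℝ) ≤ α * M - 3 * κ := by
        have h9 : ∀ d ∈ B, (ρ d : ℝ) ≤ α * S.size d - 3 * κ := fun d hd =>
          (hρ d (S.size_kid_lt (Finset.mem_of_mem_erase (h2 hd)))).2.2.1 (h3 d hd)
        push_cast [M]
        rw [Finset.mul_sum, ← Finset.add_sum_erase _ _ hc,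
          ← Finset.add_sum_erase B (fun i => α * _) hc]
        have h10 : ∑ d ∈ B.erase c, (ρ d : ℝ) ≤ ∑ d ∈ B.erase c, α * S.size d :=
          Finset.sum_le_sum fun d hd => by
            have := h9 d (Finset.mem_of_mem_erase hd); linarith
        have := h9 c hc
        linarith
      linarith
  push Not at hbig
  obtain ⟨H, h1, h2⟩ := draw_chunk A (1 + 2 * L) (12 * A + 1 + Nat.log 2 (S.size v)) (by omega)
    ρ v A
    hbig (fun c _ hc => (rootDraw_of_size_le hc).draw) (fun r hr hrv =>
      (hρ r (size_lt_of_mem_desc hr hrv)).1.mono (by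
        have := Nat.log_mono_right (b := 2) (size_lt_of_mem_desc hr hrv).le
        omega) le_rfl)
  suffices h6 : ((1 + 2 * L + H + 2 : ℕ) : ℝ) ≤ α * S.size v - 3 * κ from
    ⟨_, h1.mono (by omega) le_rfl, fun h => by omega, fun _ => h6, fun _ => by omega⟩
  have hv : α * A ≤ α * S.size v :=
    mul_le_mul_of_nonneg_left (by exact_mod_cast hsmall.le) hα0.le
  push_cast
  -- A section costs at most κ. It is paid by the A vertices collected, or by the additional credit
  -- of a rest whose root has a light part above A.
  rcases h2 with rfl | ⟨r, hr, hrv, rfl, h2⟩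
  · push_cast; linarith
  have hlt := size_lt_of_mem_desc hr hrv
  rcases h2 with h2 | h2
  · by_cases h : S.size r ≤ A
    · have := (hρ r hlt).2.1 h; linarith
    · have h4 := (hρ r hlt).2.2.1 (not_le.1 h)
      have h5 : α * (S.size r + A) ≤ α * S.size v :=
        mul_le_mul_of_nonneg_left (by exact_mod_cast h2) hα0.le
      linarith
  · have h4 := (hρ r hlt).2.2.2 h2
    have h5 : α * S.size r ≤ α * S.size v :=
      mul_le_mul_of_nonneg_left (by exact_mod_cast hlt.le) hα0.le
    linarith

end ChildSystem

/-! ### Rooted trees as child systems -/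

section OfTree

variable {V : Type*} [Fintype V] [DecidableEq V]

open Classical in
/-- The children and descendants in a tree with root `r`. -/
noncomputable def ChildSystem.ofTree {G : SimpleGraph V} (hG : G.IsTree) (r : V) :
    ChildSystem V where
  kids v := Finset.univ.filter fun c => G.Adj v c ∧ G.dist r c = G.dist r v + 1
  desc v := Finset.univ.filter fun x => G.dist r x = G.dist r v + G.dist v x
  desc_eq v := by
    have htri : ∀ u v w, G.dist u w ≤ G.dist u v + G.dist v w := fun _ _ _ =>
      hG.connected.dist_triangle
    ext x
    simp only [Finset.mem_insert, Finset.mem_biUnion, Finset.mem_filter, Finset.mem_univ, true_and]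
    constructor
    · intro hx
      by_cases hxv : x = v
      · exact Or.inl hxv
      right
      obtain ⟨w, hw⟩ := hG.connected.exists_walk_length_eq_dist v x
      cases w with
      | nil => exact absurd rfl hxv
      | @cons _ c _ hvc p =>
        rw [SimpleGraph.Walk.length_cons] at hw
        have h1 := SimpleGraph.dist_le p
        have h2 := htri r c x
        have h3 := htri r v c
        have h4 := SimpleGraph.dist_eq_one_iff_adj.2 hvc
        have h5 := htri v c x
        exact ⟨c, ⟨hvc, by omega⟩, by omega⟩
    · rintro (rfl | ⟨c, ⟨hvc, hc⟩, hx⟩)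
      · simp
      · have h2 := htri r v x
        have h4 := SimpleGraph.dist_eq_one_iff_adj.2 hvc
        have h5 := htri v c x
        omega
  notMem v c hc hv := by
    simp only [Finset.mem_filter, Finset.mem_univ, true_and] at hc hv
    omega
  disj v c hc d hd hcd := by
    simp only [Finset.mem_filter, Finset.mem_univ, true_and] at hc hd
    rw [Finset.disjoint_left]
    intro x hx hx'
    simp only [Finset.mem_filter, Finset.mem_univ, true_and] at hx hx'
    obtain ⟨w, hw⟩ := hG.connected.exists_walk_length_eq_dist r v
    obtain ⟨p, hp⟩ := hG.connected.exists_walk_length_eq_dist c x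
    obtain ⟨q, hq⟩ := hG.connected.exists_walk_length_eq_dist d x
    have h1 : (w.append (p.cons hc.1)).IsPath := SimpleGraph.Walk.isPath_of_length_eq_dist _ (by
      rw [SimpleGraph.Walk.length_append, SimpleGraph.Walk.length_cons]; omega)
    have h2 : (w.append (q.cons hd.1)).IsPath := SimpleGraph.Walk.isPath_of_length_eq_dist _ (by
      rw [SimpleGraph.Walk.length_append, SimpleGraph.Walk.length_cons]; omega)
    have h3 := (hG.existsUnique_path r x).unique h1 h2
    -- A common descendant of c and d would have shortest paths from the root through both. Paths in
    -- a tree are unique, so the vertices just after v agree.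
    have h4 := congrArg (fun z => z.getVert (w.length + 1)) h3
    simp only [SimpleGraph.Walk.getVert_append] at h4
    simp at h4
    exact hcd h4

namespace ChildSystem

variable {G : SimpleGraph V} (hG : G.IsTree) (r : V)

lemma ofTree_adj {v c : V} (h : c ∈ (ofTree hG r).kids v) : G.Adj v c := by
  simp only [ofTree, Finset.mem_filter] at h
  exact h.2.1

lemma ofTree_kids_or {u v : V} (h : G.Adj u v) :
    v ∈ (ofTree hG r).kids u ∨ u ∈ (ofTree hG r).kids v := by
  simp only [ofTree, Finset.mem_filter, Finset.mem_univ, true_and]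
  rcases hG.dist_eq_dist_add_one_of_adj r h with h1 | h1
  · exact Or.inr ⟨h.symm, h1⟩
  · exact Or.inl ⟨h, h1⟩

lemma ofTree_mem_desc (x : V) : x ∈ (ofTree hG r).desc r := by
  simp [ofTree]

lemma ofTree_size : (ofTree hG r).size r = Fintype.card V := by
  rw [size, Finset.eq_univ_iff_forall.2 (ofTree_mem_desc hG r), Finset.card_univ]

end ChildSystem

end OfTree

/-! ### Local and global planarity -/

namespace ChildSystem

variable {V : Type*} [DecidableEq V] (S : ChildSystem V)

/-- `pos` draws the vertices in `D` and the edges between them without overlaps. -/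
structure Straight (pos : V → ℤ × ℤ) (D : Finset V) : Prop where
  inj : ∀ x ∈ D, ∀ y ∈ D, x ≠ y → pos x ≠ pos y
  vertex : ∀ x ∈ D, ∀ c ∈ S.kids x, c ∈ D → ∀ w ∈ D, w ≠ x → w ≠ c →
    toPlane (pos w) ∉ seg (pos x) (pos c)
  planar : ∀ x ∈ D, ∀ c ∈ S.kids x, c ∈ D → ∀ y ∈ D, ∀ d ∈ S.kids y, d ∈ D → ¬(x = y ∧ c = d) →
    seg (pos x) (pos c) ∩ seg (pos y) (pos d) ⊆
      (fun w => toPlane (pos w)) '' (({x, c} : Set V) ∩ {y, d})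

variable {S} {pos : V → ℤ × ℤ}

lemma kid_mem_of_mem_desc {v x c : V} (hx : x ∈ S.desc v) (hc : c ∈ S.kids x) : c ∈ S.desc v :=
  S.kid_mem_desc_of_mem hx hc

lemma left_mem_seg (p q : ℤ × ℤ) : toPlane p ∈ seg p q := left_mem_segment ℝ _ _

lemma right_mem_seg (p q : ℤ × ℤ) : toPlane q ∈ seg p q := right_mem_segment ℝ _ _

lemma seg_comm (p q : ℤ × ℤ) : seg p q = seg q p := segment_symm ℝ _ _

lemma Local.notMem_supp {v : V} {B : Finset V} (h : S.Local pos v B) {c : V} (hc : c ∈ B) :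
    toPlane (pos v) ∉ S.supp pos c := fun hm =>
  (h.1 c hc).1 (toPlane_injective ((h.1 c hc).2 ⟨left_mem_seg _ _, hm⟩))

lemma Local.disjoint_supp {v : V} {B : Finset V} (h : S.Local pos v B) {c d : V} (hc : c ∈ B)
    (hd : d ∈ B) (hcd : c ≠ d) {p : ℝ × ℝ} (hp : p ∈ S.supp pos c) : p ∉ S.arm pos v d := by
  intro hq
  have := h.2 c hc d hd hcd ⟨Or.inr hp, hq⟩
  rw [Set.mem_singleton_iff] at this
  exact h.notMem_supp hc (this ▸ hp)

/-- A drawing that is planar at each vertex is planar. -/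
lemma Plane.straight {v : V} (h : S.Plane pos v) : S.Straight pos (S.desc v) := by
  induction hn : S.size v using Nat.strong_induction_on generalizing v with
  | _ n ih =>
  have ih' : ∀ c ∈ S.kids v, S.Straight pos (S.desc c) := fun c hc =>
    ih _ (hn ▸ S.size_kid_lt hc) ((S.plane_iff.1 h).2 c hc) rfl
  have hl := (S.plane_iff.1 h).1
  have inj : ∀ x ∈ S.desc v, ∀ y ∈ S.desc v, x ≠ y → pos x ≠ pos y := by
    intro x hx y hy hxy he
    rcases S.mem_desc.1 hx with rfl | ⟨c, hc, hx'⟩ <;>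
      rcases S.mem_desc.1 hy with rfl | ⟨d, hd, hy'⟩
    · exact hxy rfl
    · exact hl.notMem_supp hd (he ▸ S.mem_supp_of_mem hy')
    · exact hl.notMem_supp hc (he ▸ S.mem_supp_of_mem hx')
    · by_cases hcd : c = d
      · subst hcd; exact (ih' c hc).inj x hx' y hy' hxy he
      · exact hl.disjoint_supp hc hd hcd (S.mem_supp_of_mem hx')
          (Or.inr (he ▸ S.mem_supp_of_mem hy'))
  have vertex : ∀ x ∈ S.desc v, ∀ c ∈ S.kids x, ∀ w ∈ S.desc v, w ≠ x → w ≠ c →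
      toPlane (pos w) ∉ seg (pos x) (pos c) := by
    intro x hx c hc w hw hwx hwc hm
    rcases S.mem_desc.1 hx with rfl | ⟨e, he, hx'⟩ <;>
      rcases S.mem_desc.1 hw with rfl | ⟨d, hd, hw'⟩
    · exact hwx rfl
    · by_cases hcd : d = c
      · subst hcd
        exact inj w hw d (S.kid_mem_desc hd) hwc
          (toPlane_injective ((hl.1 d hd).2 ⟨hm, S.mem_supp_of_mem hw'⟩))
      · exact hl.disjoint_supp hd hc hcd (S.mem_supp_of_mem hw') (Or.inl hm)
    · exact hl.notMem_supp he (S.seg_subset_supp hx' hc hm)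
    · by_cases hed : e = d
      · subst hed
        exact (ih' e he).vertex x hx' c hc (kid_mem_of_mem_desc hx' hc) w hw' hwx hwc hm
      · exact hl.disjoint_supp he hd hed (S.seg_subset_supp hx' hc hm)
          (Or.inr (S.mem_supp_of_mem hw'))
  -- The mixed case: an edge from v to its child c can meet an edge inside a subtree only at c, and
  -- c must then be an endpoint of that edge.
  have half : ∀ c ∈ S.kids v, ∀ e ∈ S.kids v, ∀ y ∈ S.desc e, ∀ d ∈ S.kids y,
      ∀ p ∈ seg (pos v) (pos c), p ∈ seg (pos y) (pos d) →
      p = toPlane (pos c) ∧ (c = y ∨ c = d) := by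
    intro c hc e he y hy d hd p hp hq
    by_cases hec : e = c
    · subst hec
      have h1 : p = toPlane (pos e) := (hl.1 e hc).2 ⟨hp, S.seg_subset_supp hy hd hq⟩
      refine ⟨h1, ?_⟩
      by_contra! hne
      exact vertex y (S.desc_subset_of_kid hc hy) d hd e (S.kid_mem_desc hc) hne.1 hne.2 (h1 ▸ hq)
    · exact absurd (Or.inl hp) (hl.disjoint_supp he hc hec (S.seg_subset_supp hy hd hq))
  refine ⟨inj, fun x hx c hc _ => vertex x hx c hc, ?_⟩
  intro x hx c hc _ y hy d hd _ hne p hp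
  rcases S.mem_desc.1 hx with rfl | ⟨e, he, hx'⟩ <;>
    rcases S.mem_desc.1 hy with rfl | ⟨f, hf, hy'⟩
  · have hcd : c ≠ d := fun h => hne ⟨rfl, h⟩
    have h1 := hl.2 c hc d hd hcd ⟨Or.inl hp.1, Or.inl hp.2⟩
    exact ⟨_, ⟨Or.inl rfl, Or.inl rfl⟩, (Set.mem_singleton_iff.1 h1).symm⟩
  · obtain ⟨h1, h2⟩ := half c hc f hf y hy' d hd p hp.1 hp.2
    exact ⟨c, ⟨Or.inr rfl, h2⟩, h1.symm⟩
  · obtain ⟨h1, h2⟩ := half d hd e he x hx' c hc p hp.2 hp.1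
    exact ⟨d, ⟨h2, Or.inr rfl⟩, h1.symm⟩
  · by_cases hef : e = f
    · subst hef
      exact (ih' e he).planar x hx' c hc (kid_mem_of_mem_desc hx' hc) y hy' d hd
        (kid_mem_of_mem_desc hy' hd) hne hp
    · exact absurd (Or.inr (S.seg_subset_supp hy' hd hp.2))
        (hl.disjoint_supp he hf hef (S.seg_subset_supp hx' hc hp.1))

lemma Straight.isStraightLineDrawing {D : Finset V} (h : S.Straight pos D) (hD : ∀ x, x ∈ D)
    {G : SimpleGraph V} (hG : ∀ u v, G.Adj u v → v ∈ S.kids u ∨ u ∈ S.kids v) :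
    IsStraightLineDrawing G pos := by
  refine ⟨fun x y hxy => by_contra fun hne => h.inj x (hD x) y (hD y) hne hxy, ?_, ?_⟩
  · intro u v w huv hwu hwv
    rcases hG u v huv with hk | hk
    · exact h.vertex u (hD u) v hk (hD v) w (hD w) hwu hwv
    · rw [seg_comm]
      exact h.vertex v (hD v) u hk (hD u) w (hD w) hwv hwu
  · have key : ∀ u v x y : V, v ∈ S.kids u → y ∈ S.kids x → s(u, v) ≠ s(x, y) →
        seg (pos u) (pos v) ∩ seg (pos x) (pos y) ⊆
          (fun w => toPlane (pos w)) '' (({u, v} : Set V) ∩ {x, y}) := by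
      intro u v x y hv hy hne
      refine h.planar u (hD u) v hv (hD v) x (hD x) y hy (hD y) fun he => hne ?_
      rw [he.1, he.2]
    intro u v x y huv hxy hne
    rcases hG u v huv with hv | hv <;> rcases hG x y hxy with hy | hy
    · exact key u v x y hv hy hne
    · rw [seg_comm (pos x), Set.pair_comm x]
      exact key u v y x hv hy (by rwa [Sym2.eq_swap (a := y)])
    · rw [seg_comm (pos u), Set.pair_comm u]
      exact key v u x y hv hy (by rwa [Sym2.eq_swap (a := v)])
    · rw [seg_comm (pos u), seg_comm (pos x), Set.pair_comm u, Set.pair_comm x]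
      exact key v u y x hv hy (by rwa [Sym2.eq_swap (a := v), Sym2.eq_swap (a := y)])

lemma exists_parent {v c z : V} (hc : c ∈ S.kids v) (hz : z ∈ S.desc c) :
    ∃ y ∈ insert v (S.desc c), z ∈ S.kids y := by
  induction hn : S.size c using Nat.strong_induction_on generalizing v c with
  | _ n ih =>
    rcases S.mem_desc.1 hz with rfl | ⟨d, hd, hz⟩
    · exact ⟨v, Finset.mem_insert_self _ _, hc⟩
    · obtain ⟨y, hy, h⟩ := ih _ (hn ▸ S.size_kid_lt hd) hd hz rfl
      refine ⟨y, Finset.mem_insert_of_mem ?_, h⟩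
      rcases Finset.mem_insert.1 hy with rfl | hy
      · exact S.self_mem _
      · exact S.desc_subset_of_kid hd hy

/-- In an arm every vertex below v lies on the edge to its parent, so edges cover everything and
overlaps of arms reduce to overlaps of edges. -/
lemma exists_edge_of_mem_arm {v c : V} (hc : c ∈ S.kids v) {p : ℝ × ℝ} (hp : p ∈ S.arm pos v c) :
    ∃ y ∈ insert v (S.desc c), ∃ z ∈ S.desc c, z ∈ S.kids y ∧ p ∈ seg (pos y) (pos z) := by
  rcases hp with hp | hp
  · exact ⟨v, Finset.mem_insert_self _ _, c, S.self_mem c, hc, hp⟩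
  · simp only [supp, Set.mem_iUnion] at hp
    obtain ⟨x, hx, hp | hp⟩ := hp
    · obtain ⟨y, hy, h⟩ := exists_parent hc hx
      exact ⟨y, hy, x, hx, h, by rw [hp]; exact right_mem_seg _ _⟩
    · simp only [Set.mem_iUnion] at hp
      obtain ⟨d, hd, hp⟩ := hp
      exact ⟨x, Finset.mem_insert_of_mem hx, d, kid_mem_of_mem_desc hx hd, hd, hp⟩

/-- The converse of `Plane.straight`, needed to use the drawings of the given algorithm. Two edges
from different arms meet only in a common endpoint; as the subtrees are disjoint, that is v. -/
lemma Straight.local {D : Finset V} (h : S.Straight pos D) {v : V} {B : Finset V}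
    (hB : B ⊆ S.kids v) (hv : v ∈ D) (hD : ∀ c ∈ B, S.desc c ⊆ D) : S.Local pos v B := by
  refine ⟨fun c hc => ?_, fun c hc d hd hcd p hp => ?_⟩
  · have hvc : ∀ x ∈ S.desc c, x ≠ v := fun x hx => ne_of_mem_desc_kid (hB hc) hx
    have hcD := hD c hc (S.self_mem c)
    refine ⟨h.inj v hv c hcD (hvc c (S.self_mem c)).symm, ?_⟩
    rintro p ⟨hp, hq⟩
    simp only [supp, Set.mem_iUnion] at hq
    obtain ⟨x, hx, hq | hq⟩ := hq
    · by_contra hne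
      have hxc : x ≠ c := by rintro rfl; exact hne hq
      exact h.vertex v hv c (hB hc) hcD x (hD c hc hx) (hvc x hx) hxc (hq ▸ hp)
    · simp only [Set.mem_iUnion] at hq
      obtain ⟨d, hd, hq⟩ := hq
      have hdc := kid_mem_of_mem_desc hx hd
      obtain ⟨w, ⟨hw1, hw2⟩, rfl⟩ := h.planar v hv c (hB hc) hcD x (hD c hc hx) d hd (hD c hc hdc)
        (fun he => hvc x hx he.1.symm) ⟨hp, hq⟩
      have hwv : w ≠ v := by
        rcases hw2 with rfl | rfl
        · exact hvc w hx
        · exact hvc w hdc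
      rcases hw1 with rfl | rfl
      · exact absurd rfl hwv
      · rfl
  · obtain ⟨y, hy, z, hz, hzy, hpz⟩ := exists_edge_of_mem_arm (hB hc) hp.1
    obtain ⟨y', hy', z', hz', hzy', hpz'⟩ := exists_edge_of_mem_arm (hB hd) hp.2
    have hdis := Finset.disjoint_left.1 (S.disj v c (hB hc) d (hB hd) hcd)
    have hmem : ∀ e ∈ B, ∀ w ∈ insert v (S.desc e), w ∈ D := by
      intro e he w hw
      rcases Finset.mem_insert.1 hw with rfl | hw
      · exact hv
      · exact hD e he hw
    obtain ⟨w, ⟨hw1, hw2⟩, rfl⟩ := h.planar y (hmem c hc y hy) z hzy (hD c hc hz) y'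
      (hmem d hd y' hy') z' hzy' (hD d hd hz') (fun he => hdis hz (he.2 ▸ hz')) ⟨hpz, hpz'⟩
    have h1 : w ∈ insert v (S.desc c) := by
      rcases hw1 with rfl | rfl
      · exact hy
      · exact Finset.mem_insert_of_mem hz
    have h2 : w ∈ insert v (S.desc d) := by
      rcases hw2 with rfl | rfl
      · exact hy'
      · exact Finset.mem_insert_of_mem hz'
    rcases Finset.mem_insert.1 h1 with rfl | h1
    · rfl
    · rcases Finset.mem_insert.1 h2 with rfl | h2
      · rfl
      · exact absurd h2 (hdis h1)

end ChildSystem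

/-! ### Reversing the vertical axis, and bounding boxes -/

/-- The reflection `(x, y) ↦ (x - q.1, q.2 - y)`, which reverses the second axis. -/
def reflect (q : ℤ × ℤ) : ℝ × ℝ →ᵃ[ℝ] ℝ × ℝ where
  toFun p := (p.1 - q.1, q.2 - p.2)
  linear :=
    { toFun := fun p => (p.1, -p.2)
      map_add' := fun p p' => by ext <;> simp; ring
      map_smul' := fun a p => by ext <;> simp }
  map_vadd' p p' := by ext <;> simp <;> ring

lemma reflect_injective (q : ℤ × ℤ) : Function.Injective (reflect q) := by
  intro p p' h
  have h1 : p.1 - q.1 = p'.1 - q.1 := congrArg Prod.fst h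
  have h2 : q.2 - p.2 = q.2 - p'.2 := congrArg Prod.snd h
  ext <;> linarith

lemma toPlane_reflect (q p : ℤ × ℤ) :
    toPlane (p.1 - q.1, q.2 - p.2) = reflect q (toPlane p) := by
  simp [toPlane, reflect]

lemma IsStraightLineDrawing.reflect {V : Type*} {G : SimpleGraph V} {pos : V → ℤ × ℤ}
    (h : IsStraightLineDrawing G pos) (q : ℤ × ℤ) :
    IsStraightLineDrawing G fun x => ((pos x).1 - q.1, q.2 - (pos x).2) := by
  have hseg : ∀ p p' : ℤ × ℤ, seg (p.1 - q.1, q.2 - p.2) (p'.1 - q.1, q.2 - p'.2) =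
      TreeDrawing.reflect q '' seg p p' := fun p p' => by
    unfold seg
    rw [toPlane_reflect, toPlane_reflect, image_segment]
  refine ⟨fun x y hxy => h.injective ?_, fun u v w huv hu hv => ?_, fun u v x y huv hxy hne => ?_⟩
  · simp only [Prod.mk.injEq] at hxy
    ext <;> omega
  · rw [hseg, toPlane_reflect, (reflect_injective q).mem_set_image]
    exact h.vertex_notMem_edge u v w huv hu hv
  · rw [hseg, hseg, ← Set.image_inter (reflect_injective q)]
    simp only [toPlane_reflect]
    rw [← Set.image_image (TreeDrawing.reflect q) (fun w => toPlane (pos w))]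
    exact Set.image_mono (h.planar u v x y huv hxy hne)

section BoundingBox

variable {V : Type*} [Finite V] (pos : V → ℤ × ℤ)

lemma bddAbove_fst : BddAbove (Set.range fun v => (pos v).1) := (Set.finite_range _).bddAbove
lemma bddBelow_fst : BddBelow (Set.range fun v => (pos v).1) := (Set.finite_range _).bddBelow
lemma bddAbove_snd : BddAbove (Set.range fun v => (pos v).2) := (Set.finite_range _).bddAbove
lemma bddBelow_snd : BddBelow (Set.range fun v => (pos v).2) := (Set.finite_range _).bddBelow

variable {pos}

lemma boundingBox_of_forall {r : V} (hr : pos r = 0) {W H : ℕ}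
    (h : ∀ v, 0 ≤ (pos v).1 ∧ (pos v).1 ≤ W - 1 ∧ (pos v).2 ≤ 0 ∧ -(pos v).2 ≤ H - 1) :
    AtTopLeft pos r ∧ width pos ≤ W ∧ height pos ≤ H := by
  have : Nonempty V := ⟨r⟩
  have h1 : (⨅ v, (pos v).1) = 0 := le_antisymm
    ((ciInf_le (bddBelow_fst pos) r).trans (by rw [hr]; rfl)) (le_ciInf fun v => (h v).1)
  have h2 : (⨆ v, (pos v).2) = 0 := le_antisymm (ciSup_le fun v => (h v).2.2.1)
    (le_trans (by rw [hr]; rfl) (le_ciSup (bddAbove_snd pos) r))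
  have h3 : (⨆ v, (pos v).1) ≤ W - 1 := ciSup_le fun v => (h v).2.1
  have h4 : -((H : ℤ) - 1) ≤ ⨅ v, (pos v).2 := le_ciInf fun v => by have := (h v).2.2.2; omega
  refine ⟨⟨by rw [h1, hr]; rfl, by rw [h2, hr]; rfl⟩, ?_, ?_⟩
  · rw [width, h1]; omega
  · rw [height, h2]; omega

lemma AtTopLeft.bounds {r : V} (h : AtTopLeft pos r) (v : V) :
    0 ≤ (pos v).1 - (pos r).1 ∧ (pos v).1 - (pos r).1 ≤ width pos - 1 ∧
      0 ≤ (pos r).2 - (pos v).2 ∧ (pos r).2 - (pos v).2 ≤ height pos - 1 := by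
  have h1 := ciInf_le (bddBelow_fst pos) v
  have h2 := le_ciSup (bddAbove_fst pos) v
  have h3 := ciInf_le (bddBelow_snd pos) v
  have h4 := le_ciSup (bddAbove_snd pos) v
  rw [h.1, h.2, width, height]
  refine ⟨?_, ?_, ?_, ?_⟩ <;> omega

lemma one_le_height [Nonempty V] : 1 ≤ height pos := by
  obtain ⟨v⟩ := ‹Nonempty V›
  have h3 := ciInf_le (bddBelow_snd pos) v
  have h4 := le_ciSup (bddAbove_snd pos) v
  rw [height]
  omega

end BoundingBox

/-! ### Translation between drawings of trees and drawings of stars -/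

namespace ChildSystem

lemma convex_box (W H : ℕ) : Convex ℝ (Box W H) := by
  have : Box W H = Set.Icc ((0, 0) : ℝ × ℝ) ((W : ℝ) - 1, (H : ℝ) - 1) := by
    ext p
    simp only [Box, Set.mem_Icc, Prod.le_def, Set.mem_ofPred_eq]
    tauto
  rw [this]
  exact convex_Icc _ _

section

variable {V : Type*} [DecidableEq V] {S : ChildSystem V}

lemma starSupp_subset_box {pos : V → ℤ × ℤ} {v : V} {B : Finset V} (hB : B ⊆ S.kids v) {W H : ℕ}
    (hv : toPlane (pos v) ∈ Box W H) (h : ∀ c ∈ B, ∀ x ∈ S.desc c, toPlane (pos x) ∈ Box W H) :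
    S.starSupp pos v B ⊆ Box W H := by
  rintro p (hp | hp)
  · rw [hp]; exact hv
  · simp only [Set.mem_iUnion] at hp
    obtain ⟨c, hc, hp⟩ := hp
    obtain ⟨y, hy, z, hz, -, hp⟩ := exists_edge_of_mem_arm (hB hc) hp
    refine (convex_box W H).segment_subset ?_ (h c hc z hz) hp
    rcases Finset.mem_insert.1 hy with rfl | hy
    · exact hv
    · exact h c hc y hy

/-- Turns drawings of subtrees into drawings of trees. -/
lemma Draw.exists_drawing [Finite V] {G : SimpleGraph V} {r : V} {W H : ℕ} (h : S.Draw r W H)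
    (hr : ∀ x, x ∈ S.desc r) (hG : ∀ u v, G.Adj u v → v ∈ S.kids u ∨ u ∈ S.kids v) :
    ∃ pos : V → ℤ × ℤ, IsStraightLineDrawing G pos ∧ AtTopLeft pos r ∧ width pos ≤ W ∧
      height pos ≤ H := by
  obtain ⟨pos, h1, h2, h3, h4⟩ := h
  have hp : S.Plane pos r := S.plane_iff.2 ⟨h2, h3⟩
  rw [← S.supp_eq] at h4
  refine ⟨_, (hp.straight.isStraightLineDrawing hr hG).reflect 0, boundingBox_of_forall
    (by simp [h1]) fun v => ?_⟩
  obtain ⟨e1, e2, e3, e4⟩ := h4 (S.mem_supp_of_mem (hr v))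
  simp only [toPlane] at e1 e2 e3 e4
  have e1' : 0 ≤ (pos v).1 := by exact_mod_cast e1
  have e2' : (pos v).1 ≤ W - 1 := by exact_mod_cast e2
  have e3' : 0 ≤ (pos v).2 := by exact_mod_cast e3
  have e4' : (pos v).2 ≤ H - 1 := by exact_mod_cast e4
  refine ⟨?_, ?_, ?_, ?_⟩ <;> simp <;> omega

lemma induce_reachable {G : SimpleGraph V} (hS : ∀ v c, c ∈ S.kids v → G.Adj v c) (D : Set V)
    {x y : V} (hxD : ∀ z ∈ S.desc x, z ∈ D) (hy : y ∈ S.desc x) :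
    (G.induce D).Reachable ⟨x, hxD x (S.self_mem x)⟩ ⟨y, hxD y hy⟩ := by
  induction hn : S.size x using Nat.strong_induction_on generalizing x with
  | _ n ih =>
    rcases S.mem_desc.1 hy with rfl | ⟨c, hc, hyc⟩
    · exact SimpleGraph.Reachable.refl _
    · have h1 := ih _ (hn ▸ S.size_kid_lt hc)
        (fun z hz => hxD z (S.desc_subset_of_kid hc hz)) hyc rfl
      refine SimpleGraph.Reachable.trans (SimpleGraph.Adj.reachable ?_) h1
      exact hS x c hc

/-- Turns drawings of trees into drawings of stars of subtrees. -/
lemma exists_tree_starDraw {G : SimpleGraph V} (hG : G.IsAcyclic)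
    (hS : ∀ v c, c ∈ S.kids v → G.Adj v c) {v : V} {B : Finset V} (hB : B ⊆ S.kids v) :
    ∃ T : LabelledTree (1 + ∑ c ∈ B, S.size c), ∀ (pos : Fin (1 + ∑ c ∈ B, S.size c) → ℤ × ℤ)
      (W H : ℕ), IsStraightLineDrawing T.graph pos → AtTopLeft pos T.root → width pos ≤ W →
      height pos ≤ H → S.StarDraw v B (Box W H) := by
  set D : Finset V := insert v (B.biUnion S.desc) with hD
  have hcard : D.card = 1 + ∑ c ∈ B, S.size c := by
    rw [hD, Finset.card_insert_of_notMem, Finset.card_biUnion, add_comm]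
    · rfl
    · exact fun c hc d hd h => S.disj v c (hB hc) d (hB hd) h
    · simp only [Finset.mem_biUnion, not_exists, not_and]
      exact fun c hc => S.notMem v c (hB hc)
  have hvD : v ∈ D := Finset.mem_insert_self _ _
  have hBD : ∀ c ∈ B, S.desc c ⊆ D := fun c hc x hx =>
    Finset.mem_insert_of_mem (Finset.mem_biUnion.2 ⟨c, hc, hx⟩)
  let e := (Finset.equivFinOfCardEq hcard).symm
  have hconn : (G.induce (D : Set V)).Connected := by
    rw [SimpleGraph.connected_iff_exists_forall_reachable]
    refine ⟨⟨v, hvD⟩, ?_⟩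
    rintro ⟨x, hx⟩
    rcases Finset.mem_insert.1 hx with rfl | hx'
    · exact SimpleGraph.Reachable.refl _
    · obtain ⟨c, hc, hxc⟩ := Finset.mem_biUnion.1 hx'
      refine SimpleGraph.Reachable.trans (SimpleGraph.Adj.reachable ?_)
        (induce_reachable hS (D : Set V) (fun z hz => hBD c hc hz) hxc)
      exact hS v c (hB hc)
  have hconn' : ((G.induce (D : Set V)).comap e).Connected :=
    (SimpleGraph.Iso.comap e (G.induce (D : Set V))).connected_iff.2 hconn
  have hacyc : ((G.induce (D : Set V)).comap e).IsAcyclic :=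
    SimpleGraph.IsAcyclic.of_comap e.toEmbedding (hG.induce _)
  -- The star is itself a rooted tree, the subgraph induced on D, relabelled so that an algorithm
  -- can be applied to it.
  refine ⟨⟨(G.induce (D : Set V)).comap e, ⟨hconn', hacyc⟩, e.symm ⟨v, hvD⟩⟩, ?_⟩
  intro pos W H h1 h2 h3 h4
  set q := pos (e.symm ⟨v, hvD⟩) with hq
  have h5 := h1.reflect q
  set pos₁ : Fin (1 + ∑ c ∈ B, S.size c) → ℤ × ℤ := fun x => ((pos x).1 - q.1, q.2 - (pos x).2)
  let ι : Fin (1 + ∑ c ∈ B, S.size c) → V := fun i => e i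
  have hι : Function.Injective ι := Subtype.val_injective.comp e.injective
  let p : V → ℤ × ℤ := Function.extend ι pos₁ 0
  have hp : ∀ i, p (ι i) = pos₁ i := hι.extend_apply pos₁ 0
  have hιs : ∀ x ∈ D, ∃ i, ι i = x := fun x hx => ⟨e.symm ⟨x, hx⟩, by simp [ι]⟩
  have hst : S.Straight p D := by
    refine ⟨fun x hx y hy hxy => ?_, fun x hx c hc hcD w hw hwx hwc => ?_,
      fun x hx c hc hcD y hy d hd hdD hne => ?_⟩
    · obtain ⟨i, rfl⟩ := hιs x hx
      obtain ⟨j, rfl⟩ := hιs y hy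
      rw [hp, hp]
      exact fun h => hxy (congrArg ι (h5.injective h))
    · obtain ⟨i, rfl⟩ := hιs x hx
      obtain ⟨j, rfl⟩ := hιs c hcD
      obtain ⟨k, rfl⟩ := hιs w hw
      rw [hp, hp, hp]
      exact h5.vertex_notMem_edge i j k (hS _ _ hc) (fun h => hwx (congrArg ι h))
        (fun h => hwc (congrArg ι h))
    · obtain ⟨i, rfl⟩ := hιs x hx
      obtain ⟨j, rfl⟩ := hιs c hcD
      obtain ⟨k, rfl⟩ := hιs y hy
      obtain ⟨l, rfl⟩ := hιs d hdD
      rw [hp, hp, hp, hp]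
      refine (h5.planar i j k l (hS _ _ hc) (hS _ _ hd) ?_).trans ?_
      · intro he
        rcases Sym2.eq_iff.1 he with ⟨rfl, rfl⟩ | ⟨rfl, rfl⟩
        · exact hne ⟨rfl, rfl⟩
        · exact S.notMem _ _ hc (S.kid_mem_desc hd)
      · rintro _ ⟨w, ⟨hw1, hw2⟩, rfl⟩
        refine ⟨ι w, ⟨?_, ?_⟩, by simp only [hp]⟩
        · rcases hw1 with rfl | rfl <;> simp
        · rcases hw2 with rfl | rfl <;> simp
  have hbox : ∀ x ∈ D, toPlane (p x) ∈ Box W H := by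
    intro x hx
    obtain ⟨i, rfl⟩ := hιs x hx
    rw [hp]
    obtain ⟨b1, b2, b3, b4⟩ := h2.bounds i
    have b2' := b2.trans (sub_le_sub_right h3 1)
    have b4' := b4.trans (sub_le_sub_right h4 1)
    exact ⟨by simp only [toPlane]; exact_mod_cast b1, by simp only [toPlane]; exact_mod_cast b2',
      by simp only [toPlane]; exact_mod_cast b3, by simp only [toPlane]; exact_mod_cast b4'⟩
  refine ⟨p, ?_, hst.local hB hvD hBD, fun c hc x hx => hst.local subset_rfl (hBD c hc hx)
    fun d hd => (S.desc_subset (kid_mem_of_mem_desc hx hd)).trans (hBD c hc), ?_⟩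
  · obtain ⟨i, hi⟩ := hιs v hvD
    have hi' : i = e.symm ⟨v, hvD⟩ := by
      rw [Equiv.eq_symm_apply]; exact Subtype.ext hi
    rw [← hi, hp, hi']
    simp [pos₁, hq]
  · exact starSupp_subset_box hB (hbox v hvD) fun c hc x hx => hbox x (hBD c hc hx)

/-- If f₀(s) ≤ F, the algorithm may be called with a columns, because g₀(m) ≤ g₀(s) ≤ f₀(s) ≤ F ≤ a,
and then f₀(a) ≤ f₀(s) ≤ F bounds the height. If F = s, the conditions force a = m = s and the
trivial square is enough. -/
lemma smallStars_of_isGeneralAlgorithm {G : SimpleGraph V} (hG : G.IsAcyclic)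
    (hS : ∀ v c, c ∈ S.kids v → G.Adj v c) {f₀ g₀ : ℕ → ℝ} (hf : Monotone f₀) (hg : Monotone g₀)
    (hgf : ∀ n, g₀ n ≤ f₀ n) {𝒢₀ : Algorithm} (h𝒢₀ : IsGeneralAlgorithm f₀ g₀ 𝒢₀) {s F : ℕ}
    (hF : 1 ≤ F) (hsF : f₀ s ≤ F ∨ F = s) : S.SmallStars s F := by
  intro v B hB hm a hFa ham
  have ha : 0 < a := by omega
  rcases hsF with hsF | rfl
  · by_cases h2 : 2 ≤ 1 + ∑ c ∈ B, S.size c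
    · obtain ⟨T, hT⟩ := exists_tree_starDraw hG hS hB
      have hFa' : (F : ℝ) ≤ a := by exact_mod_cast hFa
      obtain ⟨h3, h4, h5, h6⟩ := h𝒢₀ _ a T h2 ha ham
        (((hg hm).trans (hgf s)).trans (hsF.trans hFa'))
      refine hT _ _ _ h3 h4 (by exact_mod_cast h5) ?_
      have h7 : f₀ a ≤ F := (hf (ham.trans hm)).trans hsF
      have h8 : (height (𝒢₀ _ a T) : ℝ) * a ≤ ((1 + ∑ c ∈ B, S.size c : ℕ) : ℝ) * F := by
        have ha' : (0 : ℝ) < a := by exact_mod_cast ha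
        calc _ ≤ ((1 + ∑ c ∈ B, S.size c : ℕ) : ℝ) / a * f₀ a * a :=
              mul_le_mul_of_nonneg_right h6 ha'.le
          _ = ((1 + ∑ c ∈ B, S.size c : ℕ) : ℝ) * f₀ a := by field_simp
          _ ≤ _ := mul_le_mul_of_nonneg_left h7 (Nat.cast_nonneg _)
      rw [Int.natCast_ediv]
      rw [Int.le_ediv_iff_mul_le (by exact_mod_cast ha)]
      exact_mod_cast h8
    -- The algorithm promises nothing for a single vertex; there the conditions force a = F = 1.
    · have hB0 : B = ∅ := by
        by_contra hne
        obtain ⟨c, hc⟩ := Finset.nonempty_iff_ne_empty.2 hne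
        have h3 := S.size_pos c
        have h4 := Finset.single_le_sum (f := S.size) (fun _ _ => Nat.zero_le _) hc
        omega
      subst hB0
      have ha1 : a = 1 := by simp at ham; omega
      have hF1 : F = 1 := by omega
      refine (S.starDraw_empty v).mono ?_
      rintro p hp
      rw [hp]
      simp [ha1, hF1, Box]
  · have h1 : a = 1 + ∑ c ∈ B, S.size c := by omega
    have h2 : F = 1 + ∑ c ∈ B, S.size c := by omega
    rw [← h1] at h2 ⊢
    rw [h2, Nat.mul_div_cancel _ ha, h1]
    exact starDraw_square hB

end

end ChildSystem

/-! ### The final bounds -/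

lemma natLog_le_logb (n : ℕ) : (Nat.log 2 n : ℝ) ≤ Real.logb 2 n := by
  exact_mod_cast Real.natLog_le_logb n 2

lemma one_le_logb {n : ℕ} (h : 2 ≤ n) : 1 ≤ Real.logb 2 n := by
  have h2 : (2 : ℝ) ≤ n := by exact_mod_cast h
  rw [Real.le_logb_iff_rpow_le one_lt_two (by linarith), Real.rpow_one]
  exact h2

/-- If g₀(2) ≤ 2, the algorithm draws the tree with two vertices for A = 2 in at least one row and
at most f₀(2) rows; otherwise f₀(2) ≥ g₀(2) > 2. This allows constants to be absorbed in f₀(s) for s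
≥ 2. -/
lemma one_le_of_isGeneralAlgorithm {f₀ g₀ : ℕ → ℝ} (hgf : ∀ n, g₀ n ≤ f₀ n) {𝒢₀ : Algorithm}
    (h : IsGeneralAlgorithm f₀ g₀ 𝒢₀) : 1 ≤ f₀ 2 := by
  by_cases h2 : g₀ 2 ≤ (2 : ℕ)
  · have hT : (⊤ : SimpleGraph (Fin 2)).IsTree := by
      rw [SimpleGraph.isTree_iff_connected_and_card]
      refine ⟨SimpleGraph.connected_top, ?_⟩
      rw [Nat.card_eq_fintype_card, ← SimpleGraph.edgeFinset_card,
        SimpleGraph.card_edgeFinset_top_eq_card_choose_two]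
      simp
    obtain ⟨-, -, -, h3⟩ := h 2 2 ⟨⊤, hT, 0⟩ le_rfl one_le_two le_rfl h2
    have h4 : (1 : ℝ) ≤ height (𝒢₀ 2 2 ⟨⊤, hT, 0⟩) := by exact_mod_cast one_le_height
    have h5 : (((2 : ℕ) : ℝ) / (2 : ℕ)) * f₀ 2 = f₀ 2 := by norm_num
    linarith
  · have := hgf 2
    push_cast at h2
    linarith

/-- A tree has a standard drawing, of logarithmic width. -/
lemma LabelledTree.exists_drawing_standard {n : ℕ} (T : LabelledTree n) :
    ∃ pos : Fin n → ℤ × ℤ, IsStraightLineDrawing T.graph pos ∧ AtTopLeft pos T.root ∧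
      (width pos : ℝ) ≤ Real.logb 2 n + 1 ∧ (height pos : ℝ) ≤ n := by
  have h := (ChildSystem.ofTree T.isTree T.root).draw_standard T.root
  rw [ChildSystem.ofTree_size, Fintype.card_fin] at h
  obtain ⟨pos, h1, h2, h3, h4⟩ := h.exists_drawing (ChildSystem.ofTree_mem_desc _ _)
    fun u v huv => ChildSystem.ofTree_kids_or _ _ huv
  have h3' : (width pos : ℝ) ≤ Nat.log 2 n + 1 := by exact_mod_cast h3
  exact ⟨pos, h1, h2, by linarith [natLog_le_logb n], by exact_mod_cast h4⟩

/-- The drawing obtained from a general algorithm for `2 ≤ s ≤ A`. -/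
lemma LabelledTree.exists_drawing {f₀ g₀ : ℕ → ℝ} (hf : Monotone f₀) (hg : Monotone g₀)
    (hgf : ∀ n, g₀ n ≤ f₀ n) {𝒢₀ : Algorithm} (h𝒢₀ : IsGeneralAlgorithm f₀ g₀ 𝒢₀) {s n A : ℕ}
    (hs : 2 ≤ s) (hsA : s ≤ A) (hAn : A ≤ n) (T : LabelledTree n) :
    ∃ pos : Fin n → ℤ × ℤ, IsStraightLineDrawing T.graph pos ∧ AtTopLeft pos T.root ∧
      (width pos : ℝ) ≤ 13 * (A + Real.logb 2 n) ∧
      (height pos : ℝ) ≤ n / A * (5400 * f₀ s + 108 * Real.logb 2 A) + n / s := by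
  have hf1 : 1 ≤ f₀ s := (one_le_of_isGeneralAlgorithm hgf h𝒢₀).trans (hf hs)
  set S := ChildSystem.ofTree T.isTree T.root with hS
  -- Rounding costs at most a factor 2 since f₀(s) ≥ 1. The cap at s provides F ≤ s, as the
  -- recursion requires.
  set F := min ⌈f₀ s⌉₊ s with hF
  have hF1 : 1 ≤ F := le_min (Nat.one_le_ceil_iff.2 (by linarith)) (by omega)
  have hsF : f₀ s ≤ F ∨ F = s := by
    rcases le_total ⌈f₀ s⌉₊ s with h | h
    · left; rw [hF, min_eq_left h]; exact Nat.le_ceil _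
    · right; rw [hF, min_eq_right h]
  have hO : S.SmallStars s F := ChildSystem.smallStars_of_isGeneralAlgorithm T.isTree.isAcyclic
    (fun v c hc => ChildSystem.ofTree_adj _ _ hc) hf hg hgf h𝒢₀ hF1 hsF
  obtain ⟨H, h, hH⟩ := ChildSystem.exists_draw hF1 (min_le_right _ _) hsA hO T.root
  rw [ChildSystem.ofTree_size, Fintype.card_fin] at h hH
  obtain ⟨pos, h1, h2, h3, h4⟩ := h.exists_drawing (ChildSystem.ofTree_mem_desc _ _)
    fun u v huv => ChildSystem.ofTree_kids_or _ _ huv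
  have h3' : (width pos : ℝ) ≤ 12 * A + 1 + Nat.log 2 n := by exact_mod_cast h3
  have h4' : (height pos : ℝ) ≤ H := by exact_mod_cast h4
  have hA : (1 : ℝ) ≤ A := by exact_mod_cast (by omega : 1 ≤ A)
  have hlogn := one_le_logb (n := n) (by omega)
  have hlogA := one_le_logb (n := A) (by omega)
  have hFf : (F : ℝ) ≤ 2 * f₀ s := by
    have e1 : (F : ℝ) ≤ ⌈f₀ s⌉₊ := by exact_mod_cast min_le_left _ _
    have e2 := Nat.ceil_lt_add_one (show 0 ≤ f₀ s by linarith)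
    linarith
  have hnA : (1 : ℝ) ≤ n / A := by
    rw [one_le_div (by linarith)]; exact_mod_cast hAn
  refine ⟨pos, h1, h2, by linarith [natLog_le_logb n], ?_⟩
  refine (h4'.trans hH).trans (add_le_add ?_ le_rfl)
  have e1 : (300 * F + 2 * Nat.log 2 A + 10 : ℝ) ≤ 600 * f₀ s + 12 * Real.logb 2 A := by
    linarith [natLog_le_logb A]
  calc _ ≤ (600 * f₀ s + 12 * Real.logb 2 A) * (9 * (n / A : ℝ)) := by
        refine mul_le_mul e1 ?_ (by positivity) (by linarith)
        rw [mul_div_assoc]; linarith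
    _ = _ := by ring

lemma LabelledTree.exists_drawing_of_isGeneralAlgorithm {f₀ g₀ : ℕ → ℝ} (hf : Monotone f₀)
    (hg : Monotone g₀) (hgf : ∀ n, g₀ n ≤ f₀ n) {𝒢₀ : Algorithm}
    (h𝒢₀ : IsGeneralAlgorithm f₀ g₀ 𝒢₀) {s n A : ℕ} (hs : 1 ≤ s) (hA : 1 ≤ A) (hAn : A ≤ n)
    (hAs : 2 ≤ max A s) (T : LabelledTree n) :
    ∃ pos : Fin n → ℤ × ℤ, IsStraightLineDrawing T.graph pos ∧ AtTopLeft pos T.root ∧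
      (width pos : ℝ) ≤ 5400 * (A + Real.logb 2 n) ∧
      (height pos : ℝ) ≤ 5400 * ((n / A) * Real.logb 2 A + (n / A) * f₀ s * Real.logb 2 s ^ 2 +
        (n / s) * Real.logb 2 A) := by
  have hA' : (1 : ℝ) ≤ A := by exact_mod_cast hA
  have hn' : (1 : ℝ) ≤ n := by exact_mod_cast hA.trans hAn
  have hs' : (1 : ℝ) ≤ s := by exact_mod_cast hs
  have hln : 0 ≤ Real.logb 2 n := Real.logb_nonneg one_lt_two hn'
  have hlA : 0 ≤ Real.logb 2 A := Real.logb_nonneg one_lt_two hA'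
  have hf2 := one_le_of_isGeneralAlgorithm hgf h𝒢₀
  -- Here (n/s) log A ≥ n, so the standard drawing of height n is good enough.
  by_cases hs1 : s = 1
  · subst hs1
    have hlA1 := one_le_logb (n := A) (by omega)
    obtain ⟨pos, h1, h2, h3, h4⟩ := T.exists_drawing_standard
    refine ⟨pos, h1, h2, by linarith, h4.trans ?_⟩
    have e1 : (n : ℝ) ≤ n * Real.logb 2 A := le_mul_of_one_le_right (by linarith) hlA1
    have e2 : (0 : ℝ) ≤ n / A * Real.logb 2 A := by positivity
    simp only [Nat.cast_one, Real.logb_one, div_one]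
    nlinarith
  have hs2 : 2 ≤ s := by omega
  have hls := one_le_logb hs2
  have hfs : 1 ≤ f₀ s := hf2.trans (hf hs2)
  have hls2 : 1 ≤ Real.logb 2 s ^ 2 := one_le_pow₀ hls
  have hmain : (n : ℝ) / A ≤ n / A * f₀ s := le_mul_of_one_le_right (by positivity) hfs
  have hmain' : (n : ℝ) / A * f₀ s ≤ n / A * f₀ s * Real.logb 2 s ^ 2 :=
    le_mul_of_one_le_right (by positivity) hls2
  -- Here the logarithms of A vanish, but (n/A) f₀(s) ≥ n.
  by_cases hA1 : A = 1
  · subst hA1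
    obtain ⟨pos, h1, h2, h3, h4⟩ := T.exists_drawing_standard
    refine ⟨pos, h1, h2, by push_cast; linarith, h4.trans ?_⟩
    simp only [Nat.cast_one, Real.logb_one, div_one] at hmain hmain' ⊢
    linarith
  have hlA1 := one_le_logb (n := A) (by omega)
  -- Lowering s to min(s, A) does not increase f₀, and n / min(s, A) ≤ n/s + n/A is absorbed by the
  -- terms with log A.
  obtain ⟨pos, h1, h2, h3, h4⟩ := T.exists_drawing hf hg hgf h𝒢₀ (s := min s A) (by omega)
    (min_le_right _ _) hAn
  refine ⟨pos, h1, h2, by linarith, h4.trans ?_⟩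
  have e1 : f₀ (min s A) ≤ f₀ s := hf (min_le_left _ _)
  have e2 : (n : ℝ) / (min s A : ℕ) ≤ n / s + n / A := by
    have p1 : (0 : ℝ) ≤ n / s := by positivity
    have p2 : (0 : ℝ) ≤ n / A := by positivity
    rcases min_choice s A with h | h <;> rw [h] <;> linarith
  have e3 : (n : ℝ) / A * (5400 * f₀ (min s A)) ≤ n / A * (5400 * f₀ s) :=
    mul_le_mul_of_nonneg_left (by linarith) (by positivity)
  have e4 : (n : ℝ) / s ≤ n / s * Real.logb 2 A := le_mul_of_one_le_right (by positivity) hlA1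
  have e5 : (n : ℝ) / A ≤ n / A * Real.logb 2 A := le_mul_of_one_le_right (by positivity) hlA1
  have p1 : (0 : ℝ) ≤ n / s := by positivity
  have p2 : (0 : ℝ) ≤ n / A := by positivity
  rw [mul_add]
  linarith

end TreeDrawing

theorem mainTheorem10 :
    ∃ C : ℝ, 0 < C ∧
      ∀ (f₀ g₀ : ℕ → ℝ), Monotone f₀ → Monotone g₀ → (∀ n, g₀ n ≤ f₀ n) →
      ∀ 𝒢₀ : TreeDrawing.Algorithm, TreeDrawing.IsGeneralAlgorithm f₀ g₀ 𝒢₀ →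
      ∀ s : ℕ, 1 ≤ s →
      ∃ 𝒢 : TreeDrawing.Algorithm,
        ∀ (n A : ℕ) (T : TreeDrawing.LabelledTree n), 1 ≤ A → A ≤ n → 2 ≤ max A s →
          Real.logb 2 s ≤ (A : ℝ) →
          𝒢.Draws A T
            (C * ((A : ℝ) + Real.logb 2 n))
            (C * (((n : ℝ) / A) * Real.logb 2 A
              + ((n : ℝ) / A) * f₀ s * (Real.logb 2 s) ^ 2
              + ((n : ℝ) / s) * Real.logb 2 A)) := by
  classical
  refine ⟨5400, by norm_num, fun f₀ g₀ hf hg hgf 𝒢₀ h𝒢₀ s hs => ?_⟩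
  have key : ∀ (n A : ℕ) (T : TreeDrawing.LabelledTree n), ∃ pos : Fin n → ℤ × ℤ,
      1 ≤ A → A ≤ n → 2 ≤ max A s → Real.logb 2 s ≤ (A : ℝ) →
      TreeDrawing.IsStraightLineDrawing T.graph pos ∧ TreeDrawing.AtTopLeft pos T.root ∧
      (TreeDrawing.width pos : ℝ) ≤ 5400 * (A + Real.logb 2 n) ∧
      (TreeDrawing.height pos : ℝ) ≤ 5400 * ((n / A) * Real.logb 2 A +
        (n / A) * f₀ s * Real.logb 2 s ^ 2 + (n / s) * Real.logb 2 A) := by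
    intro n A T
    by_cases h : 1 ≤ A ∧ A ≤ n ∧ 2 ≤ max A s ∧ Real.logb 2 s ≤ (A : ℝ)
    · obtain ⟨h1, h2, h3, -⟩ := h
      obtain ⟨pos, hpos⟩ := T.exists_drawing_of_isGeneralAlgorithm hf hg hgf h𝒢₀ hs h1 h2 h3
      exact ⟨pos, fun _ _ _ _ => hpos⟩
    -- Outside the admissible range the output is arbitrary; this makes the chosen algorithm a total
    -- function.
    · exact ⟨0, fun h1 h2 h3 h4 => absurd ⟨h1, h2, h3, h4⟩ h⟩
  choose 𝒢 h𝒢 using key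
  exact ⟨𝒢, fun n A T h1 h2 h3 h4 => h𝒢 n A T h1 h2 h3 h4⟩
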